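/- Let $\alpha_1,\alpha_2,\alpha_3,\beta$ be Hermitian $4\times4$ Dirac matrices ($\alpha_j\alpha_k+\alpha_k\alpha_j=2\delta_{jk}$, $\alpha_j\beta+\beta\alpha_j=0$, $\beta^2=1$), let $m>0$, and let $D=-i\vec\alpha\cdot\vec\partial+\beta m$ be the free Dirac Hamiltonian on $\mathcal H=L^2(\mathbb R^3,\mathbb C^4)$. Let $P$ be the projection onto the spectral subspace of $D$ for the positive half axis and $Q=1-P$. For a real potential $A=(A^0,\vec A)$ write $\slashed A=A^0+\vec\alpha\cdot\vec A$, regarded as a matrix-valued multiplication operator on $\mathcal H$. For a smooth time-dependent potential $A(t)$ of compact spatial support, which vanishes for $t<-\epsilon$ and is constant for $t>0$, let $V_t(A)$ be the unitary operator given by the norm convergent Dyson series $$V_t(A)=\sum_{n\ge0} i^n\int_{t_1<\dots<t_n<t} \slashed A_I(t_1)\cdots\slashed A_I(t_n)\,dt_1\cdots dt_n,\qquad \slashed A_I(s)=e^{isD}\slashed A(s)e^{-isD},$$ and let (all integrals of operators being taken in the strong sense) $$\mathcal K=\int_{-\epsilon}^0 V_s(A)\,e^{isD}\,\dot{\slashed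 A}(s)\,e^{-isD}\,V_s(A)^{-1}\,ds .$$ For a time-independent potential put $\|\slashed A\|_\ast=\max(\|\hat{\slashed A}\|_{L^1},\|\hat{\slashed A}\|_{L^2})$, where $\hat{\slashed A}(\xi)=\int_{\mathbb R^3} e^{-2\pi i x\cdot\xi}\slashed A(x)\,dx$ is the Fourier transform and matrices are measured in the operator norm. **Lemma.** For every compact set $S\subset\mathbb R^3$ there is $\delta>0$ (depending only on $S$, $m$ and the Dirac matrices) such that the following holds. Let $A$ be a smooth time-independent potential with support in $S$ and $\|\slashed A\|_\ast<\delta$. Let $h:\mathbb R\to\mathbb R$ be smooth with $h(t)=0$ for $t<-1$, $h(t)=1$ for $t>0$ and $\dot h\ge0$. For $\mathcal T>0$ let $\slashed A_{\mathcal T}(t)=h(t/\mathcal T)\slashed A$, and let $\mathcal K$ be the operator above for $\slashed A_{\mathcal T}$ with $\epsilon=\mathcal T$. Then there is a constant $C>0$, independent of $\mathcal T$, such that $P\mathcal KQ$ is Hilbert–Schmidt with $$\|P\mathcal KQ\|_{HS}\le \frac{C}{\mathcal T^2}\qquad\text{for all }\mathcal T>0,$$ and hence $\|P\mathcal KQ\|_{HS}\to0$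 as $\mathcal T\to\infty$. -/

import Mathlib

open MeasureTheory Filter Topology
open scoped FourierTransform ContDiff ENNReal

noncomputable section

namespace DiracSwitching

/-! ### The one-particle space and the Dirac matrices -/

/-- Physical space `ℝ³`; the same type is used for momenta. -/
abbrev Space : Type := EuclideanSpace ℝ (Fin 3)

/-- The spinor space `ℂ⁴`. -/
abbrev Spinor : Type := EuclideanSpace ℂ (Fin 4)

/-- Linear operators on `ℂ⁴`, with the operator norm. -/
abbrev SpinorOp : Type := Spinor →L[ℂ] Spinor

/-- The one-particle Hilbert space `L²(ℝ³, ℂ⁴)`. -/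
abbrev OneParticle : Type := Lp Spinor 2 (volume : Measure Space)

/-- A choice of Hermitian Dirac matrices `α₁, α₂, α₃, β`: Hermitian `4 × 4` matrices that satisfy
the anticommutation relations. -/
structure DiracMatrices where
  α : Fin 3 → Matrix (Fin 4) (Fin 4) ℂ
  β : Matrix (Fin 4) (Fin 4) ℂ
  α_hermitian : ∀ j, (α j).IsHermitian
  β_hermitian : β.IsHermitian
  α_anticomm : ∀ j k, α j * α k + α k * α j = if j = k then 2 else 0
  αβ_anticomm : ∀ j, α j * β + β * α j = 0
  β_sq : β * β = 1

/-- The standard (Dirac-Pauli) representation. -/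
def DiracMatrices.standard : DiracMatrices where
  α := ![!![0, 0, 0, 1; 0, 0, 1, 0; 0, 1, 0, 0; 1, 0, 0, 0],
    !![0, 0, 0, -Complex.I; 0, 0, Complex.I, 0; 0, -Complex.I, 0, 0; Complex.I, 0, 0, 0],
    !![0, 0, 1, 0; 0, 0, 0, -1; 1, 0, 0, 0; 0, -1, 0, 0]]
  β := !![1, 0, 0, 0; 0, 1, 0, 0; 0, 0, -1, 0; 0, 0, 0, -1]
  α_hermitian := by
    intro j
    fin_cases j <;> ext a b <;> fin_cases a <;> fin_cases b <;> simp [Matrix.conjTranspose_apply]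
  β_hermitian := by
    ext a b
    fin_cases a <;> fin_cases b <;> simp [Matrix.conjTranspose_apply]
  α_anticomm := by
    have h0 : (0 : Matrix (Fin 4) (Fin 4) ℂ) =
        !![0, 0, 0, 0; 0, 0, 0, 0; 0, 0, 0, 0; 0, 0, 0, 0] := by
      ext a b; fin_cases a <;> fin_cases b <;> rfl
    have h2 : (2 : Matrix (Fin 4) (Fin 4) ℂ) =
        !![2, 0, 0, 0; 0, 2, 0, 0; 0, 0, 2, 0; 0, 0, 0, 2] := by
      rw [← Matrix.diagonal_ofNat]
      ext a b; fin_cases a <;> fin_cases b <;> rfl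
    simp [Fin.forall_fin_succ, h2, Matrix.cons_mul, Matrix.vecMul_cons, h0]
    norm_num
  αβ_anticomm := by
    have h0 : (0 : Matrix (Fin 4) (Fin 4) ℂ) =
        !![0, 0, 0, 0; 0, 0, 0, 0; 0, 0, 0, 0; 0, 0, 0, 0] := by
      ext a b; fin_cases a <;> fin_cases b <;> rfl
    simp [Fin.forall_fin_succ, Matrix.cons_mul, Matrix.vecMul_cons, h0]
  β_sq := by
    have h1 : (1 : Matrix (Fin 4) (Fin 4) ℂ) =
        !![1, 0, 0, 0; 0, 1, 0, 0; 0, 0, 1, 0; 0, 0, 0, 1] := by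
      rw [← Matrix.diagonal_one]
      ext a b; fin_cases a <;> fin_cases b <;> rfl
    simp [Matrix.cons_mul, Matrix.vecMul_cons, h1]

namespace DiracMatrices

/-- The Dirac slash `a⁰ + α · a` of a real four-vector `a = (a⁰, a¹, a², a³)`. -/
def slash (G : DiracMatrices) (a : Fin 4 → ℝ) : SpinorOp :=
  Matrix.toEuclideanCLM (𝕜 := ℂ)
    ((a 0 : ℂ) • (1 : Matrix (Fin 4) (Fin 4) ℂ) + ∑ j : Fin 3, (a j.succ : ℂ) • G.α j)

/-- The symbol `d(p) = α · p + β m` of the free Dirac Hamiltonian `D = -i α · ∂ + β m`. -/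
def symbol (G : DiracMatrices) (m : ℝ) (p : Space) : SpinorOp :=
  Matrix.toEuclideanCLM (𝕜 := ℂ) (∑ j : Fin 3, (p j : ℂ) • G.α j + (m : ℂ) • G.β)

end DiracMatrices

/-- The relativistic energy `ω(p) = √(|p|² + m²)`. -/
def energy (m : ℝ) (p : Space) : ℝ := Real.sqrt (‖p‖ ^ 2 + m ^ 2)

/-! ### Multiplication operators and Fourier multipliers -/

open Classical in
/-- The operator on `L²(ℝ³, ℂ⁴)` of multiplication by an essentially bounded matrix-valued
function (and `0` if `a` is not essentially bounded). -/
def mulOp (a : Space → SpinorOp) : OneParticle →L[ℂ] OneParticle :=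
  if h : MemLp a ⊤ (volume : Measure Space) then
    (ContinuousLinearMap.id ℂ SpinorOp).holderL volume ⊤ 2 2 (h.toLp a)
  else 0

/-- The Fourier multiplier `a(-i∂)`: multiplication by `a(p)` in momentum space. The momentum is
`p = 2πξ` when `ξ` is the variable of the transform `f ↦ ∫ e^{-2πi x·ξ} f(x) dx`. -/
def fourierMultiplier (a : Space → SpinorOp) : OneParticle →L[ℂ] OneParticle :=
  (Lp.fourierTransformₗᵢ Space Spinor).symm.toContinuousLinearEquiv.toContinuousLinearMap ∘L
    mulOp (fun ξ => a ((2 * Real.pi) • ξ)) ∘L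
      (Lp.fourierTransformₗᵢ Space Spinor).toContinuousLinearEquiv.toContinuousLinearMap

/-- The free unitary group `e^{itD}`, `D = -i α · ∂ + β m`. -/
def freeEvolution (G : DiracMatrices) (m t : ℝ) : OneParticle →L[ℂ] OneParticle :=
  fourierMultiplier fun p => NormedSpace.exp ((Complex.I * (t : ℂ)) • G.symbol m p)

/-- The projection `P` onto the spectral subspace of `D` for the positive half axis. The matrix
`d(p)` is Hermitian with `d(p)² = ω(p)²`, so that `(1 + d(p)/ω(p))/2` is its spectral projection for
the positive half axis. -/
def posProj (G : DiracMatrices) (m : ℝ) : OneParticle →L[ℂ] OneParticle :=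
  fourierMultiplier fun p => (2⁻¹ : ℂ) • (1 + ((energy m p : ℂ))⁻¹ • G.symbol m p)

/-- The complementary projection `Q = 1 - P`. -/
def negProj (G : DiracMatrices) (m : ℝ) : OneParticle →L[ℂ] OneParticle := 1 - posProj G m

/-! ### The Dyson series and the operator `𝒦` -/

open Classical in
/-- The strong integral of an operator-valued function: the operator `f ↦ ∫ F(t) f dμ(t)`
(and `0` if this does not define a bounded operator). -/
def strongIntegral (μ : Measure ℝ) (F : ℝ → OneParticle →L[ℂ] OneParticle) :
    OneParticle →L[ℂ] OneParticle :=
  if h : ∃ S : OneParticle →L[ℂ] OneParticle,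
      ∀ f, Integrable (fun t => F t f) μ ∧ S f = ∫ t, F t f ∂μ
  then h.choose else 0

/-- A time-dependent electromagnetic potential `(t, x) ↦ A(t, x) = (A⁰, A¹, A², A³)`. -/
abbrev TimePotential : Type := ℝ → Space → Fin 4 → ℝ

/-- The slashed potential at time `t`, as a multiplication operator. -/
def slashOp (G : DiracMatrices) (A : TimePotential) (t : ℝ) : OneParticle →L[ℂ] OneParticle :=
  mulOp fun x => G.slash (A t x)

/-- The time derivative of a potential. -/
def timeDeriv (A : TimePotential) : TimePotential := fun t x μ => deriv (fun s => A s x μ) t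

/-- The slashed potential in the interaction picture, `e^{itD} A(t) e^{-itD}`. -/
def interactionPicture (G : DiracMatrices) (m : ℝ) (A : TimePotential) (t : ℝ) :
    OneParticle →L[ℂ] OneParticle :=
  freeEvolution G m t ∘L slashOp G A t ∘L freeEvolution G m (-t)

/-- The `n`-th term `iⁿ ∫_{t₁ < ⋯ < tₙ < t} B(t₁) ⋯ B(tₙ) dt₁ ⋯ dtₙ` of the Dyson series of an
operator-valued function `B`, as an iterated integral whose outermost variable is `tₙ`. -/
def dysonTerm (B : ℝ → OneParticle →L[ℂ] OneParticle) :
    ℕ → ℝ → OneParticle →L[ℂ] OneParticle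
  | 0, _ => 1
  | n + 1, t => Complex.I • strongIntegral (volume.restrict (Set.Iic t))
      (fun s => dysonTerm B n s ∘L B s)

/-- The unitary `V_t(A)`: the sum of the (norm convergent) Dyson series of the potential in the
interaction picture. -/
def dysonV (G : DiracMatrices) (m : ℝ) (A : TimePotential) (t : ℝ) :
    OneParticle →L[ℂ] OneParticle :=
  ∑' n, dysonTerm (interactionPicture G m A) n t

/-- `𝒦 = ∫_{-ε}^0 V_s(A) e^{isD} A'(s) e^{-isD} V_s(A)⁻¹ ds`, where `A'` is the (slashed) time
derivative of `A`; the inverse of the unitary `V_s(A)` is its adjoint. -/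
def smoothedInteraction (G : DiracMatrices) (m ε : ℝ) (A : TimePotential) :
    OneParticle →L[ℂ] OneParticle :=
  strongIntegral (volume.restrict (Set.Icc (-ε) 0)) fun s =>
    dysonV G m A s ∘L interactionPicture G m (timeDeriv A) s ∘L
      ContinuousLinearMap.adjoint (dysonV G m A s)

/-- The switched potential `A_𝒯(t, x) = h(t/𝒯) A(x)`. -/
def switched (h : ℝ → ℝ) (T : ℝ) (A : Space → Fin 4 → ℝ) : TimePotential :=
  fun t x μ => h (t / T) * A x μ

/-! ### Norms -/

/-- The Hilbert-Schmidt norm `(∑ᵢ ‖S eᵢ‖²)^{1/2} ∈ [0, ∞]`, for some orthonormal (Hilbert) basis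
`(eᵢ)`; it is finite exactly for Hilbert-Schmidt operators. -/
def hsNorm (S : OneParticle →L[ℂ] OneParticle) : ℝ≥0∞ :=
  (∑' e : (exists_hilbertBasis ℂ OneParticle).choose, ‖S (e : OneParticle)‖ₑ ^ 2) ^ (1 / 2 : ℝ)

/-- The norm `max (‖â‖_{L¹}, ‖â‖_{L²})` of a matrix-valued function `a` on `ℝ³`, where `â` is the
Fourier transform of `a` and matrices are measured in the operator norm. -/
def fourierNorm (a : Space → SpinorOp) : ℝ≥0∞ :=
  max (eLpNorm (𝓕 a) 1 volume) (eLpNorm (𝓕 a) 2 volume)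

/-! ### Well-definedness

The default values `0` in the definitions above do not occur for the objects of interest. -/

theorem mulOp_coeFn {a : Space → SpinorOp} (ha : MemLp a ⊤ (volume : Measure Space))
    (f : OneParticle) : mulOp a f =ᵐ[volume] fun x => a x (f x) := by
  rw [mulOp, dif_pos ha, ContinuousLinearMap.holderL_apply_apply]
  filter_upwards [ContinuousLinearMap.coeFn_holder (r := 2) (ContinuousLinearMap.id ℂ SpinorOp)
    (ha.toLp a) f, ha.coeFn_toLp] with x h1 h2
  rw [h1, h2]; rfl

theorem mulOp_norm_le {a : Space → SpinorOp} {M : ℝ} (hM : 0 ≤ M)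
    (hb : ∀ x, ‖a x‖ ≤ M) : ‖mulOp a‖ ≤ M := by
  by_cases ha : MemLp a ⊤ (volume : Measure Space)
  · refine ContinuousLinearMap.opNorm_le_bound _ hM fun f => ?_
    refine Lp.norm_le_mul_norm_of_ae_le_mul ?_
    filter_upwards [mulOp_coeFn ha f] with x hx
    rw [hx]
    exact (a x).le_of_opNorm_le (hb x) _
  · rw [mulOp, dif_neg ha]; simpa using hM

theorem mulOp_strongly_continuous {a : ℝ → Space → SpinorOp} {M : ℝ}
    (hb : ∀ t x, ‖a t x‖ ≤ M) (hx : ∀ t, Continuous (a t)) (ht : ∀ x, Continuous fun t => a t x)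
    (f : OneParticle) : Continuous fun t => mulOp (a t) f := by
  have hmem : ∀ t, MemLp (a t) ⊤ (volume : Measure Space) := fun t =>
    memLp_top_of_bound (hx t).aestronglyMeasurable M (ae_of_all _ (hb t))
  rw [continuous_iff_seqContinuous]
  intro u t0 hu
  have hM : 0 ≤ M := (norm_nonneg _).trans (hb 0 0)
  rw [Function.comp_def, Lp.tendsto_Lp_iff_tendsto_eLpNorm']
  have e1 : ∀ n, eLpNorm (⇑(mulOp (a (u n)) f) - ⇑(mulOp (a t0) f)) 2 volume
      = (∫⁻ x, ‖(a (u n) x - a t0 x) (f x)‖ₑ ^ (2 : ℝ)) ^ (1 / 2 : ℝ) := by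
    intro n
    rw [eLpNorm_congr_ae (g := fun x => (a (u n) x - a t0 x) (f x)),
      eLpNorm_eq_lintegral_rpow_enorm_toReal (by norm_num) (by norm_num)]
    · simp
    · filter_upwards [mulOp_coeFn (hmem (u n)) f, mulOp_coeFn (hmem t0) f] with x h1 h2
      simp [h1, h2]
  have hz : (0 : ℝ≥0∞) = (∫⁻ _ : Space, 0) ^ (1 / 2 : ℝ) := by simp
  simp only [e1]
  rw [hz]
  refine (ENNReal.continuous_rpow_const.tendsto _).comp ?_
  refine tendsto_lintegral_of_dominated_convergence'
    (fun x => (ENNReal.ofReal (2 * M) * ‖f x‖ₑ) ^ (2 : ℝ)) ?_ ?_ ?_ ?_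
  · intro n
    refine AEMeasurable.pow_const ?_ _
    refine AEStronglyMeasurable.enorm ?_
    exact ((ContinuousLinearMap.id ℂ SpinorOp).aestronglyMeasurable_comp₂
      (((hx (u n)).sub (hx t0)).aestronglyMeasurable) (Lp.aestronglyMeasurable f))
  · intro n
    refine ae_of_all _ fun x => ENNReal.rpow_le_rpow ?_ (by norm_num)
    rw [← ofReal_norm, ← ofReal_norm, ← ENNReal.ofReal_mul (by positivity)]
    refine ENNReal.ofReal_le_ofReal ?_
    refine ContinuousLinearMap.le_of_opNorm_le _ ?_ _
    exact (norm_sub_le _ _).trans (by linarith [hb (u n) x, hb t0 x])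
  · have h2 := (Lp.memLp f).const_smul (2 * M)
    have h3 := lintegral_rpow_enorm_lt_top_of_eLpNorm_lt_top (by norm_num) (by norm_num) h2.2
    refine ne_of_lt (lt_of_le_of_lt (le_of_eq ?_) h3)
    refine lintegral_congr fun x => ?_
    simp only [Pi.smul_apply, enorm_smul]
    rw [← ofReal_norm (2 * M), Real.norm_of_nonneg (by positivity)]
    simp
  · refine ae_of_all _ fun x => ?_
    have : Tendsto (fun n => (a (u n) x - a t0 x) (f x)) atTop (𝓝 ((a t0 x - a t0 x) (f x))) := by
      have h1 : Tendsto (fun n => a (u n) x - a t0 x) atTop (𝓝 (a t0 x - a t0 x)) :=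
        (((ht x).tendsto t0).comp hu).sub tendsto_const_nhds
      exact ((ContinuousLinearMap.apply ℂ Spinor (f x)).continuous.tendsto _).comp h1
    have h2 := (ENNReal.continuous_rpow_const (y := (2:ℝ))).tendsto _ |>.comp
      ((continuous_enorm.tendsto _).comp this)
    simpa [Function.comp_def] using h2

theorem symbol_selfAdjoint (G : DiracMatrices) (m : ℝ) (p : Space) :
    IsSelfAdjoint (G.symbol m p) := by
  rw [DiracMatrices.symbol]
  refine IsSelfAdjoint.map ?_ _
  rw [isSelfAdjoint_iff, Matrix.star_eq_conjTranspose]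
  simp [Matrix.conjTranspose_add, Matrix.conjTranspose_sum, Matrix.conjTranspose_smul,
    (G.α_hermitian _).eq, G.β_hermitian.eq]

theorem symbol_continuous (G : DiracMatrices) (m : ℝ) : Continuous (G.symbol m) := by
  unfold DiracMatrices.symbol
  refine (LinearMap.continuous_of_finiteDimensional
    (Matrix.toEuclideanCLM (n := Fin 4) (𝕜 := ℂ)).toAlgEquiv.toLinearMap).comp ?_
  fun_prop

theorem symbol_sq (G : DiracMatrices) (m : ℝ) (p : Space) :
    G.symbol m p * G.symbol m p = ((energy m p : ℂ) ^ 2) • 1 := by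
  have hn : (energy m p) ^ 2 = p 0 ^ 2 + p 1 ^ 2 + p 2 ^ 2 + m ^ 2 := by
    rw [energy, Real.sq_sqrt (by positivity), EuclideanSpace.real_norm_sq_eq, Fin.sum_univ_three]
  have hsq : ∀ j, G.α j * G.α j = 1 := by
    intro j
    have h1 := G.α_anticomm j j
    rw [if_pos rfl, ← two_smul ℂ, ← mul_one (2 : Matrix (Fin 4) (Fin 4) ℂ)] at h1
    have h2 : (2 : Matrix (Fin 4) (Fin 4) ℂ) * 1 = (2 : ℂ) • 1 := by
      rw [two_smul]; norm_num
    rw [h2] at h1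
    exact smul_right_injective _ (two_ne_zero (α := ℂ)) h1
  have h10 : G.α 1 * G.α 0 = -(G.α 0 * G.α 1) := by
    have := G.α_anticomm 1 0
    rw [if_neg (by decide)] at this
    exact eq_neg_of_add_eq_zero_left this
  have h20 : G.α 2 * G.α 0 = -(G.α 0 * G.α 2) := by
    have := G.α_anticomm 2 0
    rw [if_neg (by decide)] at this
    exact eq_neg_of_add_eq_zero_left this
  have h21 : G.α 2 * G.α 1 = -(G.α 1 * G.α 2) := by
    have := G.α_anticomm 2 1
    rw [if_neg (by decide)] at this
    exact eq_neg_of_add_eq_zero_left this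
  have hb : ∀ j, G.β * G.α j = -(G.α j * G.β) := fun j =>
    eq_neg_of_add_eq_zero_right (G.αβ_anticomm j)
  have hn' : ((energy m p : ℂ)) ^ 2 = (p 0 : ℂ) ^ 2 + (p 1 : ℂ) ^ 2 + (p 2 : ℂ) ^ 2 + (m : ℂ) ^ 2 := by
    exact_mod_cast hn
  rw [DiracMatrices.symbol, ← map_mul, hn', ← map_one (Matrix.toEuclideanCLM (𝕜 := ℂ)), ← map_smul]
  congr 1
  simp only [Fin.sum_univ_three, add_mul, mul_add, smul_mul_assoc, mul_smul_comm, hsq, h10, h20,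
    h21, hb, G.β_sq]
  module

theorem norm_exp_I_smul_le {d : SpinorOp} (hd : IsSelfAdjoint d) :
    ‖NormedSpace.exp (Complex.I • d)‖ ≤ 1 := by
  have e : ((selfAdjoint.expUnitary (⟨d, hd⟩ : selfAdjoint SpinorOp) : unitary SpinorOp) : SpinorOp)
      = NormedSpace.exp (Complex.I • d) := selfAdjoint.expUnitary_coe _
  rw [← e]
  exact (CStarRing.norm_coe_unitary _).le

theorem evolSymbol_norm_le (G : DiracMatrices) (m t : ℝ) (p : Space) :
    ‖NormedSpace.exp ((Complex.I * (t : ℂ)) • G.symbol m p)‖ ≤ 1 := by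
  rw [mul_smul]
  refine norm_exp_I_smul_le ?_
  exact (show IsSelfAdjoint (t : ℂ) by simp [isSelfAdjoint_iff]).smul (symbol_selfAdjoint G m p)

theorem posSymbol_norm_le (G : DiracMatrices) {m : ℝ} (hm : 0 < m) (p : Space) :
    ‖(2⁻¹ : ℂ) • (1 + ((energy m p : ℂ))⁻¹ • G.symbol m p)‖ ≤ 1 := by
  have hω : 0 < energy m p := Real.sqrt_pos.2 (by positivity)
  have h1 : ‖G.symbol m p‖ = energy m p := by
    have h := CStarRing.norm_star_mul_self (x := G.symbol m p)
    rw [(symbol_selfAdjoint G m p).star_eq, symbol_sq, norm_smul, norm_one, mul_one, norm_pow,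
      Complex.norm_real, Real.norm_of_nonneg hω.le, sq] at h
    exact ((mul_self_inj hω.le (norm_nonneg _)).1 h).symm
  calc _ ≤ 2⁻¹ * (1 + (energy m p)⁻¹ * energy m p) := by
        rw [norm_smul]
        gcongr
        · simp
        · refine (norm_add_le _ _).trans ?_
          rw [norm_one, norm_smul, h1, norm_inv, Complex.norm_real, Real.norm_of_nonneg hω.le]
    _ = 1 := by rw [inv_mul_cancel₀ hω.ne']; norm_num

theorem posSymbol_memLp (G : DiracMatrices) {m : ℝ} (hm : 0 < m) :
    MemLp (fun ξ : Space => (2⁻¹ : ℂ) • (1 + ((energy m ((2 * Real.pi) • ξ) : ℂ))⁻¹ •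
      G.symbol m ((2 * Real.pi) • ξ))) ⊤ volume := by
  refine memLp_top_of_bound (Continuous.aestronglyMeasurable ?_) 1
    (ae_of_all _ fun ξ => posSymbol_norm_le G hm _)
  have hs : Continuous fun ξ : Space => G.symbol m ((2 * Real.pi) • ξ) :=
    (symbol_continuous G m).comp (continuous_const_smul _)
  have he : Continuous fun ξ : Space => (energy m ((2 * Real.pi) • ξ) : ℂ) := by
    unfold energy; fun_prop
  refine Continuous.const_smul (continuous_const.add (Continuous.smul
    (he.inv₀ fun ξ => ?_) hs)) (2⁻¹ : ℂ)
  exact_mod_cast (Real.sqrt_pos.2 (by positivity)).ne'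

theorem evolSymbol_continuous (G : DiracMatrices) (m : ℝ) :
    Continuous fun z : ℝ × Space => NormedSpace.exp ((Complex.I * (z.1 : ℂ)) • G.symbol m z.2) := by
  let _ : NormedAlgebra ℚ SpinorOp := NormedAlgebra.restrictScalars ℚ ℂ SpinorOp
  refine NormedSpace.exp_continuous.comp ?_
  have hs := symbol_continuous G m
  fun_prop

theorem freeEvolution_norm_le (G : DiracMatrices) (m t : ℝ) : ‖freeEvolution G m t‖ ≤ 1 := by
  refine ContinuousLinearMap.opNorm_le_bound _ zero_le_one fun f => ?_
  have h := (mulOp_norm_le (a := fun ξ => NormedSpace.exp ((Complex.I * (t : ℂ)) •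
    G.symbol m ((2 * Real.pi) • ξ))) zero_le_one fun ξ => evolSymbol_norm_le G m t _)
  have := ContinuousLinearMap.le_of_opNorm_le _ h (Lp.fourierTransformₗᵢ Space Spinor f)
  rw [LinearIsometryEquiv.norm_map] at this
  simpa [freeEvolution, fourierMultiplier] using this

theorem freeEvolution_continuous (G : DiracMatrices) (m : ℝ) (f : OneParticle) :
    Continuous fun t => freeEvolution G m t f := by
  have h := mulOp_strongly_continuous (M := 1) (a := fun t ξ => NormedSpace.exp
    ((Complex.I * (t : ℂ)) • G.symbol m ((2 * Real.pi) • ξ))) (fun t ξ => evolSymbol_norm_le G m t _)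
    (fun t => (evolSymbol_continuous G m).comp (by fun_prop : Continuous fun ξ : Space =>
      ((t, (2 * Real.pi) • ξ) : ℝ × Space)))
    (fun ξ => (evolSymbol_continuous G m).comp (by fun_prop : Continuous fun t : ℝ =>
      ((t, (2 * Real.pi) • ξ) : ℝ × Space)))
    (Lp.fourierTransformₗᵢ Space Spinor f)
  exact (Lp.fourierTransformₗᵢ Space Spinor).symm.continuous.comp h

theorem strongly_continuous_apply {F : ℝ → OneParticle →L[ℂ] OneParticle} {M : ℝ}
    (hb : ∀ t, ‖F t‖ ≤ M) (hF : ∀ f, Continuous fun t => F t f) {s : Set ℝ} {g : ℝ → OneParticle}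
    (hg : ContinuousOn g s) : ContinuousOn (fun t => F t (g t)) s := by
  intro t ht
  have h1 : Tendsto (fun r => F r (g r - g t)) (𝓝[s] t) (𝓝 0) := by
    refine squeeze_zero_norm (a := fun r => M * ‖g r - g t‖)
      (fun r => ContinuousLinearMap.le_of_opNorm_le _ (hb r) _) ?_
    have h3 : Tendsto g (𝓝[s] t) (𝓝 (g t)) := hg t ht
    have := (h3.sub (tendsto_const_nhds (x := g t))).norm.const_mul M
    simpa only [sub_self, norm_zero, mul_zero] using this
  have h2 := h1.add (((hF (g t)).tendsto t).mono_left nhdsWithin_le_nhds)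
  simpa [ContinuousWithinAt] using h2

theorem strongIntegral_spec {μ : Measure ℝ} {F : ℝ → OneParticle →L[ℂ] OneParticle} {g : ℝ → ℝ}
    (hF : ∀ f, AEStronglyMeasurable (fun t => F t f) μ) (hg : Integrable g μ)
    (hb : ∀ᵐ t ∂μ, ‖F t‖ ≤ g t) (f : OneParticle) :
    Integrable (fun t => F t f) μ ∧ strongIntegral μ F f = ∫ t, F t f ∂μ := by
  have hi : ∀ f, Integrable (fun t => F t f) μ := fun f => by
    refine (hg.mul_const ‖f‖).mono' (hF f) ?_
    filter_upwards [hb] with t ht using ContinuousLinearMap.le_of_opNorm_le _ ht _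
  have h : ∃ S : OneParticle →L[ℂ] OneParticle,
      ∀ f, Integrable (fun t => F t f) μ ∧ S f = ∫ t, F t f ∂μ := by
    refine ⟨LinearMap.mkContinuous
      { toFun := fun f => ∫ t, F t f ∂μ
        map_add' := fun f f' => by
          simp only [map_add]; exact integral_add (hi f) (hi f')
        map_smul' := fun c f => by
          simp only [map_smul, RingHom.id_apply]; exact integral_smul c _ } (∫ t, g t ∂μ)
      fun f => ?_, fun f => ⟨hi f, rfl⟩⟩
    rw [← integral_mul_const]
    refine norm_integral_le_of_norm_le (hg.mul_const _) ?_
    filter_upwards [hb] with t ht using ContinuousLinearMap.le_of_opNorm_le _ ht _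
  rw [strongIntegral, dif_pos h]
  exact h.choose_spec f

theorem integral_weight {M : ℝ} (hM : 0 < M) (c ε t : ℝ) :
    IntegrableOn (fun s => c * M * Real.exp (2 * M * (s + ε))) (Set.Iic t) ∧
      ∫ s in Set.Iic t, c * M * Real.exp (2 * M * (s + ε)) =
        c / 2 * Real.exp (2 * M * (t + ε)) := by
  have e : ∀ s : ℝ, c * M * Real.exp (2 * M * (s + ε)) =
      c * M * Real.exp (2 * M * ε) * Real.exp (2 * M * s) := fun s => by
    rw [mul_assoc _ (Real.exp _) (Real.exp _), ← Real.exp_add]; ring_nf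
  have h2 : 0 < 2 * M := by linarith
  simp only [e]
  refine ⟨(integrableOn_exp_mul_Iic h2 t).const_mul _, ?_⟩
  rw [integral_const_mul, integral_exp_mul_Iic h2]
  have : Real.exp (2 * M * (t + ε)) = Real.exp (2 * M * ε) * Real.exp (2 * M * t) := by
    rw [← Real.exp_add]; ring_nf
  rw [this]
  field_simp

/-- One step of the Dyson recursion. -/
theorem dysonStep {B D : ℝ → OneParticle →L[ℂ] OneParticle} {M ε c : ℝ} (hM : 0 < M) (hc : 0 ≤ c)
    (hb : ∀ t, ‖B t‖ ≤ M) (hB : ∀ f, Continuous fun t => B t f) (h0 : ∀ t, t < -ε → B t = 0)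
    (hD : Continuous D) (hDb : ∀ t, -ε ≤ t → ‖D t‖ ≤ c * Real.exp (2 * M * (t + ε))) :
    Continuous (fun t => strongIntegral (volume.restrict (Set.Iic t)) fun s => D s ∘L B s) ∧
      (∀ t, ‖strongIntegral (volume.restrict (Set.Iic t)) fun s => D s ∘L B s‖ ≤
        c / 2 * Real.exp (2 * M * (t + ε))) ∧
      ∀ t f, IntegrableOn (fun s => D s (B s f)) (Set.Iic t) ∧
        strongIntegral (volume.restrict (Set.Iic t)) (fun s => D s ∘L B s) f =
          ∫ s in Set.Iic t, D s (B s f) := by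
  have hF : ∀ s, ‖D s ∘L B s‖ ≤ c * M * Real.exp (2 * M * (s + ε)) := by
    intro s
    rcases lt_or_ge s (-ε) with hs | hs
    · rw [h0 s hs, ContinuousLinearMap.comp_zero, norm_zero]; positivity
    · calc _ ≤ ‖D s‖ * ‖B s‖ := ContinuousLinearMap.opNorm_comp_le _ _
        _ ≤ (c * Real.exp (2 * M * (s + ε))) * M := by
            gcongr
            exacts [hDb s hs, hb s]
        _ = _ := by ring
  have hcont : ∀ f, Continuous fun s => D s (B s f) := fun f => hD.clm_apply (hB f)
  have key : ∀ t f, IntegrableOn (fun s => D s (B s f)) (Set.Iic t) ∧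
      strongIntegral (volume.restrict (Set.Iic t)) (fun s => D s ∘L B s) f =
        ∫ s in Set.Iic t, D s (B s f) := fun t f => strongIntegral_spec (μ := volume.restrict (Set.Iic t))
    (F := fun s => D s ∘L B s) (fun f => (hcont f).aestronglyMeasurable)
    (integral_weight hM c ε t).1 (ae_of_all _ hF) f
  have hFf : ∀ f s, ‖D s (B s f)‖ ≤ c * M * Real.exp (2 * M * (s + ε)) * ‖f‖ := fun f s =>
    ContinuousLinearMap.le_of_opNorm_le _ (hF s) f
  refine ⟨?_, fun t => ?_, key⟩
  · set W := fun t => strongIntegral (volume.restrict (Set.Iic t)) fun s => D s ∘L B s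
    have hφ : Continuous fun t : ℝ => c / 2 * Real.exp (2 * M * (t + ε)) := by fun_prop
    have hle : ∀ s t, s ≤ t → ‖W t - W s‖ ≤
        |c / 2 * Real.exp (2 * M * (t + ε)) - c / 2 * Real.exp (2 * M * (s + ε))| := by
      intro s t hst
      refine ContinuousLinearMap.opNorm_le_bound _ (abs_nonneg _) fun f => ?_
      rw [sub_apply, (key t f).2, (key s f).2]
      rw [intervalIntegral.integral_Iic_sub_Iic (key s f).1 (key t f).1,
        ← (integral_weight hM c ε t).2, ← (integral_weight hM c ε s).2,
        intervalIntegral.integral_Iic_sub_Iic (integral_weight hM c ε s).1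
          (integral_weight hM c ε t).1]
      refine (intervalIntegral.norm_integral_le_of_norm_le hst (ae_of_all _ fun r _ => hFf f r)
        ((Continuous.intervalIntegrable (by fun_prop) _ _))).trans ?_
      rw [intervalIntegral.integral_mul_const]
      exact mul_le_mul_of_nonneg_right (le_abs_self _) (norm_nonneg _)
    rw [continuous_iff_continuousAt]
    intro t
    rw [ContinuousAt, tendsto_iff_norm_sub_tendsto_zero]
    have h3 : Tendsto (fun r : ℝ => |c / 2 * Real.exp (2 * M * (r + ε)) -
        c / 2 * Real.exp (2 * M * (t + ε))|) (𝓝 t) (𝓝 0) := by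
      have := ((hφ.tendsto t).sub (tendsto_const_nhds
        (x := c / 2 * Real.exp (2 * M * (t + ε))))).abs
      simpa only [sub_self, abs_zero] using this
    refine squeeze_zero (fun _ => norm_nonneg _) (fun r => ?_) h3
    rcases le_total t r with h | h
    · exact hle t r h
    · rw [norm_sub_rev, abs_sub_comm]; exact hle r t h
  · refine ContinuousLinearMap.opNorm_le_bound _ (by positivity) fun f => ?_
    rw [(key t f).2, ← (integral_weight hM c ε t).2, ← integral_mul_const]
    exact norm_integral_le_of_norm_le ((integral_weight hM c ε t).1.mul_const _)
      (ae_of_all _ (hFf f))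

/-- The Dyson series of a bounded strongly continuous `B` that vanishes at early times: its terms
are norm continuous and geometrically small. -/
theorem dysonTerm_bound {B : ℝ → OneParticle →L[ℂ] OneParticle} {M ε : ℝ} (hM : 0 < M)
    (hb : ∀ t, ‖B t‖ ≤ M) (hB : ∀ f, Continuous fun t => B t f) (h0 : ∀ t, t < -ε → B t = 0)
    (n : ℕ) :
    Continuous (dysonTerm B n) ∧
      ∀ t, -ε ≤ t → ‖dysonTerm B n t‖ ≤ (1 / 2) ^ n * Real.exp (2 * M * (t + ε)) := by
  induction n with
  | zero =>
    refine ⟨continuous_const, fun t ht => ?_⟩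
    have h1 : (1 : ℝ) ≤ Real.exp (2 * M * (t + ε)) :=
      Real.one_le_exp (mul_nonneg (by linarith) (by linarith))
    rw [pow_zero, one_mul]
    exact ContinuousLinearMap.norm_id_le.trans h1
  | succ n ih =>
    have h := dysonStep hM (by positivity) hb hB h0 ih.1 ih.2
    refine ⟨h.1.const_smul Complex.I, fun t _ => ?_⟩
    rw [dysonTerm, norm_smul, Complex.norm_I, one_mul]
    refine (h.2.1 t).trans (le_of_eq ?_)
    ring

theorem dysonTerm_succ_apply {B : ℝ → OneParticle →L[ℂ] OneParticle} {M ε : ℝ} (hM : 0 < M)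
    (hb : ∀ t, ‖B t‖ ≤ M) (hB : ∀ f, Continuous fun t => B t f) (h0 : ∀ t, t < -ε → B t = 0)
    (n : ℕ) (t : ℝ) (f : OneParticle) :
    IntegrableOn (fun s => dysonTerm B n s (B s f)) (Set.Iic t) ∧
      dysonTerm B (n + 1) t f = Complex.I • ∫ s in Set.Iic t, dysonTerm B n s (B s f) := by
  have ih := dysonTerm_bound hM hb hB h0 n
  have h := (dysonStep hM (by positivity) hb hB h0 ih.1 ih.2).2.2 t f
  exact ⟨h.1, by rw [dysonTerm, smul_apply, h.2]⟩

/-- The Dyson series converges in norm, and its sum is norm continuous from the switching time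
on. -/
theorem dyson_summable {B : ℝ → OneParticle →L[ℂ] OneParticle} {M ε : ℝ} (hM : 0 < M)
    (hb : ∀ t, ‖B t‖ ≤ M) (hB : ∀ f, Continuous fun t => B t f) (h0 : ∀ t, t < -ε → B t = 0)
    (b : ℝ) :
    (∀ t ∈ Set.Icc (-ε) b, Summable fun n => dysonTerm B n t) ∧
      ContinuousOn (fun t => ∑' n, dysonTerm B n t) (Set.Icc (-ε) b) := by
  have hle : ∀ n, ∀ t ∈ Set.Icc (-ε) b,
      ‖dysonTerm B n t‖ ≤ (1 / 2) ^ n * Real.exp (2 * M * (b + ε)) := fun n t ht =>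
    ((dysonTerm_bound hM hb hB h0 n).2 t ht.1).trans (by gcongr; exact ht.2)
  have hs : Summable fun n : ℕ => (1 / 2 : ℝ) ^ n * Real.exp (2 * M * (b + ε)) :=
    (summable_geometric_of_lt_one (by norm_num) (by norm_num)).mul_right _
  exact ⟨fun t ht => Summable.of_norm_bounded hs fun n => hle n t ht,
    continuousOn_tsum (fun n => (dysonTerm_bound hM hb hB h0 n).1.continuousOn) hs hle⟩

theorem slash_continuous (G : DiracMatrices) : Continuous G.slash := by
  unfold DiracMatrices.slash
  refine (LinearMap.continuous_of_finiteDimensional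
    (Matrix.toEuclideanCLM (n := Fin 4) (𝕜 := ℂ)).toAlgEquiv.toLinearMap).comp ?_
  fun_prop

theorem interactionPicture_spec (G : DiracMatrices) (m : ℝ) {A : TimePotential} {M : ℝ}
    (hA : ∀ t x, ‖G.slash (A t x)‖ ≤ M) (hx : ∀ t, Continuous (A t))
    (ht : ∀ x, Continuous fun t => A t x) :
    (∀ t, ‖interactionPicture G m A t‖ ≤ M) ∧
      ∀ f, Continuous fun t => interactionPicture G m A t f := by
  have hM : 0 ≤ M := (norm_nonneg _).trans (hA 0 0)
  have h1 : ∀ t, ‖slashOp G A t‖ ≤ M := fun t => mulOp_norm_le hM (hA t)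
  have h2 : ∀ f, Continuous fun t => slashOp G A t f := mulOp_strongly_continuous hA
    (fun t => (slash_continuous G).comp (hx t)) (fun x => (slash_continuous G).comp (ht x))
  refine ⟨fun t => ?_, fun f => ?_⟩
  · calc _ ≤ ‖freeEvolution G m t‖ * (‖slashOp G A t‖ * ‖freeEvolution G m (-t)‖) :=
          (ContinuousLinearMap.opNorm_comp_le _ _).trans
            (mul_le_mul_of_nonneg_left (ContinuousLinearMap.opNorm_comp_le _ _) (norm_nonneg _))
      _ ≤ 1 * (M * 1) := by
          gcongr
          exacts [freeEvolution_norm_le G m t, h1 t, freeEvolution_norm_le G m (-t)]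
      _ = M := by ring
  · have h3 : Continuous fun t => freeEvolution G m (-t) f :=
      (freeEvolution_continuous G m f).comp continuous_neg
    rw [← continuousOn_univ]
    exact strongly_continuous_apply (freeEvolution_norm_le G m) (freeEvolution_continuous G m)
      (strongly_continuous_apply h1 h2 h3.continuousOn)

/-- The strong integral that defines `𝒦` exists for bounded continuous potentials with bounded
continuous time derivative which vanish before the time `-ε`. -/
theorem smoothedInteraction_apply (G : DiracMatrices) (m ε : ℝ) {A : TimePotential} {M M' : ℝ}
    (hA : ∀ t x, ‖G.slash (A t x)‖ ≤ M) (hx : ∀ t, Continuous (A t))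
    (ht : ∀ x, Continuous fun t => A t x) (h0 : ∀ t, t < -ε → ∀ x, A t x = 0)
    (hA' : ∀ t x, ‖G.slash (timeDeriv A t x)‖ ≤ M') (hx' : ∀ t, Continuous (timeDeriv A t))
    (ht' : ∀ x, Continuous fun t => timeDeriv A t x) (f : OneParticle) :
    IntegrableOn (fun s => dysonV G m A s (interactionPicture G m (timeDeriv A) s
        (ContinuousLinearMap.adjoint (dysonV G m A s) f))) (Set.Icc (-ε) 0) ∧
      smoothedInteraction G m ε A f =
        ∫ s in Set.Icc (-ε) 0, dysonV G m A s (interactionPicture G m (timeDeriv A) s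
          (ContinuousLinearMap.adjoint (dysonV G m A s) f)) := by
  have hM : 0 ≤ M := (norm_nonneg _).trans (hA 0 0)
  obtain ⟨hb, hB⟩ := interactionPicture_spec G m hA hx ht
  obtain ⟨hb', hB'⟩ := interactionPicture_spec G m hA' hx' ht'
  have hB0 : ∀ t, t < -ε → interactionPicture G m A t = 0 := by
    intro t h
    have hz : slashOp G A t = 0 := by
      have : ‖slashOp G A t‖ ≤ 0 := mulOp_norm_le le_rfl fun x => by
        rw [h0 t h x, DiracMatrices.slash]; simp
      exact norm_le_zero_iff.1 this
    rw [interactionPicture, hz]; simp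
  have hV : ContinuousOn (dysonV G m A) (Set.Icc (-ε) 0) :=
    (dyson_summable (M := M + 1) (by linarith) (fun t => (hb t).trans (by linarith)) hB hB0 0).2
  have hV' : ContinuousOn (fun s => ContinuousLinearMap.adjoint (dysonV G m A s))
      (Set.Icc (-ε) 0) := ContinuousLinearMap.adjoint.continuous.comp_continuousOn hV
  have hc : ∀ f, ContinuousOn (fun s => dysonV G m A s (interactionPicture G m (timeDeriv A) s
      (ContinuousLinearMap.adjoint (dysonV G m A s) f))) (Set.Icc (-ε) 0) := fun f =>
    hV.clm_apply (strongly_continuous_apply hb' hB' (hV'.clm_apply continuousOn_const))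
  refine strongIntegral_spec (μ := volume.restrict (Set.Icc (-ε) 0))
    (F := fun s => dysonV G m A s ∘L interactionPicture G m (timeDeriv A) s ∘L
      ContinuousLinearMap.adjoint (dysonV G m A s))
    (g := fun s => ‖dysonV G m A s‖ * (M' * ‖dysonV G m A s‖))
    (fun f => (hc f).aestronglyMeasurable measurableSet_Icc)
    ((hV.norm.mul (continuousOn_const.mul hV.norm)).integrableOn_compact isCompact_Icc)
    (ae_of_all _ fun s => ?_) f
  refine (ContinuousLinearMap.opNorm_comp_le _ _).trans
    (mul_le_mul_of_nonneg_left ?_ (norm_nonneg _))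
  refine (ContinuousLinearMap.opNorm_comp_le _ _).trans ?_
  rw [LinearIsometryEquiv.norm_map]
  exact mul_le_mul_of_nonneg_right (hb' s) (norm_nonneg _)

/-- In particular `𝒦` is given by its integral for the switched potentials. -/
theorem smoothedInteraction_switched_apply (G : DiracMatrices) (m : ℝ) {h : ℝ → ℝ}
    (hh : ContDiff ℝ ∞ h) (h0 : ∀ t, t < -1 → h t = 0) (h1 : ∀ t, 0 < t → h t = 1)
    {A : Space → Fin 4 → ℝ} (hA : Continuous A) (hAc : HasCompactSupport A) {T : ℝ} (hT : 0 < T)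
    (f : OneParticle) :
    IntegrableOn (fun s => dysonV G m (switched h T A) s
        (interactionPicture G m (timeDeriv (switched h T A)) s
        (ContinuousLinearMap.adjoint (dysonV G m (switched h T A) s) f))) (Set.Icc (-T) 0) ∧
      smoothedInteraction G m T (switched h T A) f =
        ∫ s in Set.Icc (-T) 0, dysonV G m (switched h T A) s
          (interactionPicture G m (timeDeriv (switched h T A)) s
          (ContinuousLinearMap.adjoint (dysonV G m (switched h T A) s) f)) := by
  have hconst : ∀ t, t ∉ Set.Icc (-1 : ℝ) 0 → h t = 0 ∨ h t = 1 := by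
    intro t ht
    rw [Set.mem_Icc, not_and_or, not_le, not_le] at ht
    exact ht.imp (h0 t) (h1 t)
  have hd : ∀ t, t ∉ Set.Icc (-1 : ℝ) 0 → deriv h t = 0 := by
    intro t ht
    rw [Set.mem_Icc, not_and_or, not_le, not_le] at ht
    rcases ht with ht | ht
    · have : h =ᶠ[𝓝 t] fun _ => 0 := by
        filter_upwards [Iio_mem_nhds ht] with s hs using h0 s hs
      rw [this.deriv_eq, deriv_const]
    · have : h =ᶠ[𝓝 t] fun _ => 1 := by
        filter_upwards [Ioi_mem_nhds ht] with s hs using h1 s hs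
      rw [this.deriv_eq, deriv_const]
  have hdc : Continuous (deriv h) := hh.continuous_deriv (by simp)
  obtain ⟨c, hc⟩ := isCompact_Icc.exists_bound_of_continuousOn (s := Set.Icc (-1 : ℝ) 0)
    hh.continuous.continuousOn
  obtain ⟨c', hc'⟩ := isCompact_Icc.exists_bound_of_continuousOn (s := Set.Icc (-1 : ℝ) 0)
    hdc.continuousOn
  have hb : ∀ t, |h t| ≤ max c 1 := fun t => by
    by_cases ht : t ∈ Set.Icc (-1 : ℝ) 0
    · exact (hc t ht).trans (le_max_left _ _)
    · rcases hconst t ht with e | e <;> rw [e] <;> simp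
  have hb' : ∀ t, |deriv h t| ≤ max c' 0 := fun t => by
    by_cases ht : t ∈ Set.Icc (-1 : ℝ) 0
    · exact (hc' t ht).trans (le_max_left _ _)
    · rw [hd t ht]; simp
  have hsl : ∀ (r : ℝ) (a : Fin 4 → ℝ), G.slash (fun μ => r * a μ) = (r : ℂ) • G.slash a := by
    intro r a
    simp only [DiracMatrices.slash, ← map_smul, smul_add, Finset.smul_sum, smul_smul,
      Complex.ofReal_mul]
  obtain ⟨a, ha⟩ := (hAc.comp_left (g := G.slash) (by simp [DiracMatrices.slash])
    ).exists_bound_of_continuous ((slash_continuous G).comp hA)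
  have hder : timeDeriv (switched h T A) = fun t x μ => (T⁻¹ * deriv h (t / T)) * A x μ := by
    funext t x μ
    have e : (fun s => switched h T A s x μ) = fun s => h (T⁻¹ * s) * A x μ := by
      funext s; simp only [switched]; rw [div_eq_inv_mul]
    rw [timeDeriv, e, deriv_mul_const_field, deriv_comp_mul_left, smul_eq_mul, div_eq_inv_mul]
  have hcx : ∀ r : ℝ, Continuous fun x => (fun μ => r * A x μ : Fin 4 → ℝ) := fun r => by
    fun_prop
  have hhT : Continuous fun t => h (t / T) :=
    hh.continuous.comp (continuous_id.div_const T)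
  have hdT : Continuous fun t => T⁻¹ * deriv h (t / T) :=
    continuous_const.mul (hdc.comp (continuous_id.div_const T))
  refine smoothedInteraction_apply G m T (A := switched h T A) (M := max c 1 * a) (M' := (T⁻¹ * max c' 0) * a)
    (fun t x => ?_) (fun t => hcx _) (fun x => ?_) (fun t ht x => ?_) (fun t x => ?_)
    (fun t => ?_) (fun x => ?_) f
  · rw [show switched h T A t x = fun μ => h (t / T) * A x μ from rfl, hsl, norm_smul,
      Complex.norm_real]
    exact mul_le_mul (hb _) (ha x) (norm_nonneg _) (by positivity)
  · exact continuous_pi fun μ => hhT.mul continuous_const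
  · funext μ
    have : t / T < -1 := by rw [div_lt_iff₀ hT]; linarith
    simp [switched, h0 _ this]
  · rw [hder, hsl, norm_smul, Complex.norm_real, norm_mul, Real.norm_of_nonneg (inv_pos.2 hT).le]
    exact mul_le_mul (mul_le_mul_of_nonneg_left (hb' _) (inv_pos.2 hT).le) (ha x) (norm_nonneg _)
      (by positivity)
  · rw [hder]; exact hcx _
  · rw [hder]; exact continuous_pi fun μ => hdT.mul continuous_const

theorem parseval_enorm {κ : Type*} (c : HilbertBasis κ ℂ OneParticle) (x : OneParticle) :
    ‖x‖ₑ ^ 2 = ∑' j, ‖inner ℂ (c j) x‖ₑ ^ 2 := by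
  have h := (c.hasSum_inner_mul_inner x x).mapL Complex.reCLM
  have h1 : ∀ j, Complex.reCLM (inner ℂ x (c j) * inner ℂ (c j) x) = ‖inner ℂ (c j) x‖ ^ 2 := by
    intro j
    rw [← inner_conj_symm x (c j), Complex.conj_mul', Complex.reCLM_apply]
    norm_cast
  have h2 : Complex.reCLM (inner ℂ x x) = ‖x‖ ^ 2 := by
    rw [inner_self_eq_norm_sq_to_K, Complex.reCLM_apply]
    norm_cast
  simp only [h1, h2] at h
  have h3 := ENNReal.ofReal_tsum_of_nonneg (fun j => by positivity) h.summable
  rw [h.tsum_eq] at h3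
  simpa [ENNReal.ofReal_pow] using h3

/-- The Hilbert-Schmidt norm may be computed in any Hilbert basis. -/
theorem hsNorm_eq (S : OneParticle →L[ℂ] OneParticle) {ι : Type*}
    (b : HilbertBasis ι ℂ OneParticle) :
    hsNorm S = (∑' i, ‖S (b i)‖ₑ ^ 2) ^ (1 / 2 : ℝ) := by
  obtain ⟨b₀, hb₀⟩ := (exists_hilbertBasis ℂ OneParticle).choose_spec
  have swap : ∀ j i, ‖inner ℂ (b j) (S (b₀ i))‖ₑ =
      ‖inner ℂ (b₀ i) (ContinuousLinearMap.adjoint S (b j))‖ₑ := by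
    intro j i
    rw [ContinuousLinearMap.adjoint_inner_right, ← inner_conj_symm, ← ofReal_norm, ← ofReal_norm,
      RCLike.norm_conj]
  have swap' : ∀ j i, ‖inner ℂ (b j) (S (b i))‖ₑ =
      ‖inner ℂ (b i) (ContinuousLinearMap.adjoint S (b j))‖ₑ := by
    intro j i
    rw [ContinuousLinearMap.adjoint_inner_right, ← inner_conj_symm, ← ofReal_norm, ← ofReal_norm,
      RCLike.norm_conj]
  rw [hsNorm]
  congr 1
  calc _ = ∑' i, ‖S (b₀ i)‖ₑ ^ 2 := by rw [hb₀]
    _ = ∑' i, ∑' j, ‖inner ℂ (b j) (S (b₀ i))‖ₑ ^ 2 := by simp_rw [← parseval_enorm b]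
    _ = ∑' j, ∑' i, ‖inner ℂ (b j) (S (b₀ i))‖ₑ ^ 2 := ENNReal.tsum_comm
    _ = ∑' j, ‖ContinuousLinearMap.adjoint S (b j)‖ₑ ^ 2 := by
        simp_rw [swap, ← parseval_enorm b₀]
    _ = ∑' j, ∑' i, ‖inner ℂ (b j) (S (b i))‖ₑ ^ 2 := by
        simp_rw [swap', ← parseval_enorm b]
    _ = ∑' i, ∑' j, ‖inner ℂ (b j) (S (b i))‖ₑ ^ 2 := ENNReal.tsum_comm
    _ = ∑' i, ‖S (b i)‖ₑ ^ 2 := by simp_rw [← parseval_enorm b]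

end DiracSwitching

end

/-! Write `J` for the sign of `D`, call an operator even or odd if it commutes or anticommutes with
`J`, and let `σ = t/T`. The proof is an adiabatic expansion in a moving frame, with every error
controlled in Hilbert–Schmidt norm.

Inverse commutator. Because `D = J|D|` has a gap, `[D, L] = Y` is solvable for odd bounded `Y` by `L
= ∫₀^∞ e^{-r|D|} J Y e^{-r|D|} dr` (`isCommutator_invComm`). The unbounded `D` never appears: a
commutator is encoded as the strong derivative of `e^{itD} X e^{-itD}`. The integral also gains
decay in momentum. In three dimensions `|D|^{-7/4} a(x)` is Hilbert–Schmidt for compactly supported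
`a` (`hsLe_energyOp_mulOp`), and each inversion improves the weight by `|D|^{7/8}`, at the price of
the integrable singularity `r^{-7/8}`. Two inversions turn the potential into a Hilbert–Schmidt
operator.

Frame. For small `A` an analytic implicit function theorem yields `W = 1 + Z` with `Z` odd and `(D +
hA) W = W (D + M)` with `M` even (`exists_blockDiagonalizer`, `exists_adiabaticFrame`). Put `κ =
W⁻¹W'`, which has already gained one inversion. Differentiating the intertwining relation gives `h'
W⁻¹AW = M' - [D + M, κ]`.

Dynamics. Let `evol y` be `V_s e^{isD} W y W⁻¹ e^{-isD} V_s⁻¹`. Its time derivative is the evolution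
of `i[D + M, y] + T⁻¹([κ, y] + y')` (`evol_deriv`), so evolutions of commutators with `D + M`
integrate by parts. Applied to the perturbation this gives `T 𝒦 = ∫ evol M' - i T⁻¹ ∫ evol κ'`; the
boundary terms drop out because `h'` vanishes at both ends of the switching (`isPrim_perturbation`).

Off-diagonal blocks. Odd integrands are commutators with `D + M` of Hilbert–Schmidt operators, so
their primitives are bounded in Hilbert–Schmidt norm uniformly in `T` (`exists_prim_odd`). Evolved
even operators commute with the evolved projection `P_s`, and `P - P_s = O(1/T)`
(`exists_proj_expansion`), so their block between `P` and `Q` is `O(1/T)` and its integral `O(1)`.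
Hence the block of `∫ evol κ'` is `O(1)` (`unifHS_offDiag_prim`). For `∫ evol M'` the expansion of
`P - P_s` is inserted once more, which yields `O(1/T)` (`unifHS_offDiag_prim_deriv_M`). Altogether
`P𝒦Q = O(T⁻²)`. -/

noncomputable section

namespace DiracSwitching

/-! ### Strong calculus of operator-valued functions -/

section StrongCalculus

variable {H : Type*} [NormedAddCommGroup H] [InnerProductSpace ℂ H]

/-- Bounded operators on `H`. -/
abbrev Op (H : Type*) [NormedAddCommGroup H] [InnerProductSpace ℂ H] : Type _ := H →L[ℂ] H

/-- An operator-valued function is bounded along a filter. -/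
def BddAlong {α : Type*} (l : Filter α) (F : α → Op H) : Prop := ∃ c, ∀ᶠ s in l, ‖F s‖ ≤ c

theorem BddAlong.mono {α : Type*} {l l' : Filter α} {F : α → Op H} (h : BddAlong l F)
    (hl : l' ≤ l) : BddAlong l' F :=
  h.imp fun _ hc => hl hc

theorem BddAlong.mul {α : Type*} {l : Filter α} {F G : α → Op H} (hF : BddAlong l F)
    (hG : BddAlong l G) : BddAlong l fun s => F s * G s := by
  obtain ⟨c, hc⟩ := hF
  obtain ⟨d, hd⟩ := hG
  refine ⟨c * d, ?_⟩
  filter_upwards [hc, hd] with s h1 h2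
  exact (norm_mul_le _ _).trans
    (mul_le_mul h1 h2 (norm_nonneg _) ((norm_nonneg _).trans h1))

theorem BddAlong.add {α : Type*} {l : Filter α} {F G : α → Op H} (hF : BddAlong l F)
    (hG : BddAlong l G) : BddAlong l fun s => F s + G s := by
  obtain ⟨c, hc⟩ := hF
  obtain ⟨d, hd⟩ := hG
  refine ⟨c + d, ?_⟩
  filter_upwards [hc, hd] with s h1 h2
  exact (norm_add_le _ _).trans (add_le_add h1 h2)

theorem BddAlong.neg {α : Type*} {l : Filter α} {F : α → Op H} (hF : BddAlong l F) :
    BddAlong l fun s => -F s := by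
  obtain ⟨c, hc⟩ := hF
  exact ⟨c, by simpa using hc⟩

theorem BddAlong.of_tendsto {α : Type*} {l : Filter α} {F : α → Op H} {A : Op H}
    (h : Tendsto F l (𝓝 A)) : BddAlong l F :=
  ⟨‖A‖ + 1, (h.norm.eventually (gt_mem_nhds (lt_add_one _))).mono fun _ h => h.le⟩

theorem BddAlong.of_le {α : Type*} {l : Filter α} {F : α → Op H} {c : ℝ} (h : ∀ s, ‖F s‖ ≤ c) :
    BddAlong l F :=
  ⟨c, Eventually.of_forall h⟩

/-- Strong convergence alone does not allow a moving argument; a local norm bound does. For this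
reason boundedness is carried along in all the strong notions below. -/
theorem BddAlong.tendsto_apply {α : Type*} {l : Filter α} {F : α → Op H} (hF : BddAlong l F)
    {γ : α → H} {g x : H} (hx : Tendsto (fun s => F s g) l (𝓝 x)) (hγ : Tendsto γ l (𝓝 g)) :
    Tendsto (fun s => F s (γ s)) l (𝓝 x) := by
  obtain ⟨c, hc⟩ := hF
  have h1 : Tendsto (fun s => F s (γ s - g)) l (𝓝 0) := by
    refine squeeze_zero_norm' (a := fun s => c * ‖γ s - g‖) ?_ ?_
    · filter_upwards [hc] with s h using ContinuousLinearMap.le_of_opNorm_le _ h _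
    · have := (hγ.sub (tendsto_const_nhds (x := g))).norm.const_mul c
      simpa only [sub_self, norm_zero, mul_zero] using this
  simpa using h1.add hx

/-- Local boundedness and strong continuity. -/
structure StrongCont (F : ℝ → Op H) : Prop where
  bdd : ∀ t, BddAlong (𝓝 t) F
  cont : ∀ f, Continuous fun t => F t f

theorem StrongCont.mul {F G : ℝ → Op H} (hF : StrongCont F) (hG : StrongCont G) :
    StrongCont fun s => F s * G s :=
  ⟨fun t => (hF.bdd t).mul (hG.bdd t), fun f => continuous_iff_continuousAt.2 fun t =>
    (hF.bdd t).tendsto_apply ((hF.cont _).tendsto t) ((hG.cont f).tendsto t)⟩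

theorem StrongCont.add {F G : ℝ → Op H} (hF : StrongCont F) (hG : StrongCont G) :
    StrongCont fun s => F s + G s :=
  ⟨fun t => (hF.bdd t).add (hG.bdd t), fun f => (hF.cont f).add (hG.cont f)⟩

theorem StrongCont.neg {F : ℝ → Op H} (hF : StrongCont F) : StrongCont fun s => -F s :=
  ⟨fun t => (hF.bdd t).neg, fun f => (hF.cont f).neg⟩

theorem StrongCont.of_continuous {F : ℝ → Op H} (hF : Continuous F) : StrongCont F :=
  ⟨fun t => .of_tendsto (hF.tendsto t), fun _ => hF.clm_apply continuous_const⟩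

theorem StrongCont.const (A : Op H) : StrongCont fun _ => A := .of_continuous continuous_const

theorem StrongCont.const_smul {F : ℝ → Op H} (hF : StrongCont F) (c : ℂ) :
    StrongCont fun s => c • F s := by
  simpa using (StrongCont.const (c • (1 : Op H))).mul hF

/-- Strong differentiability of a locally bounded operator-valued function. -/
structure StrongDerivAt (F : ℝ → Op H) (F' : Op H) (t : ℝ) : Prop where
  bdd : BddAlong (𝓝 t) F
  deriv : ∀ f, HasDerivAt (fun s => F s f) (F' f) t

theorem StrongDerivAt.tendsto {F : ℝ → Op H} {F' : Op H} {t : ℝ} (h : StrongDerivAt F F' t)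
    (f : H) : Tendsto (fun s => F s f) (𝓝 t) (𝓝 (F t f)) :=
  (h.deriv f).continuousAt

theorem StrongDerivAt.strongCont {F F' : ℝ → Op H} (h : ∀ t, StrongDerivAt F (F' t) t) :
    StrongCont F :=
  ⟨fun t => (h t).bdd, fun f => continuous_iff_continuousAt.2 fun t => (h t).tendsto f⟩

theorem StrongDerivAt.of_hasDerivAt {F : ℝ → Op H} {F' : Op H} {t : ℝ} (h : HasDerivAt F F' t) :
    StrongDerivAt F F' t :=
  ⟨.of_tendsto h.continuousAt, fun f =>
    (((ContinuousLinearMap.apply ℂ H f).restrictScalars ℝ).hasFDerivAt.comp_hasDerivAt t h)⟩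

theorem StrongDerivAt.const (A : Op H) (t : ℝ) : StrongDerivAt (fun _ => A) 0 t :=
  .of_hasDerivAt (hasDerivAt_const t A)

theorem StrongDerivAt.add {F G : ℝ → Op H} {F' G' : Op H} {t : ℝ} (hF : StrongDerivAt F F' t)
    (hG : StrongDerivAt G G' t) : StrongDerivAt (fun s => F s + G s) (F' + G') t :=
  ⟨hF.bdd.add hG.bdd, fun f => (hF.deriv f).add (hG.deriv f)⟩

theorem StrongDerivAt.mul {F G : ℝ → Op H} {F' G' : Op H} {t : ℝ} (hF : StrongDerivAt F F' t)
    (hG : StrongDerivAt G G' t) : StrongDerivAt (fun s => F s * G s) (F' * G t + F t * G') t := by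
  refine ⟨hF.bdd.mul hG.bdd, fun f => ?_⟩
  rw [hasDerivAt_iff_tendsto_slope]
  have h1 := hasDerivAt_iff_tendsto_slope.1 (hF.deriv (G t f))
  have h2 := (hF.bdd.mono nhdsWithin_le_nhds).tendsto_apply
    ((hF.tendsto (G' f)).mono_left nhdsWithin_le_nhds) (hasDerivAt_iff_tendsto_slope.1 (hG.deriv f))
  refine (h1.add h2).congr fun s => ?_
  simp only [slope_def_module, mul_apply_eq_comp]
  rw [(F s).map_smul_of_tower, map_sub, ← smul_add]
  congr 1
  abel

/-- The resolvent identity `G s - G t = -G s (F s - F t) G t`, together with local boundedness of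
`G`, gives first strong continuity of `G` and then its derivative. -/
theorem StrongDerivAt.inv {F G : ℝ → Op H} {F' : Op H} {t : ℝ} (hF : StrongDerivAt F F' t)
    (hG : BddAlong (𝓝 t) G) (h1 : ∀ s, F s * G s = 1) (h2 : ∀ s, G s * F s = 1) :
    StrongDerivAt G (-(G t * F' * G t)) t := by
  have key : ∀ s f, G s f - G t f = -G s (F s (G t f) - F t (G t f)) := by
    intro s f
    have e1 : F t (G t f) = f := by simpa using congrArg (fun X : Op H => X f) (h1 t)
    have e2 : G s (F s (G t f)) = G t f := by
      simpa using congrArg (fun X : Op H => X (G t f)) (h2 s)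
    rw [map_sub, e1, e2]; abel
  have hc : ∀ f, Tendsto (fun s => G s f) (𝓝 t) (𝓝 (G t f)) := by
    intro f
    have h3 := (hF.tendsto (G t f)).sub (tendsto_const_nhds (x := F t (G t f)))
    rw [sub_self] at h3
    have h4 := (hG.tendsto_apply (g := 0) (x := 0) (by simp) h3).neg
    simp only [← key, neg_zero] at h4
    simpa using h4.add (tendsto_const_nhds (x := G t f))
  refine ⟨hG, fun f => ?_⟩
  rw [hasDerivAt_iff_tendsto_slope]
  have h5 := ((hG.mono nhdsWithin_le_nhds).tendsto_apply
    ((hc (F' (G t f))).mono_left nhdsWithin_le_nhds)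
    (hasDerivAt_iff_tendsto_slope.1 (hF.deriv (G t f)))).neg
  refine h5.congr fun s => ?_
  rw [slope_def_module, slope_def_module, key s f, (G s).map_smul_of_tower, smul_neg]

theorem StrongDerivAt.congr_deriv {F : ℝ → Op H} {F' G' : Op H} {t : ℝ} (h : StrongDerivAt F F' t)
    (e : F' = G') : StrongDerivAt F G' t := e ▸ h

theorem StrongCont.integral_eq_sub [CompleteSpace H] {F F' : ℝ → Op H}
    (h : ∀ t, StrongDerivAt F (F' t) t) (hF' : StrongCont F') (a b : ℝ) (f : H) :
    ∫ s in a..b, F' s f = F b f - F a f :=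
  intervalIntegral.integral_eq_sub_of_hasDerivAt (fun t _ => (h t).deriv f)
    ((hF'.cont f).intervalIntegrable _ _)

end StrongCalculus

end DiracSwitching

end

noncomputable section

namespace DiracSwitching

/-! ### Hilbert-Schmidt bounds -/

section HilbertSchmidt

variable {H : Type*} [NormedAddCommGroup H] [InnerProductSpace ℂ H]
variable {ι : Type*} (b : HilbertBasis ι ℂ H)

/-- The finite family `(T bᵢ)_{i ∈ s}` as an element of an `ℓ²` space. -/
def hsTrunc (s : Finset ι) : Op H →L[ℂ] PiLp 2 (fun _ : s => H) :=
  (PiLp.continuousLinearEquiv 2 ℂ fun _ : s => H).symm.toContinuousLinearMap ∘L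
    ContinuousLinearMap.pi fun i : s => ContinuousLinearMap.apply ℂ H (b i)

@[simp] theorem hsTrunc_apply (s : Finset ι) (T : Op H) (i : s) : hsTrunc b s T i = T (b i) := rfl

theorem norm_hsTrunc_sq (s : Finset ι) (T : Op H) :
    ‖hsTrunc b s T‖ ^ 2 = ∑ i ∈ s, ‖T (b i)‖ ^ 2 := by
  rw [PiLp.norm_sq_eq_of_L2, ← Finset.sum_coe_sort s fun i => ‖T (b i)‖ ^ 2]
  rfl

/-- The Hilbert-Schmidt norm of `T` is at most `c`. -/
def HSLe (T : Op H) (c : ℝ) : Prop := ∀ s, ‖hsTrunc b s T‖ ≤ c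

variable {b}

theorem HSLe.nonneg {T : Op H} {c : ℝ} (h : HSLe b T c) : 0 ≤ c := (norm_nonneg _).trans (h ∅)

theorem HSLe.mono {T : Op H} {c d : ℝ} (h : HSLe b T c) (hcd : c ≤ d) : HSLe b T d :=
  fun s => (h s).trans hcd

theorem HSLe.add {T S : Op H} {c d : ℝ} (hT : HSLe b T c) (hS : HSLe b S d) :
    HSLe b (T + S) (c + d) := fun s => by
  rw [map_add]; exact (norm_add_le _ _).trans (add_le_add (hT s) (hS s))

theorem HSLe.neg {T : Op H} {c : ℝ} (hT : HSLe b T c) : HSLe b (-T) c := fun s => by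
  rw [map_neg, norm_neg]; exact hT s

theorem HSLe.sub {T S : Op H} {c d : ℝ} (hT : HSLe b T c) (hS : HSLe b S d) :
    HSLe b (T - S) (c + d) := sub_eq_add_neg T S ▸ hT.add hS.neg

theorem HSLe.smul {T : Op H} {c : ℝ} (hT : HSLe b T c) (z : ℂ) : HSLe b (z • T) (‖z‖ * c) :=
  fun s => by
    rw [map_smul, norm_smul]; exact mul_le_mul_of_nonneg_left (hT s) (norm_nonneg _)

theorem HSLe.integral [CompleteSpace H] {α : Type*} [MeasurableSpace α] {μ : Measure α}
    {F : α → Op H} {c : α → ℝ} (hF : Integrable F μ) (hc : Integrable c μ)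
    (h : ∀ᵐ a ∂μ, HSLe b (F a) (c a)) : HSLe b (∫ a, F a ∂μ) (∫ a, c a ∂μ) := fun s => by
  rw [← (hsTrunc b s).integral_comp_comm hF]
  exact norm_integral_le_of_norm_le hc (h.mono fun _ h => h s)

theorem HSLe.mul_left {T : Op H} {c : ℝ} (hT : HSLe b T c) (A : Op H) :
    HSLe b (A * T) (‖A‖ * c) := fun s => by
  refine abs_le_of_sq_le_sq' ?_ (mul_nonneg (norm_nonneg _) hT.nonneg) |>.2
  calc ‖hsTrunc b s (A * T)‖ ^ 2 = ∑ i ∈ s, ‖A (T (b i))‖ ^ 2 := norm_hsTrunc_sq _ _ _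
    _ ≤ ∑ i ∈ s, ‖A‖ ^ 2 * ‖T (b i)‖ ^ 2 := by
        gcongr with i
        rw [← mul_pow]
        gcongr
        exact A.le_opNorm _
    _ = ‖A‖ ^ 2 * ‖hsTrunc b s T‖ ^ 2 := by rw [norm_hsTrunc_sq, Finset.mul_sum]
    _ ≤ (‖A‖ * c) ^ 2 := by
        rw [mul_pow]
        gcongr
        exact hT s

theorem hsLe_iff_tsum {T : Op H} {c : ℝ} (hc : 0 ≤ c) :
    HSLe b T c ↔ ∑' i, ‖T (b i)‖ₑ ^ 2 ≤ ENNReal.ofReal c ^ 2 := by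
  have e : ∀ s : Finset ι, ∑ i ∈ s, ‖T (b i)‖ₑ ^ 2 = ENNReal.ofReal (‖hsTrunc b s T‖ ^ 2) := by
    intro s
    rw [norm_hsTrunc_sq, ENNReal.ofReal_sum_of_nonneg fun _ _ => by positivity]
    refine Finset.sum_congr rfl fun i _ => ?_
    rw [ENNReal.ofReal_pow (norm_nonneg _), ofReal_norm]
  rw [ENNReal.tsum_eq_iSup_sum, iSup_le_iff]
  refine forall_congr' fun s => ?_
  rw [e, ← ENNReal.ofReal_pow hc, ENNReal.ofReal_le_ofReal_iff (by positivity)]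
  exact (pow_le_pow_iff_left₀ (norm_nonneg _) hc two_ne_zero).symm

theorem tsum_enorm_inner_sq (c : HilbertBasis ι ℂ H) (x : H) :
    ∑' j, ‖inner ℂ (c j) x‖ₑ ^ 2 = ‖x‖ₑ ^ 2 := by
  have h := (c.hasSum_inner_mul_inner x x).mapL Complex.reCLM
  have h1 : ∀ j, Complex.reCLM (inner ℂ x (c j) * inner ℂ (c j) x) = ‖inner ℂ (c j) x‖ ^ 2 := by
    intro j
    rw [← inner_conj_symm x (c j), Complex.conj_mul', Complex.reCLM_apply]
    norm_cast
  have h2 : Complex.reCLM (inner ℂ x x) = ‖x‖ ^ 2 := by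
    rw [inner_self_eq_norm_sq_to_K, Complex.reCLM_apply]
    norm_cast
  simp only [h1, h2] at h
  have h3 := ENNReal.ofReal_tsum_of_nonneg (fun j => by positivity) h.summable
  rw [h.tsum_eq] at h3
  simpa [ENNReal.ofReal_pow] using h3.symm

/-- Both sides are the sum of the squared matrix entries, taken in the two possible orders. -/
theorem tsum_enorm_adjoint_sq [CompleteSpace H] (T : Op H) :
    ∑' i, ‖ContinuousLinearMap.adjoint T (b i)‖ₑ ^ 2 = ∑' i, ‖T (b i)‖ₑ ^ 2 := by
  have swap : ∀ j i, ‖inner ℂ (b j) (T (b i))‖ₑ =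
      ‖inner ℂ (b i) (ContinuousLinearMap.adjoint T (b j))‖ₑ := by
    intro j i
    rw [ContinuousLinearMap.adjoint_inner_right, ← inner_conj_symm, ← ofReal_norm, ← ofReal_norm,
      RCLike.norm_conj]
  simp_rw [← tsum_enorm_inner_sq b (T _), swap]
  rw [ENNReal.tsum_comm]
  simp_rw [tsum_enorm_inner_sq b]

theorem HSLe.adjoint [CompleteSpace H] {T : Op H} {c : ℝ} (hT : HSLe b T c) :
    HSLe b (ContinuousLinearMap.adjoint T) c :=
  (hsLe_iff_tsum hT.nonneg).2 ((tsum_enorm_adjoint_sq T).trans_le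
    ((hsLe_iff_tsum hT.nonneg).1 hT))

/-- Factors on the left act on the vectors `T bᵢ` directly; factors on the right are moved to the
left by taking adjoints. -/
theorem HSLe.mul_right [CompleteSpace H] {T : Op H} {c : ℝ} (hT : HSLe b T c) (A : Op H) :
    HSLe b (T * A) (c * ‖A‖) := by
  have h := (hT.adjoint.mul_left (ContinuousLinearMap.adjoint A)).adjoint
  rw [LinearIsometryEquiv.norm_map, mul_comm] at h
  convert h using 1
  rw [← ContinuousLinearMap.star_eq_adjoint, ← ContinuousLinearMap.star_eq_adjoint,
    ← ContinuousLinearMap.star_eq_adjoint, star_mul, star_star, star_star]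

/-- Hilbert-Schmidt bounds pass to strong integrals. -/
theorem HSLe.intervalIntegral_apply [CompleteSpace H] {F : ℝ → Op H} (hF : StrongCont F)
    {T : Op H} {r t c : ℝ} (hrt : r ≤ t) (hT : ∀ f, T f = ∫ s in r..t, F s f)
    (h : ∀ s ∈ Set.Icc r t, HSLe b (F s) c) : HSLe b T (c * (t - r)) := fun s => by
  have hcont : Continuous fun u => hsTrunc b s (F u) :=
    (PiLp.continuous_toLp 2 fun _ : s => H).comp (continuous_pi fun i => hF.cont (b i))
  have e : hsTrunc b s T = ∫ u in r..t, hsTrunc b s (F u) := by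
    ext i
    rw [hsTrunc_apply, hT]
    exact (PiLp.proj (𝕜 := ℂ) 2 (fun _ : s => H) i).intervalIntegral_comp_comm
      (hcont.intervalIntegrable r t)
  rw [e, ← abs_of_nonneg (sub_nonneg.2 hrt)]
  refine intervalIntegral.norm_integral_le_of_norm_le_const fun u hu => ?_
  rw [Set.uIoc_of_le hrt] at hu
  exact h u ⟨hu.1.le, hu.2⟩ s

theorem norm_le_of_apply_eq_integral [CompleteSpace H] {F : ℝ → Op H}
    {T : Op H} {r t c : ℝ} (hrt : r ≤ t) (hc : 0 ≤ c) (hT : ∀ f, T f = ∫ s in r..t, F s f)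
    (h : ∀ s ∈ Set.Icc r t, ‖F s‖ ≤ c) : ‖T‖ ≤ c * (t - r) := by
  refine T.opNorm_le_bound (mul_nonneg hc (sub_nonneg.2 hrt)) fun f => ?_
  rw [hT, mul_right_comm, ← abs_of_nonneg (sub_nonneg.2 hrt)]
  refine intervalIntegral.norm_integral_le_of_norm_le_const fun u hu => ?_
  rw [Set.uIoc_of_le hrt] at hu
  exact (F u).le_of_opNorm_le (h u ⟨hu.1.le, hu.2⟩) f

/-- The strong integral of a strongly continuous function over an interval. -/
def sInt [CompleteSpace H] (F : ℝ → Op H) (hF : StrongCont F) (r t : ℝ) : Op H :=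
  -- Compactness of the interval upgrades local bounds to one bound, which makes the integral a
  -- bounded operator.
  have hloc : ∃ c, ∀ s ∈ Set.uIcc r t, ‖F s‖ ≤ c := by
    refine isCompact_uIcc.induction_on (p := fun S => ∃ c, ∀ s ∈ S, ‖F s‖ ≤ c)
      ⟨0, by simp⟩ (fun S S' h ⟨c, hc⟩ => ⟨c, fun s hs => hc s (h hs)⟩)
      (fun S S' ⟨c, hc⟩ ⟨d, hd⟩ => ⟨max c d, ?_⟩) fun s _ => ?_
    · rintro s (hs | hs)
      exacts [(hc s hs).trans (le_max_left _ _), (hd s hs).trans (le_max_right _ _)]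
    · obtain ⟨c, hc⟩ := hF.bdd s
      exact ⟨_, mem_nhdsWithin_of_mem_nhds hc, c, fun u hu => hu⟩
  LinearMap.mkContinuousOfExistsBound
    { toFun := fun f => ∫ s in r..t, F s f
      map_add' := fun f g => by
        simp only [map_add]
        exact intervalIntegral.integral_add ((hF.cont f).intervalIntegrable _ _)
          ((hF.cont g).intervalIntegrable _ _)
      map_smul' := fun z f => by
        simp only [map_smul, RingHom.id_apply]
        exact intervalIntegral.integral_smul z _ } (by
    obtain ⟨c, hc⟩ := hloc
    refine ⟨c * |t - r|, fun f => ?_⟩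
    rw [mul_right_comm]
    exact intervalIntegral.norm_integral_le_of_norm_le_const fun u hu =>
      (F u).le_of_opNorm_le (hc u (Set.uIoc_subset_uIcc hu)) f)

end HilbertSchmidt

theorem hsNorm_le_of_hsLe {S : OneParticle →L[ℂ] OneParticle} {ι : Type*}
    {b : HilbertBasis ι ℂ OneParticle} {c : ℝ} (h : HSLe b S c) :
    hsNorm S ≤ ENNReal.ofReal c := by
  rw [hsNorm_eq S b]
  calc _ ≤ (ENNReal.ofReal c ^ 2) ^ (1 / 2 : ℝ) :=
        ENNReal.rpow_le_rpow ((hsLe_iff_tsum h.nonneg).1 h) (by norm_num)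
    _ = ENNReal.ofReal c := by
        rw [← ENNReal.rpow_natCast, ← ENNReal.rpow_mul]; norm_num

end DiracSwitching

end

/-! ### Free Hamiltonians with a spectral gap and the inverse of the commutator -/

noncomputable section

namespace DiracSwitching

section FreeModel

/-- The data of a free Hamiltonian `D` with a spectral gap `(-m, m)`: the group `E t = e^{itD}`, the
sign `J` of `D`, the semigroup `S r = e^{-r|D|}` and its generator `Ω r = |D| e^{-r|D|}`. -/
structure FreeModel (H : Type*) [NormedAddCommGroup H] [InnerProductSpace ℂ H] where
  m : ℝ
  E : ℝ → Op H
  J : Op H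
  S : ℝ → Op H
  Ω : ℝ → Op H
  m_pos : 0 < m
  E_zero : E 0 = 1
  E_add : ∀ s t, E (s + t) = E s * E t
  E_norm : ∀ t, ‖E t‖ ≤ 1
  E_cont : ∀ f, Continuous fun t => E t f
  J_sq : J * J = 1
  J_norm : ‖J‖ ≤ 1
  E_J : ∀ t, Commute (E t) J
  S_J : ∀ r, Commute (S r) J
  E_S : ∀ t r, Commute (E t) (S r)
  S_add : ∀ r s, 0 < r → 0 < s → S (r + s) = S r * S s
  S_norm : ∀ r, 0 < r → ‖S r‖ ≤ Real.exp (-m * r)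
  S_tendsto : ∀ f, Tendsto (fun r => S r f) (𝓝[>] 0) (𝓝 f)
  S_deriv : ∀ r, 0 < r → HasDerivAt S (-Ω r) r
  ES_deriv : ∀ r, 0 < r → ∀ t,
    HasDerivAt (fun t => E t * S r) (Complex.I • (E t * (J * Ω r))) t

variable {H : Type*} [NormedAddCommGroup H] [InnerProductSpace ℂ H]

/-- The part of `X` that anticommutes with the sign `J`. -/
def oddPart (J : Op H) : Op H →L[ℂ] Op H :=
  (2⁻¹ : ℂ) • (ContinuousLinearMap.id ℂ (Op H) -
    (ContinuousLinearMap.mul ℂ (Op H) J).comp ((ContinuousLinearMap.mul ℂ (Op H)).flip J))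

theorem oddPart_apply (J X : Op H) : oddPart J X = (2⁻¹ : ℂ) • (X - J * (X * J)) := rfl

namespace FreeModel

variable (𝓜 : FreeModel H)

theorem J_mul_cancel (X : Op H) : 𝓜.J * (𝓜.J * X) = X := by rw [← mul_assoc, 𝓜.J_sq, one_mul]

theorem oddPart_norm_le (X : Op H) : ‖oddPart 𝓜.J X‖ ≤ ‖X‖ := by
  have h : ‖𝓜.J * (X * 𝓜.J)‖ ≤ 1 * (‖X‖ * 1) :=
    (norm_mul_le _ _).trans (mul_le_mul 𝓜.J_norm ((norm_mul_le _ _).trans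
      (mul_le_mul_of_nonneg_left 𝓜.J_norm (norm_nonneg _))) (norm_nonneg _) zero_le_one)
  rw [oddPart_apply, norm_smul]
  have := norm_sub_le X (𝓜.J * (X * 𝓜.J))
  norm_num at h ⊢
  linarith

theorem oddPart_mul_J (X : Op H) : oddPart 𝓜.J X * 𝓜.J = -(𝓜.J * oddPart 𝓜.J X) := by
  simp only [oddPart_apply, smul_mul_assoc, mul_smul_comm, sub_mul, mul_sub, mul_assoc, 𝓜.J_sq,
    mul_one, 𝓜.J_mul_cancel]
  module

theorem oddPart_eq_self {X : Op H} (h : X * 𝓜.J = -(𝓜.J * X)) : oddPart 𝓜.J X = X := by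
  rw [oddPart_apply, h, mul_neg, 𝓜.J_mul_cancel]; module

theorem oddPart_eq_zero {X : Op H} (h : Commute X 𝓜.J) : oddPart 𝓜.J X = 0 := by
  rw [oddPart_apply, h.eq, 𝓜.J_mul_cancel, sub_self, smul_zero]

theorem commute_sub_oddPart (X : Op H) : Commute (X - oddPart 𝓜.J X) 𝓜.J := by
  rw [Commute, SemiconjBy]
  simp only [oddPart_apply, smul_mul_assoc, mul_smul_comm, sub_mul, mul_sub, mul_assoc, 𝓜.J_sq,
    mul_one, 𝓜.J_mul_cancel]
  module

theorem oddPart_mul_of_commute_left {M : Op H} (hM : Commute M 𝓜.J) (X : Op H) :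
    oddPart 𝓜.J (M * X) = M * oddPart 𝓜.J X := by
  simp only [oddPart_apply, mul_smul_comm, mul_sub]
  rw [mul_assoc M X, ← mul_assoc 𝓜.J M, ← hM.eq, mul_assoc M 𝓜.J]

theorem oddPart_mul_of_commute_right {M : Op H} (hM : Commute M 𝓜.J) (X : Op H) :
    oddPart 𝓜.J (X * M) = oddPart 𝓜.J X * M := by
  simp only [oddPart_apply, smul_mul_assoc, sub_mul]
  rw [mul_assoc X M, hM.eq]
  simp only [mul_assoc]

theorem E_neg_mul (t : ℝ) : 𝓜.E (-t) * 𝓜.E t = 1 := by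
  rw [← 𝓜.E_add, neg_add_cancel, 𝓜.E_zero]

theorem E_mul_neg (t : ℝ) : 𝓜.E t * 𝓜.E (-t) = 1 := by
  rw [← 𝓜.E_add, add_neg_cancel, 𝓜.E_zero]

theorem E_strongCont : StrongCont 𝓜.E := ⟨fun _ => .of_le 𝓜.E_norm, 𝓜.E_cont⟩

theorem E_neg_strongCont : StrongCont fun t => 𝓜.E (-t) :=
  ⟨fun _ => .of_le fun t => 𝓜.E_norm (-t), fun f => (𝓜.E_cont f).comp continuous_neg⟩

/-- The evolution `e^{itD} X e^{-itD}`. -/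
def conj (t : ℝ) (X : Op H) : Op H := 𝓜.E t * X * 𝓜.E (-t)

theorem conj_mul (t : ℝ) (X Y : Op H) : 𝓜.conj t (X * Y) = 𝓜.conj t X * 𝓜.conj t Y := by
  simp only [conj, mul_assoc]
  rw [← mul_assoc (𝓜.E (-t)), E_neg_mul, one_mul]

theorem conj_one (t : ℝ) : 𝓜.conj t 1 = 1 := by rw [conj, mul_one, E_mul_neg]

theorem conj_norm_le (t : ℝ) (X : Op H) : ‖𝓜.conj t X‖ ≤ ‖X‖ :=
  calc _ ≤ ‖𝓜.E t * X‖ * 1 := (norm_mul_le _ _).trans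
        (mul_le_mul_of_nonneg_left (𝓜.E_norm _) (norm_nonneg _))
    _ ≤ 1 * ‖X‖ * 1 := by gcongr; exact (norm_mul_le _ _).trans (by gcongr; exact 𝓜.E_norm t)
    _ = ‖X‖ := by ring

theorem conj_strongCont {X : ℝ → Op H} (hX : StrongCont X) :
    StrongCont fun t => 𝓜.conj t (X t) :=
  (𝓜.E_strongCont.mul hX).mul 𝓜.E_neg_strongCont

/-- `C` is the commutator `[D, X]`: the derivative of `e^{itD} X e^{-itD}` is
`i e^{itD} C e^{-itD}`. -/
def IsCommutator (X C : Op H) : Prop :=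
  ∀ t, StrongDerivAt (fun t => 𝓜.conj t X) (Complex.I • 𝓜.conj t C) t

variable {𝓜}

theorem IsCommutator.add {X C Y K : Op H} (hX : 𝓜.IsCommutator X C) (hY : 𝓜.IsCommutator Y K) :
    𝓜.IsCommutator (X + Y) (C + K) := fun t => by
  have h := (hX t).add (hY t)
  simpa only [conj, mul_add, add_mul, smul_add] using h

theorem IsCommutator.mul {X C Y K : Op H} (hX : 𝓜.IsCommutator X C) (hY : 𝓜.IsCommutator Y K) :
    𝓜.IsCommutator (X * Y) (C * Y + X * K) := fun t => by
  have h := (hX t).mul (hY t)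
  simp only [← conj_mul] at h
  refine h.congr_deriv ?_
  rw [smul_mul_assoc, mul_smul_comm, ← conj_mul, ← conj_mul, ← smul_add]
  simp only [conj, mul_add, add_mul]

/-- For such `X` the conjugation is constant in time. It is applied to `1`, `J` and `P`. -/
theorem IsCommutator.of_commute {X : Op H} (h : ∀ t, Commute (𝓜.E t) X) :
    𝓜.IsCommutator X 0 := fun t => by
  have e : ∀ t, 𝓜.conj t X = X := fun t => by
    rw [conj, (h t).eq, mul_assoc, E_mul_neg, mul_one]
  simp only [e]
  exact (StrongDerivAt.const X t).congr_deriv (by simp [conj])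

theorem IsCommutator.inv {X Y C : Op H} (hX : 𝓜.IsCommutator X C) (h1 : X * Y = 1)
    (h2 : Y * X = 1) : 𝓜.IsCommutator Y (-(Y * C * Y)) := fun t => by
  have h := (hX t).inv (G := fun t => 𝓜.conj t Y) (.of_le fun t => 𝓜.conj_norm_le t Y)
    (fun s => by rw [← conj_mul, h1, conj_one]) (fun s => by rw [← conj_mul, h2, conj_one])
  refine h.congr_deriv ?_
  rw [mul_smul_comm, smul_mul_assoc, ← conj_mul, ← conj_mul, ← smul_neg]
  simp only [conj, mul_neg, neg_mul]

variable (𝓜)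

/-- The integrand of the inverse commutator. -/
def kernel (X : Op H) (r : ℝ) : Op H := 𝓜.S r * (𝓜.J * oddPart 𝓜.J X) * 𝓜.S r

theorem continuousOn_kernel (X : Op H) : ContinuousOn (𝓜.kernel X) (Set.Ioi 0) := by
  have hS : ContinuousOn 𝓜.S (Set.Ioi 0) := fun r hr =>
    (𝓜.S_deriv r hr).continuousAt.continuousWithinAt
  exact (hS.mul continuousOn_const).mul hS

/-- Each of the two factors `e^{-r|D|}` contributes the decay rate `m`; the gap is what makes the
integral converge at infinity. -/
theorem norm_kernel_le (X : Op H) {r : ℝ} (hr : 0 < r) :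
    ‖𝓜.kernel X r‖ ≤ Real.exp (-(2 * 𝓜.m) * r) * ‖X‖ := by
  have h1 : ‖𝓜.J * oddPart 𝓜.J X‖ ≤ 1 * ‖X‖ := (norm_mul_le _ _).trans
    (mul_le_mul 𝓜.J_norm (𝓜.oddPart_norm_le X) (norm_nonneg _) zero_le_one)
  have hS := 𝓜.S_norm r hr
  calc _ ≤ ‖𝓜.S r‖ * ‖𝓜.J * oddPart 𝓜.J X‖ * ‖𝓜.S r‖ :=
        (norm_mul_le _ _).trans (mul_le_mul_of_nonneg_right (norm_mul_le _ _) (norm_nonneg _))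
    _ ≤ Real.exp (-𝓜.m * r) * (1 * ‖X‖) * Real.exp (-𝓜.m * r) := by gcongr
    _ = (Real.exp (-𝓜.m * r) * Real.exp (-𝓜.m * r)) * ‖X‖ := by ring
    _ = _ := by rw [← Real.exp_add]; ring_nf

theorem integrableOn_exp : IntegrableOn (fun r => Real.exp (-(2 * 𝓜.m) * r)) (Set.Ioi 0) :=
  exp_neg_integrableOn_Ioi 0 (by linarith [𝓜.m_pos])

theorem kernel_mul_J (X : Op H) (r : ℝ) : 𝓜.kernel X r * 𝓜.J = -(𝓜.J * 𝓜.kernel X r) := by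
  rw [kernel, mul_assoc _ (𝓜.S r) 𝓜.J, (𝓜.S_J r).eq, ← mul_assoc, mul_assoc _ _ 𝓜.J,
    mul_assoc 𝓜.J, 𝓜.oddPart_mul_J, mul_neg, mul_neg, neg_mul, ← mul_assoc 𝓜.J (_ * _) (𝓜.S r),
    ← mul_assoc 𝓜.J (𝓜.S r), ← (𝓜.S_J r).eq, mul_assoc (𝓜.S r) 𝓜.J]

variable [CompleteSpace H]

omit [CompleteSpace H] in
theorem integrableOn_kernel (X : Op H) : IntegrableOn (𝓜.kernel X) (Set.Ioi 0) := by
  refine (𝓜.integrableOn_exp.mul_const ‖X‖).mono'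
    ((𝓜.continuousOn_kernel X).aestronglyMeasurable measurableSet_Ioi) ?_
  filter_upwards [ae_restrict_mem measurableSet_Ioi] with r hr using 𝓜.norm_kernel_le X hr

/-- The inverse of the commutator with `D` on odd operators. -/
def invComm : Op H →L[ℂ] Op H :=
  LinearMap.mkContinuous
    { toFun := fun X => ∫ r in Set.Ioi 0, 𝓜.kernel X r
      map_add' := fun X Y => by
        rw [← integral_add (𝓜.integrableOn_kernel X) (𝓜.integrableOn_kernel Y)]
        simp only [kernel, map_add, mul_add, add_mul]
      map_smul' := fun z X => by
        rw [RingHom.id_apply, ← integral_smul]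
        simp only [kernel, map_smul, mul_smul_comm, smul_mul_assoc] }
    (∫ r in Set.Ioi 0, Real.exp (-(2 * 𝓜.m) * r)) fun X => by
      rw [← integral_mul_const]
      refine norm_integral_le_of_norm_le (𝓜.integrableOn_exp.mul_const _) ?_
      filter_upwards [ae_restrict_mem measurableSet_Ioi] with r hr using 𝓜.norm_kernel_le X hr

theorem invComm_apply (X : Op H) : 𝓜.invComm X = ∫ r in Set.Ioi 0, 𝓜.kernel X r := rfl

theorem invComm_mul_J (X : Op H) : 𝓜.invComm X * 𝓜.J = -(𝓜.J * 𝓜.invComm X) := by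
  have h1 := ((ContinuousLinearMap.mul ℂ (Op H)).flip 𝓜.J).integral_comp_comm
    (𝓜.integrableOn_kernel X)
  have h2 := (ContinuousLinearMap.mul ℂ (Op H) 𝓜.J).integral_comp_comm (𝓜.integrableOn_kernel X)
  simp only [ContinuousLinearMap.flip_apply, ContinuousLinearMap.mul_apply', kernel_mul_J,
    integral_neg] at h1 h2
  rw [invComm_apply, ← h1, h2]

omit [CompleteSpace H] in
theorem S_kernel_S (X : Op H) {r ε : ℝ} (hr : 0 < r) (hε : 0 < ε) :
    𝓜.S ε * 𝓜.kernel X r * 𝓜.S ε = 𝓜.kernel X (r + ε) := by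
  have e : 𝓜.S (r + ε) = 𝓜.S ε * 𝓜.S r := by rw [add_comm, 𝓜.S_add ε r hε hr]
  rw [kernel, kernel]
  nth_rewrite 1 [e]
  rw [𝓜.S_add r ε hr hε]
  simp only [mul_assoc]

/-- By the semigroup law, sandwiching with `e^{-ε|D|}` shifts the integration variable by `ε` and
leaves the tail of the integral. -/
theorem S_invComm_S (X : Op H) {ε : ℝ} (hε : 0 < ε) :
    𝓜.S ε * 𝓜.invComm X * 𝓜.S ε =
      𝓜.invComm X - ∫ r in (0 : ℝ)..ε, 𝓜.kernel X r := by
  have h1 := ((ContinuousLinearMap.mul ℂ (Op H) (𝓜.S ε)).comp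
    ((ContinuousLinearMap.mul ℂ (Op H)).flip (𝓜.S ε))).integral_comp_comm
    (𝓜.integrableOn_kernel X)
  simp only [ContinuousLinearMap.comp_apply, ContinuousLinearMap.flip_apply,
    ContinuousLinearMap.mul_apply', ← mul_assoc] at h1
  rw [invComm_apply, ← h1]
  have h2 : ∫ r in Set.Ioi 0, 𝓜.S ε * 𝓜.kernel X r * 𝓜.S ε =
      ∫ r in Set.Ioi 0, 𝓜.kernel X (r + ε) :=
    setIntegral_congr_fun measurableSet_Ioi fun r hr => 𝓜.S_kernel_S X hr hε
  have h3 : ∫ r in Set.Ioi 0, 𝓜.kernel X (r + ε) = ∫ r in Set.Ioi ε, 𝓜.kernel X r := by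
    have := (measurePreserving_add_right volume ε).setIntegral_preimage_emb
      (measurableEmbedding_addRight ε) (𝓜.kernel X) (Set.Ioi ε)
    simpa using this
  rw [h2, h3]
  rw [intervalIntegral.integral_of_le hε.le, eq_sub_iff_add_eq, add_comm, ← setIntegral_union]
  · rw [Set.Ioc_union_Ioi_eq_Ioi hε.le]
  · exact Set.Ioc_disjoint_Ioi le_rfl
  · exact measurableSet_Ioi
  · exact (𝓜.integrableOn_kernel X).mono_set Set.Ioc_subset_Ioi_self
  · exact (𝓜.integrableOn_kernel X).mono_set (Set.Ioi_subset_Ioi hε.le)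

/-- This is the regularized form of `|D| L + L |D| = J Y`. It comes from differentiating
`S_invComm_S` in `ε`: the product rule computes one side, the fundamental theorem of calculus the
other. -/
theorem Ω_invComm (X : Op H) {ε : ℝ} (hε : 0 < ε) :
    𝓜.Ω ε * 𝓜.invComm X * 𝓜.S ε + 𝓜.S ε * 𝓜.invComm X * 𝓜.Ω ε = 𝓜.kernel X ε := by
  have h1 := ((𝓜.S_deriv ε hε).mul_const (𝓜.invComm X)).mul (𝓜.S_deriv ε hε)
  have hi : IntervalIntegrable (𝓜.kernel X) volume 0 ε :=
    (intervalIntegrable_iff_integrableOn_Ioc_of_le hε.le).2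
      ((𝓜.integrableOn_kernel X).mono_set Set.Ioc_subset_Ioi_self)
  have hm : StronglyMeasurableAtFilter (𝓜.kernel X) (𝓝 ε) :=
    (𝓜.continuousOn_kernel X).stronglyMeasurableAtFilter isOpen_Ioi ε hε
  have h2 := (intervalIntegral.integral_hasDerivAt_right hi hm
    ((𝓜.continuousOn_kernel X).continuousAt (Ioi_mem_nhds hε))).const_sub (𝓜.invComm X)
  have h3 := h2.congr_of_eventuallyEq (f₁ := fun r => 𝓜.S r * 𝓜.invComm X * 𝓜.S r) (by
    filter_upwards [Ioi_mem_nhds hε] with r hr using 𝓜.S_invComm_S X hr)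
  have h4 := h1.unique h3
  rw [neg_mul, neg_mul, mul_neg, ← neg_add, neg_inj] at h4
  exact h4

/-- Formally, `L` is odd and `D = J|D|`, so `[D, L] = J(|D| L + L |D|) = J(J Y) = Y`. To avoid the
unbounded operator, the identity is shown for `e^{-ε|D|} L e^{-ε|D|}`, integrated in time, and only
then is `ε` sent to zero. -/
theorem isCommutator_invComm (X : Op H) : 𝓜.IsCommutator (𝓜.invComm X) (oddPart 𝓜.J X) := by
  set L := 𝓜.invComm X with hL
  set Y := oddPart 𝓜.J X
  have hreg : ∀ ε, 0 < ε → 𝓜.IsCommutator (𝓜.S ε * L * 𝓜.S ε) (𝓜.S ε * Y * 𝓜.S ε) := by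
    intro ε hε t
    have h1 := StrongDerivAt.of_hasDerivAt (𝓜.ES_deriv ε hε t)
    have h2 := StrongDerivAt.of_hasDerivAt ((𝓜.ES_deriv ε hε (-t)).scomp t (hasDerivAt_neg t))
    have h3 := (h1.mul (StrongDerivAt.const L t)).mul h2
    have e : ∀ s, 𝓜.conj s (𝓜.S ε * L * 𝓜.S ε) =
        𝓜.E s * 𝓜.S ε * L * (𝓜.E (-s) * 𝓜.S ε) := fun s => by
      rw [(𝓜.E_S (-s) ε).eq, conj]; simp only [mul_assoc]
    simp only [e]
    refine h3.congr_deriv ?_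
    have hk := 𝓜.Ω_invComm X hε
    have hE : 𝓜.E (-t) * (𝓜.J * 𝓜.Ω ε) = 𝓜.J * 𝓜.Ω ε * 𝓜.E (-t) := by
      have hc : ∀ s, Commute (𝓜.E s) (𝓜.Ω ε) := fun s => by
        have h6 := ((𝓜.S_deriv ε hε).const_mul (𝓜.E s))
        have h7 := ((𝓜.S_deriv ε hε).mul_const (𝓜.E s))
        simp only [(𝓜.E_S s _).eq] at h6
        have := h6.unique h7
        rw [mul_neg, neg_mul, neg_inj] at this
        exact this
      rw [← mul_assoc, (𝓜.E_J _).eq, mul_assoc, (hc _).eq, mul_assoc]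
    have hJ : L * 𝓜.J = -(𝓜.J * L) := 𝓜.invComm_mul_J X
    -- Moving `J` across the odd operator `L` changes the sign, which turns the commutator into the
    -- sum computed in `Ω_invComm`.
    have hkey : 𝓜.J * 𝓜.Ω ε * L * 𝓜.S ε - 𝓜.S ε * L * (𝓜.J * 𝓜.Ω ε) = 𝓜.S ε * Y * 𝓜.S ε := by
      have e1 : 𝓜.S ε * L * (𝓜.J * 𝓜.Ω ε) = -(𝓜.J * (𝓜.S ε * L * 𝓜.Ω ε)) := by
        rw [← mul_assoc, mul_assoc _ L, hJ, mul_neg, neg_mul, ← mul_assoc (𝓜.S ε), (𝓜.S_J ε).eq]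
        simp only [mul_assoc]
      have e2 : 𝓜.J * 𝓜.kernel X ε = 𝓜.S ε * Y * 𝓜.S ε := by
        rw [kernel, ← mul_assoc, ← mul_assoc, ← (𝓜.S_J ε).eq, mul_assoc (𝓜.S ε), 𝓜.J_mul_cancel]
      rw [e1, ← e2, ← hk, ← hL, mul_add, sub_neg_eq_add]
      simp only [mul_assoc]
    simp only [Function.comp_apply]
    rw [conj, ← hkey, (𝓜.E_S (-t) ε).eq, hE]
    simp only [mul_zero, add_zero, smul_mul_assoc, mul_smul_comm, mul_sub, sub_mul, mul_assoc,
      neg_smul, one_smul, mul_neg, smul_sub]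
    abel
  have hSb : BddAlong (𝓝[>] 0) 𝓜.S := by
    refine ⟨1, ?_⟩
    filter_upwards [self_mem_nhdsWithin] with r hr
    refine (𝓜.S_norm r hr).trans (Real.exp_le_one_iff.2 ?_)
    have := mul_pos 𝓜.m_pos hr
    linarith
  have hSA : ∀ (A : Op H) f, Tendsto (fun r => (𝓜.S r * A * 𝓜.S r) f) (𝓝[>] 0) (𝓝 (A f)) := by
    intro A f
    exact hSb.tendsto_apply (𝓜.S_tendsto (A f)) ((A.continuous.tendsto f).comp (𝓜.S_tendsto f))
  have hcY : ∀ A : Op H, StrongCont fun t => 𝓜.conj t A := fun A =>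
    𝓜.conj_strongCont (StrongCont.const A)
  -- The derivatives are not known to converge as such, but the integrated identity passes to the
  -- limit by dominated convergence. The derivative is recovered afterwards from the strong
  -- continuity of the integrand.
  have hint : ∀ t f, ∫ s in (0:ℝ)..t, (Complex.I • 𝓜.conj s Y) f = 𝓜.conj t L f - L f := by
    intro t f
    have h1 : ∀ᶠ ε in 𝓝[>] (0:ℝ), ∫ s in (0:ℝ)..t, (Complex.I • 𝓜.conj s (𝓜.S ε * Y * 𝓜.S ε)) f =
        𝓜.conj t (𝓜.S ε * L * 𝓜.S ε) f - (𝓜.S ε * L * 𝓜.S ε) f := by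
      filter_upwards [self_mem_nhdsWithin] with ε hε
      rw [StrongCont.integral_eq_sub (hreg ε hε) ((hcY _).const_smul _)]
      congr 2
      simp [conj, 𝓜.E_zero]
    have h2 : ∀ (A : Op H) s, Tendsto (fun ε => 𝓜.conj s (𝓜.S ε * A * 𝓜.S ε) f) (𝓝[>] 0)
        (𝓝 (𝓜.conj s A f)) := fun A s =>
      ((𝓜.E s).continuous.tendsto _).comp (hSA A (𝓜.E (-s) f))
    have h3 : Tendsto (fun ε => ∫ s in (0:ℝ)..t, (Complex.I • 𝓜.conj s (𝓜.S ε * Y * 𝓜.S ε)) f)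
        (𝓝[>] 0) (𝓝 (∫ s in (0:ℝ)..t, (Complex.I • 𝓜.conj s Y) f)) := by
      obtain ⟨c, hc⟩ := (hSb.mul (BddAlong.of_le (fun _ => le_refl ‖Y‖))).mul hSb
      refine intervalIntegral.tendsto_integral_filter_of_dominated_convergence
        (fun _ => c * ‖f‖) (Eventually.of_forall fun ε =>
          (((hcY _).const_smul Complex.I).cont f).aestronglyMeasurable) ?_ (by simp) ?_
      · filter_upwards [hc] with ε h
        refine ae_of_all _ fun s _ => ?_
        rw [smul_apply, norm_smul, Complex.norm_I, one_mul]
        exact ContinuousLinearMap.le_of_opNorm_le _ ((𝓜.conj_norm_le _ _).trans h) f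
      · exact ae_of_all _ fun s _ => (h2 Y s).const_smul Complex.I
    exact tendsto_nhds_unique h3 (((h2 L t).sub (hSA L f)).congr' (h1.mono fun _ h => h.symm))
  intro t
  refine ⟨.of_le fun t => 𝓜.conj_norm_le t L, fun f => ?_⟩
  have hc := ((hcY Y).const_smul Complex.I).cont f
  have h4 := (intervalIntegral.integral_hasDerivAt_right (hc.intervalIntegrable 0 t)
    (hc.stronglyMeasurableAtFilter _ _) hc.continuousAt).add_const (L f)
  simpa only [hint, sub_add_cancel] using h4

end FreeModel

end FreeModel

end DiracSwitching

end

/-! ### Banach spaces of operators that become Hilbert–Schmidt after weighting -/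

noncomputable section

namespace DiracSwitching

section WeightedClass

variable {H : Type*} [NormedAddCommGroup H] [InnerProductSpace ℂ H]
variable {ι : Type*} (b : HilbertBasis ι ℂ H) (G G' : Op H)

/-- The pairs `(X, (G X bᵢ)ᵢ)` of a bounded operator `X` such that `G X` is Hilbert-Schmidt and the
square summable family that represents `G X`. -/
def weightedGraph : Submodule ℂ (Op H × lp (fun _ : ι => H) 2) where
  carrier := {z | ∀ i, z.2 i = G (z.1 (b i))}
  add_mem' := fun {x y} hx hy i => by simp [hx i, hy i]
  zero_mem' := fun i => by simp
  smul_mem' := fun c x hx i => by simp [hx i]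

/-- The Banach space of the bounded operators `X` such that `G X` is Hilbert-Schmidt. -/
def WeightedHS : Type _ := weightedGraph b G

instance : NormedAddCommGroup (WeightedHS b G) :=
  inferInstanceAs (NormedAddCommGroup (weightedGraph b G))

instance : NormedSpace ℂ (WeightedHS b G) :=
  inferInstanceAs (NormedSpace ℂ (weightedGraph b G))

/-- The graph is cut out by one closed condition for each basis vector. The resulting completeness
is needed for the inverse function theorem and for the inversion by Neumann series. -/
theorem isClosed_weightedGraph : IsClosed (weightedGraph b G : Set (Op H × lp (fun _ : ι => H) 2)) := by
  have : (weightedGraph b G : Set (Op H × lp (fun _ : ι => H) 2)) =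
      ⋂ i, {z | z.2 i = G (z.1 (b i))} := by
    ext z; rw [Set.mem_iInter]; rfl
  rw [this]
  refine isClosed_iInter fun i => isClosed_eq ?_ ?_
  · exact (lp.evalCLM ℂ (fun _ : ι => H) 2 i).continuous.comp continuous_snd
  · exact G.continuous.comp (continuous_fst.clm_apply continuous_const)

instance [CompleteSpace H] : CompleteSpace (WeightedHS b G) :=
  (isClosed_weightedGraph b G).completeSpace_coe

namespace WeightedHS

/-- The underlying operator. -/
def op : WeightedHS b G →L[ℂ] Op H :=
  ((ContinuousLinearMap.fst ℂ _ _).comp (weightedGraph b G).subtypeL :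
    weightedGraph b G →L[ℂ] Op H)

variable {b G G'}

/-- The square summable component is determined by the operator, so identities in the class may be
checked on operators. -/
theorem op_injective : Function.Injective (op b G) := by
  rintro ⟨⟨X, v⟩, hx⟩ ⟨⟨Y, w⟩, hy⟩ (h : X = Y)
  subst h
  have : v = w := by ext i; exact (hx i).trans (hy i).symm
  exact Subtype.ext (Prod.ext rfl this)

theorem norm_op_le (x : WeightedHS b G) : ‖op b G x‖ ≤ ‖x‖ := le_max_left _ _

theorem hsLe (x : WeightedHS b G) : HSLe b (G * op b G x) ‖x‖ := by
  intro s
  have h1 : ‖hsTrunc b s (G * op b G x)‖ ^ 2 ≤ ‖x.1.2‖ ^ 2 := by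
    rw [norm_hsTrunc_sq]
    have := lp.sum_rpow_le_norm_rpow (p := 2) (by norm_num) x.1.2 s
    simp only [ENNReal.toReal_ofNat, Real.rpow_ofNat] at this
    refine le_trans (le_of_eq ?_) this
    exact Finset.sum_congr rfl fun i _ => by rw [x.2 i]; rfl
  exact ((pow_le_pow_iff_left₀ (norm_nonneg _) (norm_nonneg _) two_ne_zero).1 h1).trans
    (le_max_right _ _)

/-- The element of the class with a given underlying operator. -/
theorem exists_of_hsLe {X : Op H} {c : ℝ} (h : HSLe b (G * X) c) :
    ∃ x : WeightedHS b G, op b G x = X ∧ ‖x‖ ≤ max ‖X‖ c := by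
  have hs : ∀ s : Finset ι, ∑ i ∈ s, ‖G (X (b i))‖ ^ (2 : ℝ≥0∞).toReal ≤
      c ^ (2 : ℝ≥0∞).toReal := by
    intro s
    simp only [ENNReal.toReal_ofNat, Real.rpow_ofNat]
    have := norm_hsTrunc_sq b s (G * X)
    simp only [mul_apply_eq_comp] at this
    rw [← this]
    exact pow_le_pow_left₀ (norm_nonneg _) (h s) 2
  refine ⟨⟨(X, ⟨fun i => G (X (b i)), memℓp_gen' hs⟩), fun i => rfl⟩, rfl, ?_⟩
  exact max_le_max le_rfl (lp.norm_le_of_forall_sum_le (by norm_num) h.nonneg hs)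

/-- The element of the class with underlying operator `X`. -/
def mk {X : Op H} (h : ∃ c, HSLe b (G * X) c) : WeightedHS b G :=
  (exists_of_hsLe h.choose_spec).choose

@[simp] theorem op_mk {X : Op H} (h : ∃ c, HSLe b (G * X) c) : op b G (mk h) = X :=
  (exists_of_hsLe h.choose_spec).choose_spec.1

theorem norm_le_of_hsLe {x : WeightedHS b G} {c : ℝ} (h : HSLe b (G * op b G x) c) :
    ‖x‖ ≤ max ‖op b G x‖ c := by
  obtain ⟨y, hy, hn⟩ := exists_of_hsLe h
  rwa [op_injective hy] at hn

variable (b) in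
/-- A bounded superoperator that respects the Hilbert-Schmidt bounds acts between the classes. -/
def map (T : Op H →L[ℂ] Op H) (c : ℝ)
    (h : ∀ X d, HSLe b (G * X) d → HSLe b (G' * T X) (c * d)) :
    WeightedHS b G →L[ℂ] WeightedHS b G' :=
  LinearMap.mkContinuous
    { toFun := fun x => mk ⟨_, h _ _ (hsLe x)⟩
      map_add' := fun x y => op_injective (by simp)
      map_smul' := fun z x => op_injective (by simp) }
    (max ‖T‖ c) fun x => by
      have h0 := h _ _ (hsLe x)
      refine (norm_le_of_hsLe (c := c * ‖x‖) (by simpa using h0)).trans ?_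
      refine (max_le_max ?_ le_rfl).trans (max_mul_of_nonneg _ _ (norm_nonneg x)).ge
      simp only [LinearMap.coe_mk, AddHom.coe_mk, op_mk]
      exact (T.le_opNorm _).trans (mul_le_mul_of_nonneg_left (norm_op_le x) (norm_nonneg _))

@[simp] theorem op_map (T : Op H →L[ℂ] Op H) (c : ℝ)
    (h : ∀ X d, HSLe b (G * X) d → HSLe b (G' * T X) (c * d)) (x : WeightedHS b G) :
    op b G' (map b T c h x) = T (op b G x) := op_mk _

theorem norm_map_le (T : Op H →L[ℂ] Op H) (c : ℝ)
    (h : ∀ X d, HSLe b (G * X) d → HSLe b (G' * T X) (c * d)) :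
    ‖map b T c h‖ ≤ max ‖T‖ c :=
  LinearMap.mkContinuous_norm_le _ ((norm_nonneg T).trans (le_max_left _ _)) _

variable [CompleteSpace H]

variable (b G) in
/-- Multiplication on the right by bounded operators. -/
def mulRight : WeightedHS b G →L[ℂ] Op H →L[ℂ] WeightedHS b G :=
  LinearMap.mkContinuous₂
    (LinearMap.mk₂ ℂ (fun x Y => mk (X := op b G x * Y)
        ⟨_, by rw [← mul_assoc]; exact (hsLe x).mul_right Y⟩)
      (fun x y Y => op_injective (by simp [add_mul]))
      (fun z x Y => op_injective (by simp))
      (fun x Y Y' => op_injective (by simp [mul_add]))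
      (fun z x Y => op_injective (by simp)))
    1 fun x Y => by
      rw [LinearMap.mk₂_apply, one_mul (‖x‖)]
      refine (norm_le_of_hsLe (c := ‖x‖ * ‖Y‖) ?_).trans (max_le ?_ le_rfl)
      · rw [op_mk, ← mul_assoc]; exact (hsLe x).mul_right Y
      · rw [op_mk]
        exact (norm_mul_le _ _).trans (mul_le_mul_of_nonneg_right (norm_op_le x) (norm_nonneg _))

@[simp] theorem op_mulRight (x : WeightedHS b G) (Y : Op H) :
    op b G (mulRight b G x Y) = op b G x * Y := op_mk _

theorem norm_mulRight_le (x : WeightedHS b G) (Y : Op H) : ‖mulRight b G x Y‖ ≤ ‖x‖ * ‖Y‖ := by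
  refine (norm_le_of_hsLe (c := ‖x‖ * ‖Y‖) ?_).trans (max_le ?_ le_rfl)
  · rw [op_mulRight, ← mul_assoc]; exact (hsLe x).mul_right Y
  · rw [op_mulRight]
    exact (norm_mul_le _ _).trans (mul_le_mul_of_nonneg_right (norm_op_le x) (norm_nonneg _))

omit [CompleteSpace H] in
theorem hsLe_mul_left {Y : Op H} {x : WeightedHS b (1 : Op H)} :
    HSLe b (1 * (Y * op b 1 x)) (‖Y‖ * ‖x‖) := by
  have := (hsLe x).mul_left Y
  rwa [one_mul] at this ⊢

variable (b) in
/-- Multiplication of Hilbert-Schmidt operators on the left by bounded operators. -/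
def mulLeft : Op H →L[ℂ] WeightedHS b (1 : Op H) →L[ℂ] WeightedHS b (1 : Op H) :=
  LinearMap.mkContinuous₂
    (LinearMap.mk₂ ℂ (fun Y x => mk (X := Y * op b 1 x) ⟨_, hsLe_mul_left⟩)
      (fun x y Y => op_injective (by simp [add_mul]))
      (fun z x Y => op_injective (by simp))
      (fun x Y Y' => op_injective (by simp [mul_add]))
      (fun z x Y => op_injective (by simp)))
    1 fun Y x => by
      rw [LinearMap.mk₂_apply, one_mul (‖Y‖)]
      refine (norm_le_of_hsLe (c := ‖Y‖ * ‖x‖) ?_).trans (max_le ?_ le_rfl)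
      · rw [op_mk]; exact hsLe_mul_left
      · rw [op_mk]
        exact (norm_mul_le _ _).trans (mul_le_mul_of_nonneg_left (norm_op_le x) (norm_nonneg _))

@[simp] theorem op_mulLeft (Y : Op H) (x : WeightedHS b (1 : Op H)) :
    op b 1 (mulLeft b Y x) = Y * op b 1 x := op_mk _

theorem norm_mulLeft_le (Y : Op H) (x : WeightedHS b (1 : Op H)) :
    ‖mulLeft b Y x‖ ≤ ‖Y‖ * ‖x‖ := by
  refine (norm_le_of_hsLe (c := ‖Y‖ * ‖x‖) ?_).trans (max_le ?_ le_rfl)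
  · rw [op_mulLeft]; exact hsLe_mul_left
  · rw [op_mulLeft]
    exact (norm_mul_le _ _).trans (mul_le_mul_of_nonneg_left (norm_op_le x) (norm_nonneg _))

end WeightedHS

end WeightedClass

/-! ### Gain of weight under the inverse commutator -/

section Weight

variable {H : Type*} [NormedAddCommGroup H] [InnerProductSpace ℂ H]

/-- A weight for a free model: a bounded function `G` of `|D|` that is inverted by the semigroup up
to an integrable singularity, `L r * G = e^{-r|D|}`. -/
structure Weight (𝓜 : FreeModel H) where
  G : Op H
  L : ℝ → Op H
  w : ℝ → ℝ
  G_J : Commute G 𝓜.J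
  G_S : ∀ r, Commute G (𝓜.S r)
  G_L : ∀ r, Commute G (L r)
  L_G : ∀ r, 0 < r → L r * G = 𝓜.S r
  L_norm : ∀ r, 0 < r → ‖L r‖ ≤ w r
  w_int : IntegrableOn (fun r => w r * Real.exp (-𝓜.m * r)) (Set.Ioi 0)

namespace FreeModel

variable {ι : Type*} {b : HilbertBasis ι ℂ H} [CompleteSpace H] (𝓜 : FreeModel H)

omit [CompleteSpace H] in
theorem hsLe_mul_J {X : Op H} {c : ℝ} (h : HSLe b X c) : HSLe b (𝓜.J * X) c :=
  (h.mul_left 𝓜.J).mono (mul_le_of_le_one_left h.nonneg 𝓜.J_norm)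

theorem hsLe_oddPart {X : Op H} {c : ℝ} (h : HSLe b X c) : HSLe b (oddPart 𝓜.J X) c := by
  have h1 : HSLe b (X * 𝓜.J) c :=
    (h.mul_right 𝓜.J).mono (mul_le_of_le_one_right h.nonneg 𝓜.J_norm)
  refine ((h.sub (𝓜.hsLe_mul_J h1)).smul (2⁻¹ : ℂ)).mono (le_of_eq ?_)
  norm_num; ring

/-- Inside the integral, `G' S_r = L_r G` moves the weight `G` onto `X`, since taking odd parts and
multiplying by `J` both commute with `G`. What remains costs `w r` on the left and gains `e^{-mr}`
on the right. A singularity of `w` at `r = 0` is harmless if it is integrable, and this leaves room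
for `G'` to be a weaker weight than `G`. -/
theorem hsLe_invComm {G G' : Op H} {L : ℝ → Op H} {w : ℝ → ℝ} (hG : Commute G 𝓜.J)
    (hL : ∀ r, 0 < r → G' * 𝓜.S r = L r * G) (hw : ∀ r, 0 < r → ‖L r‖ ≤ w r)
    (hi : IntegrableOn (fun r => w r * Real.exp (-𝓜.m * r)) (Set.Ioi 0)) {X : Op H} {c : ℝ}
    (h : HSLe b (G * X) c) :
    HSLe b (G' * 𝓜.invComm X) ((∫ r in Set.Ioi 0, w r * Real.exp (-𝓜.m * r)) * c) := by
  have h1 := (ContinuousLinearMap.mul ℂ (Op H) G').integral_comp_comm (𝓜.integrableOn_kernel X)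
  have h2 := (ContinuousLinearMap.mul ℂ (Op H) G').integrable_comp (𝓜.integrableOn_kernel X)
  simp only [ContinuousLinearMap.mul_apply'] at h1 h2
  rw [invComm_apply, ← h1, ← integral_mul_const]
  refine HSLe.integral h2 (hi.mul_const c) ?_
  filter_upwards [ae_restrict_mem measurableSet_Ioi] with r hr
  have e : G' * 𝓜.kernel X r = L r * (𝓜.J * oddPart 𝓜.J (G * X)) * 𝓜.S r := by
    rw [kernel, 𝓜.oddPart_mul_of_commute_left hG, ← mul_assoc G', ← mul_assoc G', hL r hr, mul_assoc (L r),
      ← mul_assoc G, hG.eq]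
    simp only [mul_assoc]
  rw [e]
  refine (((𝓜.hsLe_mul_J (𝓜.hsLe_oddPart h)).mul_left (L r)).mul_right (𝓜.S r)).mono ?_
  rw [mul_right_comm]
  exact mul_le_mul_of_nonneg_right (mul_le_mul (hw r hr) (𝓜.S_norm r hr) (norm_nonneg _)
    ((norm_nonneg _).trans (hw r hr))) h.nonneg

omit [CompleteSpace H] in
theorem integrableOn_exp_mul_exp :
    IntegrableOn (fun r => Real.exp (-𝓜.m * r) * Real.exp (-𝓜.m * r)) (Set.Ioi 0) := by
  refine 𝓜.integrableOn_exp.congr_fun (fun r _ => ?_) measurableSet_Ioi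
  rw [← Real.exp_add]; ring_nf

/-- A bound for the inverse commutator that is common to all classes. -/
def invCommConst : ℝ :=
  max ‖𝓜.invComm‖ (∫ r in Set.Ioi 0, Real.exp (-𝓜.m * r) * Real.exp (-𝓜.m * r))

variable (b) in
/-- The inverse commutator on a weighted class. -/
def invCommSelf (G : Op H) (hJ : Commute G 𝓜.J) (hS : ∀ r, Commute G (𝓜.S r)) :
    WeightedHS b G →L[ℂ] WeightedHS b G :=
  WeightedHS.map b 𝓜.invComm _ fun _ _ h =>
    𝓜.hsLe_invComm hJ (fun r _ => (hS r).eq) 𝓜.S_norm 𝓜.integrableOn_exp_mul_exp h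

@[simp] theorem op_invCommSelf (G : Op H) (hJ : Commute G 𝓜.J) (hS : ∀ r, Commute G (𝓜.S r))
    (x : WeightedHS b G) :
    WeightedHS.op b G (𝓜.invCommSelf b G hJ hS x) = 𝓜.invComm (WeightedHS.op b G x) :=
  WeightedHS.op_map _ _ _ _

theorem norm_invCommSelf_le (G : Op H) (hJ : Commute G 𝓜.J) (hS : ∀ r, Commute G (𝓜.S r)) :
    ‖𝓜.invCommSelf b G hJ hS‖ ≤ 𝓜.invCommConst :=
  WeightedHS.norm_map_le _ _ _

variable {𝓜} (𝓦 : Weight 𝓜)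

variable (b) in
/-- The inverse commutator improves the weight from `G²` to `G`. -/
def invCommTwo : WeightedHS b (𝓦.G * 𝓦.G) →L[ℂ] WeightedHS b 𝓦.G :=
  WeightedHS.map b 𝓜.invComm _ fun _ _ h =>
    𝓜.hsLe_invComm (𝓦.G_J.mul_left 𝓦.G_J)
      (fun r hr => by rw [← mul_assoc, ← (𝓦.G_L r).eq, mul_assoc, 𝓦.L_G r hr])
      𝓦.L_norm 𝓦.w_int h

@[simp] theorem op_invCommTwo (x : WeightedHS b (𝓦.G * 𝓦.G)) :
    WeightedHS.op b 𝓦.G (invCommTwo b 𝓦 x) = 𝓜.invComm (WeightedHS.op b _ x) :=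
  WeightedHS.op_map _ _ _ _

variable (b) in
/-- The inverse commutator improves the weight from `G` to `1`. -/
def invCommOne : WeightedHS b 𝓦.G →L[ℂ] WeightedHS b (1 : Op H) :=
  WeightedHS.map b 𝓜.invComm _ fun _ _ h =>
    𝓜.hsLe_invComm 𝓦.G_J (fun r hr => by rw [one_mul, 𝓦.L_G r hr]) 𝓦.L_norm 𝓦.w_int h

@[simp] theorem op_invCommOne (x : WeightedHS b 𝓦.G) :
    WeightedHS.op b 1 (invCommOne b 𝓦 x) = 𝓜.invComm (WeightedHS.op b _ x) :=
  WeightedHS.op_map _ _ _ _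

variable (b) in
/-- Hilbert-Schmidt operators belong to the weighted class. -/
def ofHS : WeightedHS b (1 : Op H) →L[ℂ] WeightedHS b 𝓦.G :=
  WeightedHS.map b (ContinuousLinearMap.id ℂ _) ‖𝓦.G‖ fun X d h => by
    simpa using h.mul_left 𝓦.G

omit [CompleteSpace H] in
@[simp] theorem op_ofHS (x : WeightedHS b (1 : Op H)) :
    WeightedHS.op b 𝓦.G (ofHS b 𝓦 x) = WeightedHS.op b 1 x :=
  WeightedHS.op_map _ _ _ _

end FreeModel

end Weight

end DiracSwitching

end

/-! ### Stationary block diagonalization -/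

noncomputable section

namespace DiracSwitching

/-- An implicit function theorem for equations `z + l a + q (a, z) = 0` without linear part in
`q`. -/
theorem exists_analytic_solution {X : Type*} [NormedAddCommGroup X] [NormedSpace ℂ X]
    [CompleteSpace X] (l : X →L[ℂ] X) {q : X × X → X} (hq : ContDiff ℂ ω q) (hq0 : q 0 = 0)
    (hq' : HasFDerivAt q (0 : X × X →L[ℂ] X) 0) {η : ℝ} (hη : 0 < η) :
    ∃ δ > 0, ∃ z : X → X, z 0 = 0 ∧ ∀ a, ‖a‖ < δ →
      ContDiffAt ℂ ω z a ∧ ‖z a‖ < η ∧ z a + l a + q (a, z a) = 0 := by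
  -- The inverse function theorem is applied to the equation together with its parameter. The
  -- derivative at the origin is the triangular map `e`, and `z a` is the second component of the
  -- local preimage of `(a, 0)`.
  let f : X × X → X × X := fun p => (p.1, p.2 + l p.1 + q p)
  let e : (X × X) ≃L[ℂ] (X × X) := ContinuousLinearEquiv.equivOfInverse
    ((ContinuousLinearMap.fst ℂ X X).prod
      (ContinuousLinearMap.snd ℂ X X + l.comp (ContinuousLinearMap.fst ℂ X X)))
    ((ContinuousLinearMap.fst ℂ X X).prod
      (ContinuousLinearMap.snd ℂ X X - l.comp (ContinuousLinearMap.fst ℂ X X)))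
    (fun p => by ext <;> simp) (fun p => by ext <;> simp)
  have hf : ContDiff ℂ ω f := contDiff_fst.prodMk
    ((contDiff_snd.add (l.contDiff.comp contDiff_fst)).add hq)
  have hf' : HasFDerivAt f (e : X × X →L[ℂ] X × X) 0 := by
    have h := (hasFDerivAt_fst (𝕜 := ℂ) (p := (0 : X × X))).prodMk
      (((hasFDerivAt_snd (𝕜 := ℂ) (p := (0 : X × X))).add
        (l.hasFDerivAt.comp (0 : X × X) hasFDerivAt_fst)).add hq')
    refine h.congr_fderiv ?_
    ext p <;> simp [e]
  have hω : (ω : WithTop ℕ∞) ≠ 0 := by simp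
  have hf0 : f 0 = 0 := by simp [f, hq0]
  let g := hf.contDiffAt.localInverse hf' hω
  have hg : ContDiffAt ℂ ω g (f 0) := hf.contDiffAt.to_localInverse hf' hω
  have hs := hf.contDiffAt.hasStrictFDerivAt' hf' hω
  have hg0 : g (f 0) = 0 := hs.localInverse_apply_image
  have hr : ∀ᶠ y in 𝓝 (f 0), f (g y) = y := hs.eventually_right_inverse
  rw [hf0] at hg hg0 hr
  have hgev : ∀ᶠ y in 𝓝 (0 : X × X), ContDiffAt ℂ ω g y := hg.eventually (by simp)
  have hsmall : ∀ᶠ y in 𝓝 (0 : X × X), ‖g y‖ < η := by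
    have := (hg.continuousAt.norm)
    rw [ContinuousAt, hg0, norm_zero] at this
    exact this.eventually (gt_mem_nhds hη)
  obtain ⟨δ, hδ, hball⟩ := Metric.eventually_nhds_iff.1 (hr.and (hgev.and hsmall))
  refine ⟨δ, hδ, fun a => (g (a, 0)).2, ?_, fun a ha => ?_⟩
  · have : g ((0 : X), (0 : X)) = 0 := hg0
    simp [this]
  · obtain ⟨h1, h2, h3⟩ := @hball (a, 0) (by simpa [Prod.dist_eq, hδ] using ha)
    refine ⟨?_, (norm_snd_le _).trans_lt h3, ?_⟩
    · have hm : ContDiffAt ℂ ω (fun a : X => (a, (0 : X))) a :=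
        contDiffAt_id.prodMk contDiffAt_const
      exact contDiffAt_snd.comp a (ContDiffAt.comp a h2 hm)
    · have e1 : (g (a, 0)).1 = a := congrArg Prod.fst h1
      have e2 := congrArg Prod.snd h1
      simp only [f, e1] at e2
      have e3 : (a, (g (a, 0)).2) = g (a, 0) := Prod.ext e1.symm rfl
      rw [e3]
      exact e2

namespace FreeModel

open WeightedHS

variable {H : Type*} [NormedAddCommGroup H] [InnerProductSpace ℂ H] [CompleteSpace H]
variable {ι : Type*} {b : HilbertBasis ι ℂ H} (𝓜 : FreeModel H)

/-- The stationary block diagonalization: for a small perturbation `a` there is a solution `z` of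
`[D, z] = ((z - 1) a (1 + z))_odd`, which depends analytically on `a`. -/
theorem exists_blockDiagonalizer (G : Op H) (hJ : Commute G 𝓜.J) (hS : ∀ r, Commute G (𝓜.S r))
    {η : ℝ} (hη : 0 < η) :
    ∃ δ > 0, ∃ z : WeightedHS b G → WeightedHS b G, z 0 = 0 ∧ ∀ a, ‖a‖ < δ →
      ContDiffAt ℂ ω z a ∧ ‖z a‖ < η ∧
      z a = 𝓜.invCommSelf b G hJ hS (mulRight b G (z a) (op b G a) +
        mulRight b G (mulRight b G (z a) (op b G a)) (op b G (z a)) - a -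
        mulRight b G a (op b G (z a))) := by
  let l := 𝓜.invCommSelf b G hJ hS
  let R := mulRight b G
  let o := op b G
  let q : WeightedHS b G × WeightedHS b G → WeightedHS b G := fun p =>
    -l (R p.2 (o p.1) + R (R p.2 (o p.1)) (o p.2) - R p.1 (o p.2))
  have h1 : ContDiff ℂ ω fun p : WeightedHS b G × WeightedHS b G => R p.2 (o p.1) :=
    (R.contDiff.comp contDiff_snd).clm_apply (o.contDiff.comp contDiff_fst)
  have h2 : ContDiff ℂ ω fun p : WeightedHS b G × WeightedHS b G => R (R p.2 (o p.1)) (o p.2) :=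
    (R.contDiff.comp h1).clm_apply (o.contDiff.comp contDiff_snd)
  have h3 : ContDiff ℂ ω fun p : WeightedHS b G × WeightedHS b G => R p.1 (o p.2) :=
    (R.contDiff.comp contDiff_fst).clm_apply (o.contDiff.comp contDiff_snd)
  have hq : ContDiff ℂ ω q := (l.contDiff.comp ((h1.add h2).sub h3)).neg
  have d1 : HasFDerivAt (fun p : WeightedHS b G × WeightedHS b G => R p.2 (o p.1))
      (0 : WeightedHS b G × WeightedHS b G →L[ℂ] WeightedHS b G) 0 := by
    have := ((R.hasFDerivAt.comp (0 : WeightedHS b G × WeightedHS b G)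
      hasFDerivAt_snd)).clm_apply (o.hasFDerivAt.comp (0 : WeightedHS b G × WeightedHS b G)
      hasFDerivAt_fst)
    refine this.congr_fderiv ?_
    ext p <;> simp
  have d2 : HasFDerivAt (fun p : WeightedHS b G × WeightedHS b G => R (R p.2 (o p.1)) (o p.2))
      (0 : WeightedHS b G × WeightedHS b G →L[ℂ] WeightedHS b G) 0 := by
    have := ((R.hasFDerivAt.comp (0 : WeightedHS b G × WeightedHS b G)
      d1)).clm_apply (o.hasFDerivAt.comp (0 : WeightedHS b G × WeightedHS b G)
      hasFDerivAt_snd)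
    refine this.congr_fderiv ?_
    ext p <;> simp
  have d3 : HasFDerivAt (fun p : WeightedHS b G × WeightedHS b G => R p.1 (o p.2))
      (0 : WeightedHS b G × WeightedHS b G →L[ℂ] WeightedHS b G) 0 := by
    have := ((R.hasFDerivAt.comp (0 : WeightedHS b G × WeightedHS b G)
      hasFDerivAt_fst)).clm_apply (o.hasFDerivAt.comp (0 : WeightedHS b G × WeightedHS b G)
      hasFDerivAt_snd)
    refine this.congr_fderiv ?_
    ext p <;> simp
  have hq' : HasFDerivAt q (0 : WeightedHS b G × WeightedHS b G →L[ℂ] WeightedHS b G) 0 := by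
    refine (l.hasFDerivAt.comp (0 : WeightedHS b G × WeightedHS b G)
      ((d1.add d2).sub d3)).neg.congr_fderiv ?_
    simp
  obtain ⟨δ, hδ, z, hz0, hz⟩ := exists_analytic_solution l hq (by simp [q]) hq' hη
  refine ⟨δ, hδ, z, hz0, fun a ha => ⟨(hz a ha).1, (hz a ha).2.1, ?_⟩⟩
  have h := (hz a ha).2.2
  have : z a = l (R (z a) (o a) + R (R (z a) (o a)) (o (z a)) - R a (o (z a))) - l a := by
    rw [← sub_eq_zero, ← h]; simp only [q]; abel
  rw [← map_sub] at this
  exact this.trans (congrArg l (sub_right_comm _ _ _))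

end FreeModel

end DiracSwitching

end

/-! ### The commutator equation for the block diagonal Hamiltonian, and adiabatic frames -/

noncomputable section

namespace DiracSwitching

section RealCurves

variable {E F : Type*} [NormedAddCommGroup E] [NormedSpace ℂ E] [NormedAddCommGroup F]
  [NormedSpace ℂ F] {n : WithTop ℕ∞}

theorem contDiff_clm_comp (L : E →L[ℂ] F) {x : ℝ → E} (hx : ContDiff ℝ n x) :
    ContDiff ℝ n fun σ => L (x σ) :=
  (L.contDiff.restrict_scalars ℝ).comp hx

theorem contDiff_clm_apply {L : ℝ → E →L[ℂ] F} {x : ℝ → E} (hL : ContDiff ℝ n L)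
    (hx : ContDiff ℝ n x) : ContDiff ℝ n fun σ => L σ (x σ) := by
  have h : ContDiff ℂ n fun p : (E →L[ℂ] F) × E => p.1 p.2 := contDiff_fst.clm_apply contDiff_snd
  exact (h.restrict_scalars ℝ).comp (hL.prodMk hx)

theorem hasDerivAt_clm_comp (L : E →L[ℂ] F) {x : ℝ → E} {x' : E} {σ : ℝ}
    (hx : HasDerivAt x x' σ) : HasDerivAt (fun σ => L (x σ)) (L x') σ :=
  (L.restrictScalars ℝ).hasFDerivAt.comp_hasDerivAt σ hx

theorem ContDiff.hasDerivAt_deriv {x : ℝ → E} (hx : ContDiff ℝ ∞ x) (σ : ℝ) :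
    HasDerivAt x (deriv x σ) σ :=
  ((hx.differentiable (by simp)) σ).hasDerivAt

theorem ContDiff.deriv_infty {x : ℝ → E} (hx : ContDiff ℝ ∞ x) : ContDiff ℝ ∞ (deriv x) :=
  (contDiff_infty_iff_deriv.1 hx).2

end RealCurves

namespace FreeModel

open WeightedHS

variable {H : Type*} [NormedAddCommGroup H] [InnerProductSpace ℂ H] [CompleteSpace H]
variable {ι : Type*} (b : HilbertBasis ι ℂ H) {𝓜 : FreeModel H} (𝓦 : Weight 𝓜)

variable (𝓜) in
/-- The operator `X ↦ 𝓛 [M, X]` on Hilbert-Schmidt operators, as a function of `M`. -/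
def invCommAd : Op H →L[ℂ] (WeightedHS b (1 : Op H) →L[ℂ] WeightedHS b (1 : Op H)) :=
  (ContinuousLinearMap.compL ℂ _ _ _ (𝓜.invCommSelf b 1 (Commute.one_left _)
    fun _ => Commute.one_left _)).comp (mulLeft b - (mulRight b 1).flip)

theorem op_invCommAd (M : Op H) (x : WeightedHS b (1 : Op H)) :
    op b 1 (𝓜.invCommAd b M x) = 𝓜.invComm (M * op b 1 x - op b 1 x * M) := by
  simp [invCommAd, map_sub]

/-- This is the smallness that allows `[D + M, ·]` to be inverted perturbatively from `[D, ·]`. -/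
theorem norm_invCommAd_le (M : Op H) : ‖𝓜.invCommAd b M‖ ≤ 𝓜.invCommConst * (2 * ‖M‖) := by
  have h1 : ‖mulLeft b M - (mulRight b 1).flip M‖ ≤ 2 * ‖M‖ := by
    refine ContinuousLinearMap.opNorm_le_bound _ (by positivity) fun x => ?_
    have h2 := norm_mulLeft_le M x
    have h3 := norm_mulRight_le x M
    calc _ ≤ ‖mulLeft b M x‖ + ‖mulRight b 1 x M‖ := norm_sub_le _ _
      _ ≤ 2 * ‖M‖ * ‖x‖ := by linarith
  exact (ContinuousLinearMap.opNorm_comp_le _ _).trans (mul_le_mul (𝓜.norm_invCommSelf_le _ _ _)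
    h1 (norm_nonneg _) ((norm_nonneg _).trans (le_max_left _ _)))

/-- The equation `i [D + M, ξ] = y_odd` has a smooth family of Hilbert-Schmidt solutions if `M` is
small and even. -/
theorem exists_commutator_solution {M : ℝ → Op H} (hM : ContDiff ℝ ∞ M)
    (hMJ : ∀ σ, Commute (M σ) 𝓜.J) (hs : ∀ σ, 𝓜.invCommConst * (2 * ‖M σ‖) < 1)
    {y : ℝ → WeightedHS b 𝓦.G} (hy : ContDiff ℝ ∞ y) :
    ∃ ξ : ℝ → WeightedHS b (1 : Op H), ContDiff ℝ ∞ ξ ∧ (∀ σ, y σ = 0 → ξ σ = 0) ∧ ∀ σ,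
      op b 1 (ξ σ) * 𝓜.J = -(𝓜.J * op b 1 (ξ σ)) ∧
      𝓜.IsCommutator (op b 1 (ξ σ)) (-(Complex.I • oddPart 𝓜.J (op b 𝓦.G (y σ))) -
        (M σ * op b 1 (ξ σ) - op b 1 (ξ σ) * M σ)) := by
  let Φ := 𝓜.invCommAd b
  have hΦ : ∀ σ, ‖-Φ (M σ)‖ < 1 := fun σ => by
    rw [norm_neg]; exact (norm_invCommAd_le b (M σ)).trans_lt (hs σ)
  -- Applying the inverse commutator to `[D, ξ] + [M, ξ] = -i y_odd` gives `(1 + Φ(M)) ξ = v`, which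
  -- a Neumann series solves. Inversion is smooth on units, so `ξ` is smooth in `σ`.
  let u : ℝ → (WeightedHS b (1 : Op H) →L[ℂ] WeightedHS b (1 : Op H))ˣ := fun σ =>
    Units.oneSub (-Φ (M σ)) (hΦ σ)
  have hu : ∀ σ, (u σ : WeightedHS b (1 : Op H) →L[ℂ] WeightedHS b (1 : Op H)) =
      1 + Φ (M σ) := fun σ => by rw [Units.val_oneSub, sub_neg_eq_add]
  have hinv : ContDiff ℝ ∞ fun σ => Ring.inverse (1 + Φ (M σ)) := by
    refine contDiff_iff_contDiffAt.2 fun σ => ?_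
    have h1 := (contDiffAt_ringInverse ℂ (n := ∞) (u σ)).restrict_scalars ℝ
    rw [hu] at h1
    exact h1.comp σ (contDiff_const.add (contDiff_clm_comp Φ hM)).contDiffAt
  let v : ℝ → WeightedHS b (1 : Op H) := fun σ => -(Complex.I • invCommOne b 𝓦 (y σ))
  have hv : ContDiff ℝ ∞ v :=
    (contDiff_clm_comp (-(Complex.I • invCommOne b 𝓦)) hy :)
  let ξ : ℝ → WeightedHS b (1 : Op H) := fun σ => Ring.inverse (1 + Φ (M σ)) (v σ)
  have hξ : ∀ σ, ξ σ + Φ (M σ) (ξ σ) = v σ := fun σ => by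
    have h1 : (1 + Φ (M σ)) * Ring.inverse (1 + Φ (M σ)) = 1 :=
      Ring.mul_inverse_cancel _ (hu σ ▸ (u σ).isUnit)
    have := congrArg (fun T : WeightedHS b (1 : Op H) →L[ℂ] WeightedHS b (1 : Op H) => T (v σ)) h1
    simpa using this
  refine ⟨ξ, contDiff_clm_apply hinv hv, fun σ h => by simp [ξ, v, h], fun σ => ?_⟩
  have hop : op b 1 (ξ σ) = 𝓜.invComm (-(Complex.I • op b 𝓦.G (y σ)) -
      (M σ * op b 1 (ξ σ) - op b 1 (ξ σ) * M σ)) := by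
    have h1 := congrArg (op b 1) (hξ σ)
    have h2 := eq_sub_of_add_eq ((map_add _ _ _).symm.trans h1)
    refine h2.trans ?_
    rw [op_invCommAd]
    simp only [v, map_neg, map_smul, op_invCommOne, map_sub]
  have hodd : op b 1 (ξ σ) * 𝓜.J = -(𝓜.J * op b 1 (ξ σ)) := by
    rw [hop]; exact 𝓜.invComm_mul_J _
  refine ⟨hodd, ?_⟩
  -- The inverse commutator only sees the odd part of its argument. Nothing is lost in the term `[M,
  -- ξ]`, which is already odd because `M` is even and `ξ` is odd.
  have hc := 𝓜.isCommutator_invComm (-(Complex.I • op b 𝓦.G (y σ)) -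
      (M σ * op b 1 (ξ σ) - op b 1 (ξ σ) * M σ))
  rw [← hop, map_sub, map_sub, map_neg, map_smul, 𝓜.oddPart_mul_of_commute_left (hMJ σ),
    𝓜.oddPart_mul_of_commute_right (hMJ σ), 𝓜.oddPart_eq_self hodd] at hc
  exact hc

end FreeModel

/-- A smooth family of block diagonalizing transformations for `D + h(σ) A`: with `κ = W⁻¹ W'`, in
the frame given by `W` the Hamiltonian is `D + M` with even `M`. -/
structure AdiabaticFrame {H : Type*} [NormedAddCommGroup H] [InnerProductSpace ℂ H]
    [CompleteSpace H] {ι : Type*} (b : HilbertBasis ι ℂ H) {𝓜 : FreeModel H} (𝓦 : Weight 𝓜)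
    (A : Op H) (h : ℝ → ℝ) where
  W : ℝ → Op H
  Winv : ℝ → Op H
  M : ℝ → Op H
  κ : ℝ → WeightedHS b 𝓦.G
  W_contDiff : ContDiff ℝ ∞ W
  Winv_contDiff : ContDiff ℝ ∞ Winv
  M_contDiff : ContDiff ℝ ∞ M
  κ_contDiff : ContDiff ℝ ∞ κ
  W_mul_Winv : ∀ σ, W σ * Winv σ = 1
  Winv_mul_W : ∀ σ, Winv σ * W σ = 1
  M_J : ∀ σ, Commute (M σ) 𝓜.J
  M_small : ∀ σ, 𝓜.invCommConst * (2 * ‖M σ‖) < 1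
  op_κ : ∀ σ, WeightedHS.op b 𝓦.G (κ σ) = Winv σ * deriv W σ
  commutator_W : ∀ σ, 𝓜.IsCommutator (W σ) (W σ * M σ - (h σ : ℂ) • (A * W σ))
  commutator_κ : ∀ σ, 𝓜.IsCommutator (WeightedHS.op b 𝓦.G (κ σ))
    (deriv M σ - (M σ * WeightedHS.op b 𝓦.G (κ σ) - WeightedHS.op b 𝓦.G (κ σ) * M σ) -
      ((deriv h σ : ℝ) : ℂ) • (Winv σ * A * W σ))
  W_eq_one : ∀ σ, h σ = 0 → W σ = 1
  κ_eq_zero : ∀ σ, deriv h σ = 0 → κ σ = 0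

end DiracSwitching

end

/-! ### Construction of the adiabatic frame -/

noncomputable section

namespace DiracSwitching

open WeightedHS

section Construction

variable {H : Type*} [NormedAddCommGroup H] [InnerProductSpace ℂ H]
variable {ι : Type*} (b : HilbertBasis ι ℂ H) {𝓜 : FreeModel H} (𝓦 : Weight 𝓜)

theorem contDiff_mulRight [CompleteSpace H] {G : Op H} {x : ℝ → WeightedHS b G} {Y : ℝ → Op H}
    (hx : ContDiff ℝ ∞ x) (hY : ContDiff ℝ ∞ Y) :
    ContDiff ℝ ∞ fun σ => mulRight b G (x σ) (Y σ) :=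
  contDiff_clm_apply (contDiff_clm_comp (mulRight b G) hx) hY

/-- The odd part of `(Z - 1) C` in terms of the even part `M` of `C = h A (1 + Z)`. -/
theorem FreeModel.oddPart_sub_one_mul {Z C : Op H} (hZ : Z * 𝓜.J = -(𝓜.J * Z)) :
    oddPart 𝓜.J ((Z - 1) * C) = (1 + Z) * (C - oddPart 𝓜.J C) - C := by
  set K := oddPart 𝓜.J C with hK
  have hKJ : K * 𝓜.J = -(𝓜.J * K) := 𝓜.oddPart_mul_J C
  have h1 : oddPart 𝓜.J (Z * (C - K)) = Z * (C - K) := by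
    rw [𝓜.oddPart_mul_of_commute_right (𝓜.commute_sub_oddPart C), 𝓜.oddPart_eq_self hZ]
  have h2 : oddPart 𝓜.J (Z * K) = 0 := 𝓜.oddPart_eq_zero (by
    rw [Commute, SemiconjBy, mul_assoc, hKJ, mul_neg, ← mul_assoc, hZ, neg_mul, neg_neg, mul_assoc])
  have e : (Z - 1) * C = Z * (C - K) + Z * K - C := by noncomm_ring
  rw [e, map_sub, map_add, h1, h2, ← hK]
  noncomm_ring

/-- Differentiating `(D + zA) W = W (D + M)` along the family and multiplying by `W⁻¹` from the left
gives `[D + M, W⁻¹W'] = M' - z' W⁻¹AW`. -/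
theorem isCommutator_frameGenerator {W Winv W' M M' A : Op H} {z z' : ℂ} (h1 : W * Winv = 1)
    (h2 : Winv * W = 1) (hW : 𝓜.IsCommutator W (W * M - z • (A * W)))
    (hW' : 𝓜.IsCommutator W' (W' * M + W * M' - (z' • (A * W) + z • (A * W')))) :
    𝓜.IsCommutator (Winv * W') (M' - (M * (Winv * W') - (Winv * W') * M) -
      z' • (Winv * A * W)) := by
  have h := (hW.inv h1 h2).mul hW'
  have e1 : Winv * (W * M - z • (A * W)) * Winv = M * Winv - z • (Winv * A) := by
    rw [mul_sub, sub_mul, ← mul_assoc, h2, one_mul, mul_smul_comm, smul_mul_assoc, mul_assoc Winv,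
      mul_assoc A, h1, mul_one]
  have e2 : Winv * (W * M') = M' := by rw [← mul_assoc, h2, one_mul]
  rw [e1] at h
  convert h using 1
  simp only [neg_mul, mul_add, mul_sub, e2, sub_mul, smul_mul_assoc, mul_smul_comm,
    mul_assoc]
  abel

/-- With `C = hA(1 + Z)` and `M` its even part, `oddPart_sub_one_mul` identifies the equation `[D,
Z] = ((Z - 1)C)_odd` with the intertwining relation `(D + hA) W = W (D + M)` for `W = 1 + Z`.
Inserting the curve `h(σ) a` into the analytic solution map makes all the data smooth in `σ`. -/
theorem exists_adiabaticFrame [CompleteSpace H] :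
    ∃ δ > 0, ∀ a : WeightedHS b (𝓦.G * 𝓦.G), ‖a‖ < δ → ∀ h : ℝ → ℝ, ContDiff ℝ ∞ h →
      (∀ σ, 0 ≤ h σ) → (∀ σ, h σ ≤ 1) → Nonempty (AdiabaticFrame b 𝓦 (op b _ a) h) := by
  obtain ⟨δ₀, hδ₀, z, hz0, hz⟩ := 𝓜.exists_blockDiagonalizer (b := b) (𝓦.G * 𝓦.G)
    (𝓦.G_J.mul_left 𝓦.G_J) (fun r => (𝓦.G_S r).mul_left (𝓦.G_S r)) (η := 1 / 2) (by norm_num)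
  have hc0 : 0 ≤ 𝓜.invCommConst := (norm_nonneg _).trans (le_max_left _ _)
  -- Since `‖Z‖ < 1/2`, one has `‖C‖ ≤ (3/2)‖a‖` and `‖M‖ ≤ 2‖C‖`, hence `2‖M‖ ≤ 6‖a‖`; the second
  -- entry of the minimum provides `M_small`.
  refine ⟨min δ₀ (1 / (6 * (𝓜.invCommConst + 1))), lt_min hδ₀ (by positivity),
    fun a ha h hh h0 h1 => ?_⟩
  set R := mulRight b (𝓦.G * 𝓦.G)
  set o := op b (𝓦.G * 𝓦.G) with ho
  set l := 𝓜.invCommSelf b (𝓦.G * 𝓦.G) (𝓦.G_J.mul_left 𝓦.G_J)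
    (fun r => (𝓦.G_S r).mul_left (𝓦.G_S r))
  let α : ℝ → WeightedHS b (𝓦.G * 𝓦.G) := fun σ => (h σ : ℂ) • a
  have hhc : ContDiff ℝ ∞ fun σ => (h σ : ℂ) := Complex.ofRealCLM.contDiff.comp hh
  have hα : ContDiff ℝ ∞ α := by
    have := contDiff_clm_comp ((ContinuousLinearMap.id ℂ ℂ).smulRight a) hhc
    exact this
  have hαn : ∀ σ, ‖α σ‖ ≤ ‖a‖ := fun σ => by
    rw [norm_smul, Complex.norm_real, Real.norm_of_nonneg (h0 σ)]
    exact mul_le_of_le_one_left (norm_nonneg _) (h1 σ)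
  have hαδ : ∀ σ, ‖α σ‖ < δ₀ := fun σ => (hαn σ).trans_lt (ha.trans_le (min_le_left _ _))
  let ζ : ℝ → WeightedHS b (𝓦.G * 𝓦.G) := fun σ => z (α σ)
  have hζ : ContDiff ℝ ∞ ζ := contDiff_iff_contDiffAt.2 fun σ =>
    (((hz _ (hαδ σ)).1.of_le le_top).restrict_scalars ℝ).comp σ hα.contDiffAt
  let y : ℝ → WeightedHS b (𝓦.G * 𝓦.G) := fun σ =>
    R (ζ σ) (o (α σ)) + R (R (ζ σ) (o (α σ))) (o (ζ σ)) - α σ - R (α σ) (o (ζ σ))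
  have hoα : ContDiff ℝ ∞ fun σ => o (α σ) := contDiff_clm_comp o hα
  have hoζ : ContDiff ℝ ∞ fun σ => o (ζ σ) := contDiff_clm_comp o hζ
  have hy : ContDiff ℝ ∞ y :=
    (((contDiff_mulRight b hζ hoα).add (contDiff_mulRight b (contDiff_mulRight b hζ hoα) hoζ)).sub
      hα).sub (contDiff_mulRight b hα hoζ)
  have hζy : ∀ σ, ζ σ = l (y σ) := fun σ => (hz _ (hαδ σ)).2.2
  let Z : ℝ → Op H := fun σ => o (ζ σ)
  have hZn : ∀ σ, ‖Z σ‖ < 1 / 2 := fun σ => (norm_op_le _).trans_lt (hz _ (hαδ σ)).2.1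
  have hZinv : ∀ σ, Z σ = 𝓜.invComm (o (y σ)) := fun σ => by
    simp only [Z, hζy]
    exact FreeModel.op_invCommSelf _ _ _ _ _
  have hZJ : ∀ σ, Z σ * 𝓜.J = -(𝓜.J * Z σ) := fun σ => by
    rw [hZinv]; exact 𝓜.invComm_mul_J _
  let W : ℝ → Op H := fun σ => 1 + Z σ
  have hW : ContDiff ℝ ∞ W := contDiff_const.add hoζ
  have hneg : ∀ σ, ‖-Z σ‖ < 1 := fun σ => by rw [norm_neg]; linarith [hZn σ]
  let u : ℝ → (Op H)ˣ := fun σ => Units.oneSub (-Z σ) (hneg σ)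
  have hu : ∀ σ, (u σ : Op H) = W σ := fun σ => by rw [Units.val_oneSub, sub_neg_eq_add]
  let Winv : ℝ → Op H := fun σ => Ring.inverse (W σ)
  have hWinv : ContDiff ℝ ∞ Winv := by
    refine contDiff_iff_contDiffAt.2 fun σ => ?_
    have h1 := (contDiffAt_ringInverse ℂ (n := ∞) (u σ)).restrict_scalars ℝ
    rw [hu] at h1
    exact h1.comp σ hW.contDiffAt
  have hWW : ∀ σ, W σ * Winv σ = 1 := fun σ => Ring.mul_inverse_cancel _ (hu σ ▸ (u σ).isUnit)
  have hWW' : ∀ σ, Winv σ * W σ = 1 := fun σ => Ring.inverse_mul_cancel _ (hu σ ▸ (u σ).isUnit)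
  let C : ℝ → Op H := fun σ => (h σ : ℂ) • (o a * W σ)
  have hC : ContDiff ℝ ∞ C := by
    have h2 : ContDiff ℝ ∞ fun σ => o (α σ) * W σ := hoα.mul hW
    have e : C = fun σ => o (α σ) * W σ := funext fun σ => by
      simp only [C, α, map_smul, smul_mul_assoc]
    rw [e]
    exact h2
  let M : ℝ → Op H := fun σ => C σ - oddPart 𝓜.J (C σ)
  have hM : ContDiff ℝ ∞ M := hC.sub (contDiff_clm_comp (oddPart 𝓜.J) hC)
  have hyC : ∀ σ, o (y σ) = (Z σ - 1) * C σ := fun σ => by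
    have e : C σ = o (α σ) * (1 + Z σ) := by simp only [C, W, α, map_smul, smul_mul_assoc]
    rw [e]
    simp only [y, Z, R, ho, map_add, map_sub, op_mulRight]
    noncomm_ring
  have hodd : ∀ σ, oddPart 𝓜.J (o (y σ)) = W σ * M σ - (h σ : ℂ) • (o a * W σ) := fun σ => by
    rw [hyC, 𝓜.oddPart_sub_one_mul (hZJ σ)]
  have hcW : ∀ σ, 𝓜.IsCommutator (W σ) (W σ * M σ - (h σ : ℂ) • (o a * W σ)) := fun σ => by
    have h1 := (FreeModel.IsCommutator.of_commute (𝓜 := 𝓜) (X := 1)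
      fun t => Commute.one_right _).add (𝓜.isCommutator_invComm (o (y σ)))
    rw [hodd, zero_add, ← hZinv] at h1
    exact h1
  -- the derivative
  have hdW : ∀ σ, deriv W σ = 𝓜.invComm (o (deriv y σ)) := fun σ => by
    have h1 := hasDerivAt_clm_comp (𝓜.invComm.comp o) (ContDiff.hasDerivAt_deriv hy σ)
    have h2 : W = fun σ => 1 + (𝓜.invComm.comp o) (y σ) := funext fun σ => by
      simp only [W, hZinv]; rfl
    rw [h2, (h1.const_add (1 : Op H)).deriv]; rfl
  have hdodd : ∀ σ, oddPart 𝓜.J (o (deriv y σ)) = deriv W σ * M σ + W σ * deriv M σ -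
      (((deriv h σ : ℝ) : ℂ) • (o a * W σ) + (h σ : ℂ) • (o a * deriv W σ)) := fun σ => by
    have h1 := hasDerivAt_clm_comp ((oddPart 𝓜.J).comp o) (ContDiff.hasDerivAt_deriv hy σ)
    have h3 : HasDerivAt (fun σ => (h σ : ℂ) • (o a * W σ))
        (((deriv h σ : ℝ) : ℂ) • (o a * W σ) + (h σ : ℂ) • (o a * deriv W σ)) σ := by
      have h4 := ((hh.differentiable (by simp)) σ).hasDerivAt.ofReal_comp.smul
        ((ContDiff.hasDerivAt_deriv hW σ).const_mul (o a))
      rw [add_comm] at h4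
      exact h4
    have h2 := ((ContDiff.hasDerivAt_deriv hW σ).mul (ContDiff.hasDerivAt_deriv hM σ)).sub h3
    refine h1.unique (h2.congr_of_eventuallyEq (Eventually.of_forall fun σ => ?_))
    exact hodd σ
  -- The same operator `Z`, now placed in the better class: `y` carries the weight `G²` and one
  -- inversion improves it to `G`.
  let ζ₁ : ℝ → WeightedHS b 𝓦.G := fun σ => FreeModel.invCommTwo b 𝓦 (y σ)
  have hζ₁ : ContDiff ℝ ∞ ζ₁ := contDiff_clm_comp _ hy
  have hopζ₁ : ∀ σ, op b 𝓦.G (ζ₁ σ) = Z σ := fun σ => by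
    rw [FreeModel.op_invCommTwo]; exact (hZinv σ).symm
  have hdζ₁ : ∀ σ, op b 𝓦.G (deriv ζ₁ σ) = deriv W σ := fun σ => by
    rw [(hasDerivAt_clm_comp (FreeModel.invCommTwo b 𝓦) (ContDiff.hasDerivAt_deriv hy σ)).deriv,
      FreeModel.op_invCommTwo, hdW]
  -- The chain rule for the solution map gives this in the class of weight `G²`; injectivity of `op`
  -- transfers it to weight `G`.
  have hζ0 : ∀ σ, deriv h σ = 0 → deriv ζ₁ σ = 0 := fun σ hσ => by
    have hdα : HasDerivAt α 0 σ := by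
      have h4 := ((hh.differentiable (by simp)) σ).hasDerivAt.ofReal_comp.smul_const a
      rw [hσ, Complex.ofReal_zero, zero_smul] at h4
      exact h4
    have hdζ : HasDerivAt ζ 0 σ := by
      have h5 := (((hz _ (hαδ σ)).1.differentiableAt (by simp)).hasFDerivAt.restrictScalars
        ℝ).comp_hasDerivAt σ hdα
      rw [map_zero] at h5
      exact h5
    refine op_injective ?_
    rw [hdζ₁, map_zero]
    exact ((hasDerivAt_clm_comp o hdζ).const_add (1 : Op H)).deriv.trans (map_zero o)
  have hdW' : ContDiff ℝ ∞ (deriv W) := ContDiff.deriv_infty hW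
  refine ⟨{
    W := W
    Winv := Winv
    M := M
    -- Left multiplication by `W⁻¹` does not preserve the class. From `W⁻¹ = 1 - Z W⁻¹` one gets
    -- `W⁻¹W' = W' - Z (W⁻¹W')`, where `W'` and `Z` stand on the left and carry the weight.
    κ := fun σ => deriv ζ₁ σ - mulRight b 𝓦.G (ζ₁ σ) (Winv σ * deriv W σ)
    W_contDiff := hW
    Winv_contDiff := hWinv
    M_contDiff := hM
    κ_contDiff := (ContDiff.deriv_infty hζ₁).sub (contDiff_mulRight b hζ₁ (hWinv.mul hdW'))
    W_mul_Winv := hWW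
    Winv_mul_W := hWW'
    M_J := fun σ => 𝓜.commute_sub_oddPart (C σ)
    M_small := fun σ => ?_
    op_κ := fun σ => ?_
    commutator_W := hcW
    commutator_κ := fun σ => ?_
    W_eq_one := fun σ hσ => by simp [W, Z, ζ, α, hσ, hz0]
    κ_eq_zero := fun σ hσ => ?_ }⟩
  · have e1 : ‖C σ‖ ≤ ‖a‖ * (3 / 2) := by
      have e2 : C σ = o (α σ) * W σ := by simp only [C, α, map_smul, smul_mul_assoc]
      rw [e2]
      refine (norm_mul_le _ _).trans (mul_le_mul ((norm_op_le _).trans (hαn σ)) ?_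
        (norm_nonneg _) (norm_nonneg _))
      have : ‖(1 : Op H)‖ ≤ 1 := ContinuousLinearMap.norm_id_le
      exact (norm_add_le _ _).trans (by linarith [hZn σ])
    have e3 : ‖M σ‖ ≤ 2 * ‖C σ‖ :=
      (norm_sub_le _ _).trans (by linarith [𝓜.oddPart_norm_le (C σ)])
    have e4 : ‖a‖ < 1 / (6 * (𝓜.invCommConst + 1)) := ha.trans_le (min_le_right _ _)
    rw [lt_div_iff₀ (by positivity)] at e4
    calc 𝓜.invCommConst * (2 * ‖M σ‖) ≤ 𝓜.invCommConst * (6 * ‖a‖) := 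
          mul_le_mul_of_nonneg_left (by linarith) hc0
      _ < 1 := by nlinarith [norm_nonneg a]
  · rw [map_sub, op_mulRight, hdζ₁, hopζ₁]
    have e : Winv σ = 1 - Z σ * Winv σ := by
      have := hWW σ
      simp only [W, add_mul, one_mul] at this
      exact eq_sub_of_add_eq this
    conv_rhs => rw [e]
    rw [sub_mul, one_mul, mul_assoc]
  · have e : op b 𝓦.G (deriv ζ₁ σ - mulRight b 𝓦.G (ζ₁ σ) (Winv σ * deriv W σ)) =
        Winv σ * deriv W σ := by
      rw [map_sub, op_mulRight, hdζ₁, hopζ₁]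
      have e : Winv σ = 1 - Z σ * Winv σ := by
        have := hWW σ
        simp only [W, add_mul, one_mul] at this
        exact eq_sub_of_add_eq this
      conv_rhs => rw [e]
      rw [sub_mul, one_mul, mul_assoc]
    rw [e]
    refine isCommutator_frameGenerator (hWW σ) (hWW' σ) (hcW σ) ?_
    rw [← hdodd, hdW]
    exact 𝓜.isCommutator_invComm _
  · have e : deriv W σ = 0 := by rw [← hdζ₁, hζ0 σ hσ, map_zero]
    rw [hζ0 σ hσ, e, mul_zero, map_zero, sub_zero]

end Construction

end DiracSwitching

end

/-! ### Heisenberg evolution in the frame -/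

noncomputable section

namespace DiracSwitching

open WeightedHS

/-- The interaction picture propagator of the perturbation `h(t/T) A`, started at time `-T`. -/
structure Propagator {H : Type*} [NormedAddCommGroup H] [InnerProductSpace ℂ H] (𝓜 : FreeModel H)
    (A : Op H) (h : ℝ → ℝ) (T : ℝ) where
  V : ℝ → Op H
  Vinv : ℝ → Op H
  V_mul_Vinv : ∀ s, V s * Vinv s = 1
  Vinv_mul_V : ∀ s, Vinv s * V s = 1
  V_norm : ∀ s, ‖V s‖ ≤ 1
  Vinv_norm : ∀ s, ‖Vinv s‖ ≤ 1
  V_deriv : ∀ s, StrongDerivAt V (Complex.I • (V s * (h (s / T) : ℂ) • 𝓜.conj s A)) s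
  Vinv_deriv : ∀ s,
    StrongDerivAt Vinv (-(Complex.I • ((h (s / T) : ℂ) • 𝓜.conj s A * Vinv s))) s
  V_init : V (-T) = 1

section

variable {H : Type*} [NormedAddCommGroup H] [InnerProductSpace ℂ H]

/-- The difference quotient splits into that of the conjugation with `X s` frozen, where the
commutator enters, and the conjugated difference quotient of `X`, which converges in norm. -/
theorem FreeModel.conj_strongDerivAt {𝓜 : FreeModel H} {X : ℝ → Op H} {X' C : Op H} {s : ℝ}
    (hX : HasDerivAt X X' s) (hC : 𝓜.IsCommutator (X s) C) :
    StrongDerivAt (fun r => 𝓜.conj r (X r)) (𝓜.conj s (Complex.I • C + X')) s := by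
  have hb : BddAlong (𝓝 s) X := .of_tendsto hX.continuousAt
  refine ⟨((BddAlong.of_le 𝓜.E_norm).mul hb).mul (.of_le fun t => 𝓜.E_norm (-t)), fun f => ?_⟩
  rw [hasDerivAt_iff_tendsto_slope]
  have h1 := hasDerivAt_iff_tendsto_slope.1 ((hC s).deriv f)
  have h2 : Tendsto (fun r => 𝓜.E (-r) f) (𝓝[≠] s) (𝓝 (𝓜.E (-s) f)) :=
    ((𝓜.E_neg_strongCont.cont f).tendsto s).mono_left nhdsWithin_le_nhds
  have h3 := hasDerivAt_iff_tendsto_slope.1 hX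
  have h4 : Tendsto (fun r => slope X s r (𝓜.E (-r) f)) (𝓝[≠] s) (𝓝 (X' (𝓜.E (-s) f))) :=
    (BddAlong.of_tendsto h3).tendsto_apply
      (((ContinuousLinearMap.apply ℂ H (𝓜.E (-s) f)).continuous.tendsto _).comp h3) h2
  have h5 : Tendsto (fun r => 𝓜.E r (slope X s r (𝓜.E (-r) f))) (𝓝[≠] s)
      (𝓝 (𝓜.E s (X' (𝓜.E (-s) f)))) :=
    (BddAlong.of_le 𝓜.E_norm).tendsto_apply
      (((𝓜.E_cont _).tendsto s).mono_left nhdsWithin_le_nhds) h4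
  have h6 := h1.add h5
  have e : 𝓜.conj s (Complex.I • C + X') f =
      (Complex.I • 𝓜.conj s C) f + 𝓜.E s (X' (𝓜.E (-s) f)) := by simp [conj]
  rw [e]
  refine h6.congr fun r => ?_
  simp only [slope_def_module, FreeModel.conj, mul_apply_eq_comp, _root_.smul_apply,
    _root_.sub_apply]
  rw [(𝓜.E r).map_smul_of_tower, map_sub, ← smul_add]
  congr 1
  abel

end

section FrameConj

variable {H : Type*} [NormedAddCommGroup H] [InnerProductSpace ℂ H] [CompleteSpace H]
variable {ι : Type*} {b : HilbertBasis ι ℂ H} {𝓜 : FreeModel H} {𝓦 : Weight 𝓜}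
variable {A : Op H} {h : ℝ → ℝ} (𝓖 : AdiabaticFrame b 𝓦 A h) {T : ℝ}

namespace AdiabaticFrame

/-- The Heisenberg evolution of an operator given in the frame. -/
def evol (𝓥 : Propagator 𝓜 A h T) (s : ℝ) (X : Op H) : Op H :=
  𝓥.V s * 𝓜.conj s (𝓖.W (s / T) * X * 𝓖.Winv (s / T)) * 𝓥.Vinv s

variable (𝓥 : Propagator 𝓜 A h T)

theorem evol_mul (s : ℝ) (X Y : Op H) :
    𝓖.evol 𝓥 s (X * Y) = 𝓖.evol 𝓥 s X * 𝓖.evol 𝓥 s Y := by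
  have e : 𝓖.W (s / T) * (X * Y) * 𝓖.Winv (s / T) =
      (𝓖.W (s / T) * X * 𝓖.Winv (s / T)) * (𝓖.W (s / T) * Y * 𝓖.Winv (s / T)) := by
    simp only [mul_assoc]
    rw [← mul_assoc (𝓖.Winv _) (𝓖.W _), 𝓖.Winv_mul_W, one_mul]
  rw [evol, e, 𝓜.conj_mul, evol, evol]
  simp only [mul_assoc]
  rw [← mul_assoc (𝓥.Vinv s) (𝓥.V s), 𝓥.Vinv_mul_V, one_mul]

theorem evol_add (s : ℝ) (X Y : Op H) :
    𝓖.evol 𝓥 s (X + Y) = 𝓖.evol 𝓥 s X + 𝓖.evol 𝓥 s Y := by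
  simp only [evol, FreeModel.conj, mul_add, add_mul]

theorem evol_sub (s : ℝ) (X Y : Op H) :
    𝓖.evol 𝓥 s (X - Y) = 𝓖.evol 𝓥 s X - 𝓖.evol 𝓥 s Y := by
  simp only [evol, FreeModel.conj, mul_sub, sub_mul]

theorem evol_smul (s : ℝ) (z : ℂ) (X : Op H) :
    𝓖.evol 𝓥 s (z • X) = z • 𝓖.evol 𝓥 s X := by
  simp only [evol, FreeModel.conj, mul_smul_comm, smul_mul_assoc]

theorem evol_zero (s : ℝ) : 𝓖.evol 𝓥 s 0 = 0 := by simp [evol, FreeModel.conj]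

theorem evol_strongCont {y : ℝ → Op H} (hy : Continuous y) :
    StrongCont fun s => 𝓖.evol 𝓥 s (y (s / T)) := by
  have hd : Continuous fun s : ℝ => s / T := continuous_id.div_const T
  have hX : Continuous fun s => 𝓖.W (s / T) * y (s / T) * 𝓖.Winv (s / T) :=
    (((𝓖.W_contDiff.continuous.comp hd).mul (hy.comp hd)).mul
      (𝓖.Winv_contDiff.continuous.comp hd))
  exact ((StrongDerivAt.strongCont 𝓥.V_deriv).mul
    (𝓜.conj_strongCont (.of_continuous hX))).mul (StrongDerivAt.strongCont 𝓥.Vinv_deriv)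

/-- The covariant derivative in the frame. -/
def covDeriv (y : ℝ → Op H) (σ : ℝ) : Op H :=
  op b 𝓦.G (𝓖.κ σ) * y σ - y σ * op b 𝓦.G (𝓖.κ σ) + deriv y σ

/-- Differentiating the propagators and the free group produces `i[D + hA, W y W⁻¹]`, which the
intertwining relation turns into `i W [D + M, y] W⁻¹`. The slow dependence of `W`, `y` and `W⁻¹` on
`s/T` produces the covariant derivative with a factor `T⁻¹`. -/
theorem evol_deriv {y c : ℝ → Op H} (hy : ContDiff ℝ ∞ y)
    (hc : ∀ σ, 𝓜.IsCommutator (y σ) (c σ)) (s : ℝ) :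
    StrongDerivAt (fun s => 𝓖.evol 𝓥 s (y (s / T)))
      (𝓖.evol 𝓥 s (Complex.I • (c (s / T) + (𝓖.M (s / T) * y (s / T) - y (s / T) * 𝓖.M (s / T))) +
        (T⁻¹ : ℂ) • 𝓖.covDeriv y (s / T))) s := by
  set σ := s / T with hσ
  have h1 := 𝓖.W_mul_Winv σ
  have h2 := 𝓖.Winv_mul_W σ
  have dW := ContDiff.hasDerivAt_deriv 𝓖.W_contDiff σ
  have dWinv : HasDerivAt 𝓖.Winv (-(𝓖.Winv σ * deriv 𝓖.W σ * 𝓖.Winv σ)) σ := by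
    have d0 := ContDiff.hasDerivAt_deriv 𝓖.Winv_contDiff σ
    have d1 := dW.mul d0
    have d2 : HasDerivAt (𝓖.W * 𝓖.Winv) 0 σ := by
      have e : 𝓖.W * 𝓖.Winv = fun _ => 1 := funext 𝓖.W_mul_Winv
      rw [e]; exact hasDerivAt_const _ _
    have d3 := d1.unique d2
    have d4 : deriv 𝓖.Winv σ = -(𝓖.Winv σ * deriv 𝓖.W σ * 𝓖.Winv σ) := by
      have := congrArg (fun X => 𝓖.Winv σ * X) (eq_neg_of_add_eq_zero_right d3)
      simpa only [← mul_assoc, h2, one_mul, mul_neg] using this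
    rwa [d4] at d0
  have dX := (dW.mul (ContDiff.hasDerivAt_deriv hy σ)).mul dWinv
  have ds : HasDerivAt (fun s : ℝ => s / T) T⁻¹ s := by
    simpa [div_eq_mul_inv] using (hasDerivAt_id s).div_const T
  have dXs := dX.scomp_of_eq s ds hσ.symm
  have hcX := ((𝓖.commutator_W σ).mul (hc σ)).mul ((𝓖.commutator_W σ).inv h1 h2)
  have d := ((𝓥.V_deriv s).mul (FreeModel.conj_strongDerivAt dXs hcX)).mul (𝓥.Vinv_deriv s)
  refine d.congr_deriv ?_
  have h1' : ∀ Z, 𝓖.W σ * (𝓖.Winv σ * Z) = Z := fun Z => by rw [← mul_assoc, h1, one_mul]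
  have h2' : ∀ Z, 𝓖.Winv σ * (𝓖.W σ * Z) = Z := fun Z => by rw [← mul_assoc, h2, one_mul]
  have hκ : deriv 𝓖.W σ = 𝓖.W σ * op b 𝓦.G (𝓖.κ σ) := by rw [𝓖.op_κ, h1']
  -- The derivatives of `V` and `V⁻¹` are gathered inside the conjugation as `i h [A, X]`, where
  -- they can cancel the terms with `A` coming from `commutator_W`.
  have push : ∀ X Z : Op H, (Complex.I • (𝓥.V s * (h σ : ℂ) • 𝓜.conj s A) * 𝓜.conj s X +
        𝓥.V s * 𝓜.conj s Z) * 𝓥.Vinv s +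
      𝓥.V s * 𝓜.conj s X * -(Complex.I • ((h σ : ℂ) • 𝓜.conj s A * 𝓥.Vinv s)) =
      𝓥.V s * 𝓜.conj s ((Complex.I * h σ) • (A * X) + Z - (Complex.I * h σ) • (X * A)) *
        𝓥.Vinv s := by
    intro X Z
    have e : 𝓜.conj s ((Complex.I * h σ) • (A * X) + Z - (Complex.I * h σ) • (X * A)) =
        (Complex.I * h σ) • (𝓜.conj s A * 𝓜.conj s X) + 𝓜.conj s Z -
          (Complex.I * h σ) • (𝓜.conj s X * 𝓜.conj s A) := by
      rw [← 𝓜.conj_mul, ← 𝓜.conj_mul]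
      simp only [FreeModel.conj, mul_add, add_mul, mul_sub, sub_mul, mul_smul_comm,
        smul_mul_assoc]
    rw [e]
    simp only [mul_add, add_mul, mul_sub, sub_mul, mul_smul_comm, smul_mul_assoc, mul_neg,
      mul_assoc, mul_smul]
    abel
  rw [push, evol]
  congr 2
  have hT : ∀ Z : Op H, (T⁻¹ : ℝ) • Z = (T⁻¹ : ℂ) • Z := fun Z => by
    rw [← Complex.ofReal_inv]; rfl
  simp only [Function.comp_apply, Pi.mul_apply, ← hσ, hκ, covDeriv, hT]
  congr 1
  simp only [mul_add, add_mul, mul_sub, sub_mul, mul_smul_comm, smul_mul_assoc, mul_neg,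
    mul_assoc, h1, h2', mul_one, smul_add, smul_sub, smul_neg, mul_smul]
  abel

end AdiabaticFrame

end FrameConj

end DiracSwitching

end

/-! ### Strong primitives and bounds uniform in the switching time -/

noncomputable section

namespace DiracSwitching

open WeightedHS

section Switching

variable {H : Type*} [NormedAddCommGroup H] [InnerProductSpace ℂ H]

/-- A switching time together with the propagator of the switched perturbation. -/
structure Switching (𝓜 : FreeModel H) (A : Op H) (h : ℝ → ℝ) where
  T : ℝ
  T_pos : 0 < T
  prop : Propagator 𝓜 A h T

variable {ι : Type*} {b : HilbertBasis ι ℂ H} {𝓜 : FreeModel H} {A : Op H} {h : ℝ → ℝ}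

variable (b) in
/-- Hilbert-Schmidt bounds that are uniform in the switching time. -/
def UnifHS (F : Switching 𝓜 A h → ℝ → Op H) : Prop :=
  ∃ c, ∀ x, ∀ s ∈ Set.Icc (-x.T) 0, HSLe b (F x s) c

/-- Norm bounds that are uniform in the switching time. -/
def UnifBdd (F : Switching 𝓜 A h → ℝ → Op H) : Prop :=
  ∃ c, 0 ≤ c ∧ ∀ x, ∀ s ∈ Set.Icc (-x.T) 0, ‖F x s‖ ≤ c

/-- `F` is the strong primitive of `F'` that vanishes at the beginning of the switching. -/
structure IsPrim (F' F : Switching 𝓜 A h → ℝ → Op H) : Prop where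
  cont : ∀ x, StrongCont (F' x)
  apply_eq : ∀ x s f, F x s f = ∫ r in (-x.T)..s, F' x r f

variable {F F' K K' : Switching 𝓜 A h → ℝ → Op H}

theorem UnifHS.add (hF : UnifHS b F) (hK : UnifHS b K) : UnifHS b fun x s => F x s + K x s := by
  obtain ⟨c, hc⟩ := hF
  obtain ⟨d, hd⟩ := hK
  exact ⟨c + d, fun x s hs => (hc x s hs).add (hd x s hs)⟩

theorem UnifHS.neg (hF : UnifHS b F) : UnifHS b fun x s => -F x s := by
  obtain ⟨c, hc⟩ := hF
  exact ⟨c, fun x s hs => (hc x s hs).neg⟩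

theorem UnifHS.sub (hF : UnifHS b F) (hK : UnifHS b K) : UnifHS b fun x s => F x s - K x s := by
  simpa only [sub_eq_add_neg] using hF.add hK.neg

theorem UnifHS.smul (hF : UnifHS b F) (z : ℂ) : UnifHS b fun x s => z • F x s := by
  obtain ⟨c, hc⟩ := hF
  exact ⟨_, fun x s hs => (hc x s hs).smul z⟩

theorem UnifHS.mul_left (hF : UnifHS b F) (hK : UnifBdd K) :
    UnifHS b fun x s => K x s * F x s := by
  obtain ⟨c, hc⟩ := hF
  obtain ⟨d, hd0, hd⟩ := hK
  exact ⟨d * c, fun x s hs => ((hc x s hs).mul_left _).mono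
    (mul_le_mul_of_nonneg_right (hd x s hs) (hc x s hs).nonneg)⟩

theorem UnifHS.mul_right [CompleteSpace H] (hF : UnifHS b F) (hK : UnifBdd K) :
    UnifHS b fun x s => F x s * K x s := by
  obtain ⟨c, hc⟩ := hF
  obtain ⟨d, hd0, hd⟩ := hK
  exact ⟨c * d, fun x s hs => ((hc x s hs).mul_right _).mono
    (mul_le_mul_of_nonneg_left (hd x s hs) (hc x s hs).nonneg)⟩

theorem UnifBdd.const (X : Op H) : UnifBdd fun (_ : Switching 𝓜 A h) _ => X :=
  ⟨‖X‖, norm_nonneg _, fun _ _ _ => le_rfl⟩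

theorem UnifBdd.mul (hF : UnifBdd F) (hK : UnifBdd K) : UnifBdd fun x s => F x s * K x s := by
  obtain ⟨c, hc0, hc⟩ := hF
  obtain ⟨d, hd0, hd⟩ := hK
  exact ⟨c * d, mul_nonneg hc0 hd0, fun x s hs => (norm_mul_le _ _).trans
    (mul_le_mul (hc x s hs) (hd x s hs) (norm_nonneg _) hc0)⟩

theorem Switching.sub_le (x : Switching 𝓜 A h) {s : ℝ} (hs : s ∈ Set.Icc (-x.T) 0) :
    ‖((x.T : ℂ))⁻¹‖ * (s - -x.T) ≤ 1 := by
  rw [norm_inv, Complex.norm_real, Real.norm_of_nonneg x.T_pos.le, inv_mul_le_one₀ x.T_pos]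
  linarith [hs.2]

/-- The integration runs over an interval of length at most `T`, which the factor `T⁻¹` compensates.
-/
theorem UnifHS.prim [CompleteSpace H] (hF' : UnifHS b F') (hp : IsPrim F' F) :
    UnifHS b fun x s => (x.T : ℂ)⁻¹ • F x s := by
  obtain ⟨c, hc⟩ := hF'
  refine ⟨c, fun x s hs => ?_⟩
  have hc0 : 0 ≤ c := (hc x s hs).nonneg
  refine ((HSLe.intervalIntegral_apply (hp.cont x) hs.1 (hp.apply_eq x s) fun r hr =>
    hc x r ⟨hr.1, hr.2.trans hs.2⟩).smul _).mono ?_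
  rw [mul_left_comm]
  exact mul_le_of_le_one_right hc0 (x.sub_le hs)

theorem UnifBdd.prim [CompleteSpace H] (hF' : UnifBdd F') (hp : IsPrim F' F) :
    UnifBdd fun x s => (x.T : ℂ)⁻¹ • F x s := by
  obtain ⟨c, hc0, hc⟩ := hF'
  refine ⟨c, hc0, fun x s hs => ?_⟩
  rw [norm_smul]
  refine (mul_le_mul_of_nonneg_left (norm_le_of_apply_eq_integral hs.1 hc0 (hp.apply_eq x s)
    fun r hr => hc x r ⟨hr.1, hr.2.trans hs.2⟩) (norm_nonneg _)).trans ?_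
  rw [mul_left_comm]
  exact mul_le_of_le_one_right hc0 (x.sub_le hs)

theorem IsPrim.exists [CompleteSpace H] (hF' : ∀ x, StrongCont (F' x)) : ∃ F, IsPrim F' F :=
  ⟨fun x s => sInt (F' x) (hF' x) (-x.T) s, hF', fun _ _ _ => rfl⟩

/-- Identities between primitives thereby reduce to pointwise identities between integrands. -/
theorem IsPrim.unique (hF : IsPrim F' F) (hK : IsPrim F' K) : F = K := by
  funext x s
  ext1 f
  rw [hF.apply_eq, hK.apply_eq]

theorem IsPrim.add [CompleteSpace H] (hF : IsPrim F' F) (hK : IsPrim K' K) :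
    IsPrim (fun x s => F' x s + K' x s) fun x s => F x s + K x s :=
  ⟨fun x => (hF.cont x).add (hK.cont x), fun x s f => by
    simp only [_root_.add_apply, hF.apply_eq, hK.apply_eq]
    exact (intervalIntegral.integral_add (((hF.cont x).cont f).intervalIntegrable _ _)
      (((hK.cont x).cont f).intervalIntegrable _ _)).symm⟩

theorem IsPrim.smul (hF : IsPrim F' F) (z : Switching 𝓜 A h → ℂ) :
    IsPrim (fun x s => z x • F' x s) fun x s => z x • F x s :=
  ⟨fun x => (hF.cont x).const_smul (z x), fun x s f => by
    simp only [_root_.smul_apply, hF.apply_eq]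
    exact (intervalIntegral.integral_smul _ _).symm⟩

theorem IsPrim.mul_mul [CompleteSpace H] (hF : IsPrim F' F) (X Y : Op H) :
    IsPrim (fun x s => X * F' x s * Y) fun x s => X * F x s * Y :=
  ⟨fun x => ((StrongCont.const X).mul (hF.cont x)).mul (.const Y), fun x s f => by
    simp only [mul_apply_eq_comp, hF.apply_eq]
    exact (X.intervalIntegral_comp_comm (((hF.cont x).cont _).intervalIntegrable _ _)).symm⟩

theorem IsPrim.of_deriv [CompleteSpace H] (hF : ∀ x s, StrongDerivAt (F x) (F' x s) s)
    (hF' : ∀ x, StrongCont (F' x)) : IsPrim F' fun x s => F x s - F x (-x.T) :=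
  ⟨hF', fun x _ f => ((StrongCont.integral_eq_sub (hF x) (hF' x) _ _ f)).symm⟩

end Switching

end DiracSwitching

end

/-! ### Integration by parts in the frame and expansion of the evolved projection -/

noncomputable section

namespace DiracSwitching

open WeightedHS

namespace FreeModel

variable {H : Type*} [NormedAddCommGroup H] [InnerProductSpace ℂ H] (𝓜 : FreeModel H)

/-- The projection onto the positive spectral subspace. -/
def P : Op H := (2⁻¹ : ℂ) • (1 + 𝓜.J)

theorem P_mul_P : 𝓜.P * 𝓜.P = 𝓜.P := by
  simp only [P, smul_mul_assoc, mul_smul_comm, mul_add, add_mul, mul_one, one_mul, 𝓜.J_sq]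
  module

theorem P_mul_one_sub_P : 𝓜.P * (1 - 𝓜.P) = 0 := by rw [mul_sub, P_mul_P, mul_one, sub_self]

theorem conj_P (t : ℝ) : 𝓜.conj t 𝓜.P = 𝓜.P := by
  have e : 𝓜.E t * 𝓜.P = 𝓜.P * 𝓜.E t := by
    simp only [P, smul_mul_assoc, mul_smul_comm, mul_add, add_mul, mul_one, one_mul,
      (𝓜.E_J t).eq]
  rw [conj, e, mul_assoc, E_mul_neg, mul_one]

theorem commute_P {X : Op H} (hX : Commute X 𝓜.J) : Commute X 𝓜.P := by
  rw [P]
  exact ((Commute.one_right X).add_right hX).smul_right _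

/-- Even operators commute with `P`, so the motion of the evolved projection involves only the odd
part of `κ`, which the commutator equation can absorb. -/
theorem sub_P (X : Op H) : X * 𝓜.P - 𝓜.P * X = oddPart 𝓜.J X * 𝓜.J := by
  simp only [P, oddPart_apply, smul_mul_assoc, mul_smul_comm, mul_add, add_mul, mul_one, one_mul,
    sub_mul, mul_assoc, 𝓜.J_sq]
  module

end FreeModel

namespace AdiabaticFrame

variable {H : Type*} [NormedAddCommGroup H] [InnerProductSpace ℂ H] [CompleteSpace H]
variable {ι : Type*} {b : HilbertBasis ι ℂ H} {𝓜 : FreeModel H} {𝓦 : Weight 𝓜}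
variable {A : Op H} {h : ℝ → ℝ} (𝓖 : AdiabaticFrame b 𝓦 A h)

/-- The evolution of an operator in the frame, as a function of the switching and of time. -/
def tr (y : ℝ → Op H) (x : Switching 𝓜 A h) (s : ℝ) : Op H := 𝓖.evol x.prop s (y (s / x.T))

theorem tr_strongCont {y : ℝ → Op H} (hy : Continuous y) (x : Switching 𝓜 A h) :
    StrongCont (𝓖.tr y x) := 𝓖.evol_strongCont x.prop hy

omit [CompleteSpace H] in
theorem div_mem (x : Switching 𝓜 A h) {s : ℝ} (hs : s ∈ Set.Icc (-x.T) 0) :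
    s / x.T ∈ Set.Icc (-1 : ℝ) 0 :=
  ⟨(le_div_iff₀ x.T_pos).2 (by linarith [hs.1]), div_nonpos_of_nonpos_of_nonneg hs.2 x.T_pos.le⟩

theorem exists_bound {E : Type*} [NormedAddCommGroup E] {y : ℝ → E} (hy : Continuous y) :
    ∃ c, 0 ≤ c ∧ ∀ σ ∈ Set.Icc (-1 : ℝ) 0, ‖y σ‖ ≤ c := by
  obtain ⟨c, hc⟩ := isCompact_Icc.exists_bound_of_continuousOn (s := Set.Icc (-1 : ℝ) 0)
    hy.continuousOn
  exact ⟨c, (norm_nonneg _).trans (hc 0 ⟨by norm_num, le_rfl⟩), hc⟩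

theorem tr_unifBdd {y : ℝ → Op H} (hy : Continuous y) : UnifBdd (𝓖.tr y) := by
  obtain ⟨c, hc0, hc⟩ := exists_bound
    ((𝓖.W_contDiff.continuous.mul hy).mul 𝓖.Winv_contDiff.continuous)
  refine ⟨c, hc0, fun x s hs => ?_⟩
  have h1 := (𝓜.conj_norm_le s _).trans (hc _ (div_mem x hs))
  calc _ ≤ ‖x.prop.V s‖ * c * ‖x.prop.Vinv s‖ :=
        (norm_mul_le _ _).trans (mul_le_mul_of_nonneg_right ((norm_mul_le _ _).trans
          (mul_le_mul_of_nonneg_left h1 (norm_nonneg _))) (norm_nonneg _))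
    _ ≤ 1 * c * 1 := by gcongr; exacts [x.prop.V_norm s, x.prop.Vinv_norm s]
    _ = c := by ring

theorem tr_unifHS {ξ : ℝ → WeightedHS b (1 : Op H)} (hξ : Continuous ξ) :
    UnifHS b (𝓖.tr fun σ => op b 1 (ξ σ)) := by
  have hW := 𝓖.W_contDiff.continuous
  have hWinv := 𝓖.Winv_contDiff.continuous
  obtain ⟨c, hc0, hc⟩ := exists_bound
    ((((mulRight b (1 : Op H)).continuous.comp
      (((mulLeft b).continuous.comp hW).clm_apply hξ)).clm_apply hWinv))
  refine ⟨c, fun x s hs => ?_⟩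
  have h0 : HSLe b (𝓖.W (s / x.T) * op b 1 (ξ (s / x.T)) * 𝓖.Winv (s / x.T)) c := by
    refine HSLe.mono ?_ (hc _ (div_mem x hs))
    simpa using hsLe (mulRight b (1 : Op H) (mulLeft b (𝓖.W (s / x.T)) (ξ (s / x.T)))
      (𝓖.Winv (s / x.T)))
  have h1 := ((((h0.mul_left (𝓜.E s)).mul_right (𝓜.E (-s))).mul_left (x.prop.V s)).mul_right
    (x.prop.Vinv s))
  refine h1.mono ?_
  have e : ∀ a b d e : ℝ, 0 ≤ a → a ≤ 1 → 0 ≤ b → b ≤ 1 → 0 ≤ d → d ≤ 1 → 0 ≤ e → e ≤ 1 →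
      a * (b * c * d) * e ≤ c := by
    intro a b d e ha ha' hb hb' hd hd' he he'
    calc _ ≤ 1 * (1 * c * 1) * 1 := by gcongr
      _ = c := by ring
  exact e _ _ _ _ (norm_nonneg _) (x.prop.V_norm s) (norm_nonneg _) (𝓜.E_norm s) (norm_nonneg _)
    (𝓜.E_norm _) (norm_nonneg _) (x.prop.Vinv_norm s)

theorem tr_add {y z : ℝ → Op H} : 𝓖.tr (y + z) = fun x s => 𝓖.tr y x s + 𝓖.tr z x s := by
  funext x s; exact 𝓖.evol_add _ _ _ _

theorem tr_init (h0 : h (-1) = 0) (y : ℝ → Op H) (x : Switching 𝓜 A h) :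
    𝓖.tr y x (-x.T) = 𝓜.conj (-x.T) (y (-1)) := by
  have e : -x.T / x.T = -1 := by rw [neg_div, div_self x.T_pos.ne']
  have hW := 𝓖.W_eq_one _ h0
  have hWinv : 𝓖.Winv (-1) = 1 := by simpa [hW] using 𝓖.W_mul_Winv (-1)
  have hV : x.prop.Vinv (-x.T) = 1 := by simpa [x.prop.V_init] using x.prop.V_mul_Vinv (-x.T)
  rw [tr, evol, e, hW, hWinv, x.prop.V_init, hV, one_mul, one_mul, mul_one, mul_one]

theorem covDeriv_continuous {y : ℝ → Op H} (hy : ContDiff ℝ ∞ y) : Continuous (𝓖.covDeriv y) := by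
  have h1 := (op b 𝓦.G).continuous.comp 𝓖.κ_contDiff.continuous
  exact ((h1.mul hy.continuous).sub (hy.continuous.mul h1)).add (ContDiff.deriv_infty hy).continuous

/-- This is the integrated form of `evol_deriv`. Read from right to left it is integration by parts:
when `z = i[D + M, y]`, the primitive of the evolution of `z` is a boundary term minus `T⁻¹` times
another primitive. -/
theorem isPrim_tr {y c : ℝ → Op H} (hy : ContDiff ℝ ∞ y) (hc : ∀ σ, 𝓜.IsCommutator (y σ) (c σ))
    {z : ℝ → Op H} (hz : Continuous z)
    (hcz : ∀ σ, Complex.I • (c σ + (𝓖.M σ * y σ - y σ * 𝓖.M σ)) = z σ) :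
    IsPrim (fun x s => 𝓖.tr z x s + (x.T : ℂ)⁻¹ • 𝓖.tr (𝓖.covDeriv y) x s)
      fun x s => 𝓖.tr y x s - 𝓖.tr y x (-x.T) := by
  refine IsPrim.of_deriv (F := 𝓖.tr y) (fun x s => ?_) fun x =>
    (𝓖.tr_strongCont hz x).add ((𝓖.tr_strongCont (𝓖.covDeriv_continuous hy) x).const_smul _)
  refine (𝓖.evol_deriv x.prop hy hc s).congr_deriv ?_
  rw [hcz, evol_add, evol_smul]
  rfl

/-- Hilbert–Schmidt operators form a two-sided ideal, so the commutator with the bounded operator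
`κ` does not leave the class. -/
theorem exists_op_covDeriv {ξ : ℝ → WeightedHS b (1 : Op H)} (hξ : ContDiff ℝ ∞ ξ) :
    ∃ η : ℝ → WeightedHS b (1 : Op H), ContDiff ℝ ∞ η ∧
      (fun σ => op b 1 (η σ)) = 𝓖.covDeriv fun σ => op b 1 (ξ σ) := by
  have hκ := contDiff_clm_comp (op b 𝓦.G) 𝓖.κ_contDiff
  refine ⟨fun σ => mulLeft b (op b 𝓦.G (𝓖.κ σ)) (ξ σ) - mulRight b 1 (ξ σ) (op b 𝓦.G (𝓖.κ σ)) +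
    deriv ξ σ, ?_, ?_⟩
  · exact ((contDiff_clm_apply (contDiff_clm_comp (mulLeft b) hκ) hξ).sub
      (contDiff_mulRight b hξ hκ)).add (ContDiff.deriv_infty hξ)
  · funext σ
    have hd := (hasDerivAt_clm_comp (op b (1 : Op H)) (ContDiff.hasDerivAt_deriv hξ σ)).deriv
    simp only [map_add, map_sub, op_mulLeft, op_mulRight, covDeriv]
    exact congrArg _ hd.symm

omit [CompleteSpace H] in
theorem T_ne (x : Switching 𝓜 A h) : (x.T : ℂ) ≠ 0 := Complex.ofReal_ne_zero.2 x.T_pos.ne'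

/-- The primitive of an evolution with odd generator is Hilbert-Schmidt. -/
theorem exists_prim_odd {y : ℝ → WeightedHS b 𝓦.G} (hy : ContDiff ℝ ∞ y) :
    ∃ F, IsPrim (𝓖.tr fun σ => oddPart 𝓜.J (op b 𝓦.G (y σ))) F ∧ UnifHS b F := by
  obtain ⟨ξ, hξ, -, hc⟩ := 𝓜.exists_commutator_solution b 𝓦 𝓖.M_contDiff 𝓖.M_J 𝓖.M_small hy
  have hz : Continuous fun σ => oddPart 𝓜.J (op b 𝓦.G (y σ)) :=
    (oddPart 𝓜.J).continuous.comp ((op b 𝓦.G).continuous.comp hy.continuous)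
  -- Here `y_odd = i[D + M, ξ]`. The remaining term `T⁻¹ ∫ evol (covDeriv ξ)` is bounded because
  -- `covDeriv ξ` is again Hilbert–Schmidt.
  have hp := 𝓖.isPrim_tr (contDiff_clm_comp (op b 1) hξ) (fun σ => (hc σ).2) hz fun σ => by
    rw [sub_add_cancel, smul_neg, smul_smul, Complex.I_mul_I]; module
  obtain ⟨η, hη, hηξ⟩ := 𝓖.exists_op_covDeriv hξ
  rw [← hηξ] at hp
  obtain ⟨R, hR⟩ := IsPrim.exists (F' := 𝓖.tr fun σ => op b 1 (η σ))
    (𝓖.tr_strongCont ((op b 1).continuous.comp hη.continuous))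
  have hp2 := hp.add ((hR.smul fun x => (x.T : ℂ)⁻¹).smul fun _ => -1)
  refine ⟨_, ⟨𝓖.tr_strongCont hz, fun x s f => ?_⟩, UnifHS.add
    (UnifHS.sub (K := fun x _ => 𝓖.tr (fun σ => op b 1 (ξ σ)) x (-x.T))
      (𝓖.tr_unifHS hξ.continuous) ?_) (((𝓖.tr_unifHS hη.continuous).prim hR).smul (-1))⟩
  · rw [hp2.apply_eq]
    refine intervalIntegral.integral_congr fun r _ => ?_
    simp
  · obtain ⟨c, hc⟩ := 𝓖.tr_unifHS hξ.continuous
    exact ⟨c, fun x s _ => hc x _ ⟨le_rfl, by linarith [x.T_pos]⟩⟩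

/-- The evolution of the positive spectral projection differs from the projection by `O(1/T)`. -/
theorem exists_proj_expansion (h0 : h (-1) = 0) (h0' : deriv h (-1) = 0) :
    ∃ χ η : ℝ → WeightedHS b (1 : Op H), ContDiff ℝ ∞ χ ∧ ContDiff ℝ ∞ η ∧
      ∃ R, IsPrim (𝓖.tr fun σ => op b 1 (η σ)) R ∧ ∀ x s,
        (x.T : ℂ) • (𝓜.P - 𝓖.tr (fun _ => 𝓜.P) x s) =
          (x.T : ℂ)⁻¹ • R x s - 𝓖.tr (fun σ => op b 1 (χ σ)) x s := by
  obtain ⟨ξ, hξ, hξ0, hc⟩ :=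
    𝓜.exists_commutator_solution b 𝓦 𝓖.M_contDiff 𝓖.M_J 𝓖.M_small 𝓖.κ_contDiff
  -- The choice `χ = ξ J` works because `J` commutes with `D + M`: from `i[D + M, ξ] = κ_odd`
  -- follows `i[D + M, χ] = κ_odd J = [κ, P]`.
  have hχ : ContDiff ℝ ∞ fun σ => mulRight b 1 (ξ σ) 𝓜.J := contDiff_mulRight b hξ contDiff_const
  obtain ⟨η, hη, hηχ⟩ := 𝓖.exists_op_covDeriv hχ
  refine ⟨_, η, hχ, hη, ?_⟩
  have hz : Continuous fun σ => oddPart 𝓜.J (op b 𝓦.G (𝓖.κ σ)) * 𝓜.J :=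
    ((oddPart 𝓜.J).continuous.comp ((op b 𝓦.G).continuous.comp 𝓖.κ_contDiff.continuous)).mul
      continuous_const
  have hJ := FreeModel.IsCommutator.of_commute fun t => 𝓜.E_J t
  have hp := 𝓖.isPrim_tr (contDiff_clm_comp (op b 1) hχ)
    (c := fun σ => (-(Complex.I • oddPart 𝓜.J (op b 𝓦.G (𝓖.κ σ))) -
        (𝓖.M σ * op b 1 (ξ σ) - op b 1 (ξ σ) * 𝓖.M σ)) * 𝓜.J)
    (fun σ => by simpa using (hc σ).2.mul hJ) hz fun σ => by
      rw [op_mulRight, mul_assoc _ 𝓜.J, ← (𝓖.M_J σ).eq, ← mul_assoc, ← mul_assoc, ← sub_mul,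
        ← add_mul, sub_add_cancel, ← smul_mul_assoc, smul_neg, smul_smul, Complex.I_mul_I,
        neg_smul, one_smul, neg_neg]
  rw [← hηχ] at hp
  obtain ⟨R, hR⟩ := IsPrim.exists (F' := 𝓖.tr fun σ => op b 1 (η σ))
    (𝓖.tr_strongCont ((op b 1).continuous.comp hη.continuous))
  refine ⟨R, hR, fun x s => ?_⟩
  have hcov : 𝓖.covDeriv (fun _ => 𝓜.P) = fun σ => oddPart 𝓜.J (op b 𝓦.G (𝓖.κ σ)) * 𝓜.J := by
    funext σ
    rw [covDeriv, deriv_const, add_zero, 𝓜.sub_P]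
  have hPc : 𝓜.IsCommutator 𝓜.P 0 := .of_commute fun t => 𝓜.commute_P (𝓜.E_J t)
  -- Since `[D + M, P] = 0`, the evolved projection changes only at the rate `T⁻¹`, through `[κ,
  -- P]`.
  have hp1 := 𝓖.isPrim_tr (y := fun _ => 𝓜.P) contDiff_const (fun _ => hPc) (z := fun _ => 0)
    continuous_const fun σ => by
      rw [(𝓜.commute_P (𝓖.M_J σ)).eq, sub_self, add_zero, smul_zero]
  rw [hcov] at hp1
  have hp2 := ((hp1.smul fun x => (x.T : ℂ)).add (hR.smul fun x => (x.T : ℂ)⁻¹))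
  have e : (fun (x : Switching 𝓜 A h) s => (x.T : ℂ) • (𝓖.tr (fun _ => 𝓜.P) x s -
      𝓖.tr (fun _ => 𝓜.P) x (-x.T)) + (x.T : ℂ)⁻¹ • R x s) = _ := hp2.unique (K := fun x s =>
        𝓖.tr (fun σ => op b 1 (mulRight b 1 (ξ σ) 𝓜.J)) x s -
        𝓖.tr (fun σ => op b 1 (mulRight b 1 (ξ σ) 𝓜.J)) x (-x.T)) (by
      convert hp using 3 with x s
      have : 𝓖.tr (fun _ => 0) x s = 0 := 𝓖.evol_zero _ _
      rw [this, zero_add, smul_smul, mul_inv_cancel₀ (T_ne x), one_smul])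
  have e1 := congrFun (congrFun e x) s
  -- At time `-T` the frame and the propagator are trivial and `P` commutes with the free evolution,
  -- so the evolved projection starts at `P`; the boundary term of `χ` vanishes because `κ(-1) = 0`.
  simp only [𝓖.tr_init h0, 𝓜.conj_P, hξ0 _ (𝓖.κ_eq_zero _ h0')] at e1
  simp only [map_zero, _root_.zero_apply, FreeModel.conj, mul_zero, zero_mul, sub_zero] at e1
  rw [← e1]
  module

end AdiabaticFrame

end DiracSwitching

end

/-! ### Off-diagonal blocks of evolutions and of their primitives -/

noncomputable section

namespace DiracSwitching

open WeightedHS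

namespace AdiabaticFrame

variable {H : Type*} [NormedAddCommGroup H] [InnerProductSpace ℂ H] [CompleteSpace H]
variable {ι : Type*} {b : HilbertBasis ι ℂ H} {𝓜 : FreeModel H} {𝓦 : Weight 𝓜}
variable {A : Op H} {h : ℝ → ℝ} (𝓖 : AdiabaticFrame b 𝓦 A h)

/-- An even `y` commutes with `P`, hence its evolution commutes with the evolved projection. The
block thus depends only on the deviation of that projection from `P`, which is small. -/
theorem offDiag_even {y : ℝ → Op H} (hy : ∀ σ, Commute (y σ) 𝓜.J) (x : Switching 𝓜 A h) (s : ℝ) :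
    𝓜.P * 𝓖.tr y x s * (1 - 𝓜.P) =
      𝓜.P * ((𝓜.P - 𝓖.tr (fun _ => 𝓜.P) x s) * 𝓖.tr y x s -
        𝓖.tr y x s * (𝓜.P - 𝓖.tr (fun _ => 𝓜.P) x s)) * (1 - 𝓜.P) := by
  have hc : 𝓖.tr (fun _ => 𝓜.P) x s * 𝓖.tr y x s = 𝓖.tr y x s * 𝓖.tr (fun _ => 𝓜.P) x s := by
    simp only [tr, ← evol_mul, (𝓜.commute_P (hy _)).eq]
  have e : (𝓜.P - 𝓖.tr (fun _ => 𝓜.P) x s) * 𝓖.tr y x s -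
        𝓖.tr y x s * (𝓜.P - 𝓖.tr (fun _ => 𝓜.P) x s) =
      𝓜.P * 𝓖.tr y x s - 𝓖.tr y x s * 𝓜.P := by
    rw [sub_mul, mul_sub, hc]; abel
  rw [e, mul_sub 𝓜.P, sub_mul, ← mul_assoc 𝓜.P 𝓜.P, 𝓜.P_mul_P, mul_assoc 𝓜.P (_ * 𝓜.P),
    mul_assoc _ 𝓜.P, 𝓜.P_mul_one_sub_P, mul_zero, mul_zero, sub_zero]

theorem unifHS_error (h0 : h (-1) = 0) (h0' : deriv h (-1) = 0) :
    UnifHS b fun (x : Switching 𝓜 A h) s => (x.T : ℂ) • (𝓜.P - 𝓖.tr (fun _ => 𝓜.P) x s) := by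
  obtain ⟨χ, η, hχ, hη, R, hR, e⟩ := 𝓖.exists_proj_expansion h0 h0'
  simp only [e]
  exact ((𝓖.tr_unifHS hη.continuous).prim hR).sub (𝓖.tr_unifHS hχ.continuous)

theorem unifHS_offDiag_even (h0 : h (-1) = 0) (h0' : deriv h (-1) = 0) {y : ℝ → Op H}
    (hy : ∀ σ, Commute (y σ) 𝓜.J) (hyc : Continuous y) :
    UnifHS b fun (x : Switching 𝓜 A h) s => (x.T : ℂ) • (𝓜.P * 𝓖.tr y x s * (1 - 𝓜.P)) := by
  have h1 := 𝓖.unifHS_error h0 h0'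
  have hY := 𝓖.tr_unifBdd hyc
  have h2 := (((h1.mul_right hY).sub (h1.mul_left hY)).mul_left (.const 𝓜.P)).mul_right
    (.const (1 - 𝓜.P))
  simp only [𝓖.offDiag_even hy]
  simpa only [smul_mul_assoc, mul_smul_comm, ← smul_sub] using h2

/-- The off-diagonal block of the primitive of an evolution is uniformly bounded. -/
theorem unifHS_offDiag_prim (h0 : h (-1) = 0) (h0' : deriv h (-1) = 0)
    {y : ℝ → WeightedHS b 𝓦.G} (hy : ContDiff ℝ ∞ y) {F : Switching 𝓜 A h → ℝ → Op H}
    (hF : IsPrim (𝓖.tr fun σ => op b 𝓦.G (y σ)) F) :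
    UnifHS b fun x s => 𝓜.P * F x s * (1 - 𝓜.P) := by
  obtain ⟨Fo, hFo, hFo'⟩ := 𝓖.exists_prim_odd hy
  have hyc := (op b 𝓦.G).continuous.comp hy.continuous
  have hec : Continuous fun σ => op b 𝓦.G (y σ) - oddPart 𝓜.J (op b 𝓦.G (y σ)) :=
    hyc.sub ((oddPart 𝓜.J).continuous.comp hyc)
  obtain ⟨Fe, hFe⟩ := IsPrim.exists (𝓖.tr_strongCont hec)
  have e : F = fun x s => Fe x s + Fo x s := hF.unique (by
    convert hFe.add hFo using 1
    rw [← tr_add]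
    congr 1
    funext σ
    exact (sub_add_cancel _ _).symm)
  -- The block of an even evolution is `O(1/T)` at each time, so its integral over a time at most
  -- `T` is `O(1)`.
  have he := (𝓖.unifHS_offDiag_even h0 h0' (fun σ => 𝓜.commute_sub_oddPart _) hec).prim
    ((hFe.mul_mul 𝓜.P (1 - 𝓜.P)).smul fun x => (x.T : ℂ))
  have he' : UnifHS b fun x s => 𝓜.P * Fe x s * (1 - 𝓜.P) := by
    simpa only [smul_smul, inv_mul_cancel₀ (T_ne _), one_smul] using he
  have ho := (hFo'.mul_left (.const 𝓜.P)).mul_right (.const (1 - 𝓜.P))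
  rw [e]
  simpa only [mul_add, add_mul] using he'.add ho

/-- The strong integral of the switched perturbation in terms of the frame. -/
theorem isPrim_perturbation (hh : ContDiff ℝ ∞ h) (h0' : deriv h (-1) = 0)
    {F K : Switching 𝓜 A h → ℝ → Op H} (hF : IsPrim (𝓖.tr (deriv 𝓖.M)) F)
    (hK : IsPrim (𝓖.tr fun σ => op b 𝓦.G (deriv 𝓖.κ σ)) K) :
    IsPrim (𝓖.tr fun σ => ((deriv h σ : ℝ) : ℂ) • (𝓖.Winv σ * A * 𝓖.W σ)) fun x s =>
      F x s - (Complex.I * (x.T : ℂ)⁻¹) • K x s +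
        Complex.I • (𝓖.tr (fun σ => op b 𝓦.G (𝓖.κ σ)) x s) := by
  have hκ := contDiff_clm_comp (op b 𝓦.G) 𝓖.κ_contDiff
  have hM' := ContDiff.deriv_infty 𝓖.M_contDiff
  have hg : Continuous fun σ => ((deriv h σ : ℝ) : ℂ) • (𝓖.Winv σ * A * 𝓖.W σ) :=
    (Complex.continuous_ofReal.comp (hh.continuous_deriv (by simp))).smul
      ((𝓖.Winv_contDiff.continuous.mul continuous_const).mul 𝓖.W_contDiff.continuous)
  have hp := 𝓖.isPrim_tr hκ 𝓖.commutator_κ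
    (z := fun σ => Complex.I • deriv 𝓖.M σ +
      (-Complex.I) • ((deriv h σ : ℝ) : ℂ) • (𝓖.Winv σ * A * 𝓖.W σ))
    ((hM'.continuous.const_smul Complex.I).add (hg.const_smul (-Complex.I))) fun σ => by module
  -- The commutator of `κ` with itself vanishes; only `κ'` is left.
  have hcov : 𝓖.covDeriv (fun σ => op b 𝓦.G (𝓖.κ σ)) = fun σ => op b 𝓦.G (deriv 𝓖.κ σ) := by
    funext σ
    rw [covDeriv, sub_self, zero_add]
    exact (hasDerivAt_clm_comp (op b 𝓦.G) (ContDiff.hasDerivAt_deriv 𝓖.κ_contDiff σ)).deriv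
  rw [hcov] at hp
  have hp2 := (hF.add (hK.smul fun x => -(Complex.I * (x.T : ℂ)⁻¹))).add
    (hp.smul fun _ => Complex.I)
  have hi : ∀ x : Switching 𝓜 A h, 𝓖.tr (fun σ => op b 𝓦.G (𝓖.κ σ)) x (-x.T) = 0 := fun x => by
    have e : -x.T / x.T = -1 := by rw [neg_div, div_self x.T_pos.ne']
    rw [tr, e, 𝓖.κ_eq_zero _ h0', map_zero, evol_zero]
  refine ⟨𝓖.tr_strongCont hg, fun x s f => ?_⟩
  have e := hp2.apply_eq x s f
  simp only [hi, sub_zero] at e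
  have e' : ∀ r, 𝓖.tr (fun σ => ((deriv h σ : ℝ) : ℂ) • (𝓖.Winv σ * A * 𝓖.W σ)) x r =
      𝓖.tr (deriv 𝓖.M) x r + -(Complex.I * (x.T : ℂ)⁻¹) • 𝓖.tr (fun σ => op b 𝓦.G (deriv 𝓖.κ σ)) x r +
      Complex.I • (𝓖.tr (fun σ => Complex.I • deriv 𝓖.M σ +
      (-Complex.I) • ((deriv h σ : ℝ) : ℂ) • (𝓖.Winv σ * A * 𝓖.W σ)) x r + (x.T : ℂ)⁻¹ •
        𝓖.tr (fun σ => op b 𝓦.G (deriv 𝓖.κ σ)) x r) := fun r => by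
    simp only [tr, evol_add, evol_smul]
    linear_combination (norm := module) Complex.I_mul_I • (((deriv h (r / x.T) : ℝ) : ℂ) •
      𝓖.evol x.prop r (𝓖.Winv (r / x.T) * A * 𝓖.W (r / x.T))) -
      Complex.I_mul_I • 𝓖.evol x.prop r (deriv 𝓖.M (r / x.T))
  simp only [e']
  rw [← e, neg_smul, sub_eq_add_neg]

/-- The off-diagonal block of the primitive of `M'` is of order `1/T`. -/
theorem unifHS_offDiag_prim_deriv_M (h0 : h (-1) = 0) (h0' : deriv h (-1) = 0)
    {F : Switching 𝓜 A h → ℝ → Op H} (hF : IsPrim (𝓖.tr (deriv 𝓖.M)) F) :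
    UnifHS b fun x s => (x.T : ℂ) • (𝓜.P * F x s * (1 - 𝓜.P)) := by
  obtain ⟨χ, η, hχ, hη, R, hR, e⟩ := 𝓖.exists_proj_expansion h0 h0'
  have hM' := ContDiff.deriv_infty 𝓖.M_contDiff
  have hM'J : ∀ σ, Commute (deriv 𝓖.M σ) 𝓜.J := fun σ => by
    have d := ContDiff.hasDerivAt_deriv 𝓖.M_contDiff σ
    have d1 := d.mul_const 𝓜.J
    have d2 := d.const_mul 𝓜.J
    simp only [fun σ => (𝓖.M_J σ).eq] at d1
    exact d1.unique d2
  let Y : Switching 𝓜 A h → ℝ → Op H := 𝓖.tr (deriv 𝓖.M)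
  let X : Switching 𝓜 A h → ℝ → Op H := 𝓖.tr fun σ => op b 1 (χ σ)
  let r : Switching 𝓜 A h → ℝ → Op H := fun x s => (x.T : ℂ)⁻¹ • R x s
  have hχc := (op b (1 : Op H)).continuous.comp hχ.continuous
  -- Solving the expansion for the remainder `r = T⁻¹R` exhibits it as a combination of evolutions,
  -- from which its strong continuity is read off.
  have hrX : ∀ x s, r x s = (x.T : ℂ) • (𝓜.P + -𝓖.tr (fun _ => 𝓜.P) x s) + X x s :=
    fun x s => by rw [← sub_eq_add_neg, e, sub_add_cancel]
  have hYs : ∀ x, StrongCont (Y x) := 𝓖.tr_strongCont hM'.continuous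
  have hrs : ∀ x, StrongCont (r x) := fun x => by
    rw [show r x = _ from funext (hrX x)]
    exact (((StrongCont.const _).add (𝓖.tr_strongCont continuous_const x).neg).const_smul _).add
      (𝓖.tr_strongCont hχc x)
  have hYb : UnifBdd Y := 𝓖.tr_unifBdd hM'.continuous
  have hrb : UnifBdd r :=
    (𝓖.tr_unifBdd ((op b (1 : Op H)).continuous.comp hη.continuous)).prim hR
  have hPYQ := 𝓖.unifHS_offDiag_even h0 h0' hM'J hM'.continuous
  -- The integrand of `R` is the evolution of a Hilbert–Schmidt family, so the `O(1)` bound for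
  -- blocks of primitives applies to `R` itself and gives an `O(1/T)` block for `r`.
  have hPRQ : UnifHS b fun x s => 𝓜.P * R x s * (1 - 𝓜.P) :=
    𝓖.unifHS_offDiag_prim h0 h0' (contDiff_clm_comp (FreeModel.ofHS b 𝓦) hη) (by simpa using hR)
  let B : Switching 𝓜 A h → ℝ → Op H := fun x s =>
    𝓜.P * (r x s * Y x s + -(Y x s * r x s)) * (1 - 𝓜.P)
  obtain ⟨Bp, hBp⟩ := IsPrim.exists (F' := B) fun x =>
    ((StrongCont.const _).mul (((hrs x).mul (hYs x)).add ((hYs x).mul (hrs x)).neg)).mul (.const _)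
  -- Inserting `P + Q = 1` between `r` and `Y` yields four products. Each contains one of the blocks
  -- `P r Q` and `P Y Q`, both of order `1/T` in Hilbert–Schmidt norm, next to factors bounded in
  -- norm.
  have hTB : UnifHS b fun x s => (x.T : ℂ) • B x s := by
    have h1 := ((hPYQ.mul_left ((UnifBdd.const 𝓜.P).mul hrb)).add
      (hPRQ.mul_right (hYb.mul (.const (1 - 𝓜.P))))).sub
      ((hPRQ.mul_left ((UnifBdd.const 𝓜.P).mul hYb)).add
      (hPYQ.mul_right (hrb.mul (.const (1 - 𝓜.P)))))
    convert h1 using 3 with x s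
    change _ = 𝓜.P * r x s * (x.T : ℂ) • (𝓜.P * Y x s * (1 - 𝓜.P)) +
      𝓜.P * R x s * (1 - 𝓜.P) * (Y x s * (1 - 𝓜.P)) -
      (𝓜.P * Y x s * (𝓜.P * R x s * (1 - 𝓜.P)) +
        (x.T : ℂ) • (𝓜.P * Y x s * (1 - 𝓜.P)) * (r x s * (1 - 𝓜.P)))
    have hR' : R x s = (x.T : ℂ) • r x s := by
      simp only [r, smul_smul, mul_inv_cancel₀ (T_ne x), one_smul]
    rw [hR']
    simp only [mul_smul_comm, smul_mul_assoc, ← smul_add, ← smul_sub]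
    congr 1
    change 𝓜.P * (r x s * Y x s + -(Y x s * r x s)) * (1 - 𝓜.P) =
      𝓜.P * r x s * (𝓜.P * Y x s * (1 - 𝓜.P)) +
      𝓜.P * r x s * (1 - 𝓜.P) * (Y x s * (1 - 𝓜.P)) -
      (𝓜.P * Y x s * (𝓜.P * r x s * (1 - 𝓜.P)) +
        (𝓜.P * Y x s * (1 - 𝓜.P)) * (r x s * (1 - 𝓜.P)))
    generalize r x s = r', Y x s = Y', 𝓜.P = P'
    noncomm_ring
  have hBp' : UnifHS b Bp := by
    have := hTB.prim (hBp.smul fun x => (x.T : ℂ))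
    simpa only [smul_smul, inv_mul_cancel₀ (T_ne _), one_smul] using this
  -- The contribution `-[X, Y]` of `χ` is the evolution of the commutator `[M', χ]`. This is
  -- Hilbert–Schmidt, so it belongs to the class of weight `G` and its primitive has an `O(1)`
  -- block.
  let z : ℝ → WeightedHS b 𝓦.G := fun σ =>
    FreeModel.ofHS b 𝓦 (mulLeft b (deriv 𝓖.M σ) (χ σ) - mulRight b 1 (χ σ) (deriv 𝓖.M σ))
  have hz : ContDiff ℝ ∞ z := contDiff_clm_comp (FreeModel.ofHS b 𝓦)
    ((contDiff_clm_apply (contDiff_clm_comp (mulLeft b) hM') hχ).sub (contDiff_mulRight b hχ hM'))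
  obtain ⟨Z, hZ⟩ := IsPrim.exists (F' := 𝓖.tr fun σ => op b 𝓦.G (z σ))
    (𝓖.tr_strongCont ((op b 𝓦.G).continuous.comp hz.continuous))
  have hZ' := 𝓖.unifHS_offDiag_prim h0 h0' hz hZ
  -- By `offDiag_even`, `T · P Y Q = P [r - X, Y] Q`; integrating the two contributions separately
  -- gives the two primitives.
  have key : (fun (x : Switching 𝓜 A h) s => (x.T : ℂ) • (𝓜.P * F x s * (1 - 𝓜.P))) =
      fun x s => Bp x s + 𝓜.P * Z x s * (1 - 𝓜.P) := by
    refine ((hF.mul_mul 𝓜.P (1 - 𝓜.P)).smul fun x => (x.T : ℂ)).unique ?_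
    convert hBp.add (hZ.mul_mul 𝓜.P (1 - 𝓜.P)) using 3 with x s
    have hz' : 𝓖.tr (fun σ => op b 𝓦.G (z σ)) x s = Y x s * X x s - X x s * Y x s := by
      simp only [z, FreeModel.op_ofHS, map_sub, op_mulLeft, op_mulRight, tr, evol_sub, evol_mul, Y, X]
    rw [hz', 𝓖.offDiag_even hM'J, ← smul_mul_assoc, ← mul_smul_comm, smul_sub, ← smul_mul_assoc,
      ← mul_smul_comm, e]
    change 𝓜.P * ((r x s - X x s) * Y x s - Y x s * (r x s - X x s)) * (1 - 𝓜.P) =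
      𝓜.P * (r x s * Y x s + -(Y x s * r x s)) * (1 - 𝓜.P) + _
    generalize r x s = r', Y x s = Y', X x s = X', 𝓜.P = P'
    noncomm_ring
  rw [key]
  exact hBp'.add hZ'

/-- The off-diagonal block of the strong integral of the switched perturbation is a
Hilbert-Schmidt operator of norm `O(T⁻²)`. -/
theorem exists_hsLe_offDiag (𝓖 : AdiabaticFrame b 𝓦 A h) (hh : ContDiff ℝ ∞ h) (h0 : h (-1) = 0) (h0' : deriv h (-1) = 0)
    (h1 : deriv h 0 = 0) :
    ∃ C, 0 < C ∧ ∀ (T : ℝ) (_ : 0 < T) (𝓥 : Propagator 𝓜 A h T) (K : Op H),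
      (∀ f, K f = ∫ s in (-T)..0,
        (𝓥.V s * ((T⁻¹ * deriv h (s / T) : ℝ) : ℂ) • 𝓜.conj s A * 𝓥.Vinv s) f) →
      HSLe b (𝓜.P * K * (1 - 𝓜.P)) (C / T ^ 2) := by
  have hM' := ContDiff.deriv_infty 𝓖.M_contDiff
  have hκ' := ContDiff.deriv_infty 𝓖.κ_contDiff
  obtain ⟨F, hF⟩ := IsPrim.exists (F' := 𝓖.tr (deriv 𝓖.M)) (𝓖.tr_strongCont hM'.continuous)
  obtain ⟨N, hN⟩ := IsPrim.exists (F' := 𝓖.tr fun σ => op b 𝓦.G (deriv 𝓖.κ σ))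
    (𝓖.tr_strongCont ((op b 𝓦.G).continuous.comp hκ'.continuous))
  have hp := 𝓖.isPrim_perturbation hh h0' hF hN
  obtain ⟨c, hc⟩ := (𝓖.unifHS_offDiag_prim_deriv_M h0 h0' hF).sub
    ((𝓖.unifHS_offDiag_prim h0 h0' hκ' hN).smul Complex.I)
  refine ⟨max c 1, by positivity, fun T hT 𝓥 K hK => ?_⟩
  let x : Switching 𝓜 A h := ⟨T, hT, 𝓥⟩
  have hTc : (T : ℂ) ≠ 0 := Complex.ofReal_ne_zero.2 hT.ne'
  -- The boundary term at the end of the switching is removed by `h'(0) = 0`. It would otherwise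
  -- leave a contribution with only one factor `T⁻¹`.
  have hz : 𝓖.tr (fun σ => op b 𝓦.G (𝓖.κ σ)) x 0 = 0 := by
    rw [tr, zero_div, 𝓖.κ_eq_zero _ h1, map_zero, evol_zero]
  have e : K = (T : ℂ)⁻¹ • (F x 0 - (Complex.I * (T : ℂ)⁻¹) • N x 0) := by
    ext1 f
    have e1 := hp.apply_eq x 0 f
    rw [hz, smul_zero, add_zero] at e1
    rw [hK, _root_.smul_apply, e1, ← intervalIntegral.integral_smul]
    refine intervalIntegral.integral_congr fun s _ => ?_
    rw [← _root_.smul_apply]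
    congr 1
    have e2 : 𝓖.W (s / T) * (((deriv h (s / T) : ℝ) : ℂ) •
        (𝓖.Winv (s / T) * A * 𝓖.W (s / T))) * 𝓖.Winv (s / T) =
        ((deriv h (s / T) : ℝ) : ℂ) • A := by
      rw [mul_smul_comm, smul_mul_assoc, ← mul_assoc, ← mul_assoc, 𝓖.W_mul_Winv, one_mul,
        mul_assoc, 𝓖.W_mul_Winv, mul_one]
    rw [tr, evol]
    change _ = (T : ℂ)⁻¹ • (𝓥.V s * 𝓜.conj s (𝓖.W (s / T) * (((deriv h (s / T) : ℝ) : ℂ) •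
        (𝓖.Winv (s / T) * A * 𝓖.W (s / T))) * 𝓖.Winv (s / T)) * 𝓥.Vinv s)
    rw [e2]
    simp only [FreeModel.conj, mul_smul_comm, smul_mul_assoc, Complex.ofReal_mul,
      Complex.ofReal_inv, mul_smul]
  -- One factor `T⁻¹` comes from the time derivative of `h(t/T)`; the other comes from the order of
  -- the block of `F` and from the explicit coefficient of `N`.
  have e3 : 𝓜.P * K * (1 - 𝓜.P) = ((T : ℂ)⁻¹ * (T : ℂ)⁻¹) •
      ((T : ℂ) • (𝓜.P * F x 0 * (1 - 𝓜.P)) - Complex.I • (𝓜.P * N x 0 * (1 - 𝓜.P))) := by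
    rw [e]
    generalize 1 - 𝓜.P = Q
    simp only [mul_smul_comm, smul_mul_assoc, mul_sub, sub_mul, smul_sub, smul_smul]
    rw [mul_assoc (T : ℂ)⁻¹, inv_mul_cancel₀ hTc, mul_one]
    congr 2
    ring
  rw [e3]
  refine ((hc x 0 ⟨by change -T ≤ 0; linarith, le_rfl⟩).smul _).mono ?_
  rw [norm_mul, norm_inv, Complex.norm_real, Real.norm_of_nonneg hT.le, div_eq_mul_inv, mul_comm,
    ← mul_inv, ← sq]
  exact mul_le_mul_of_nonneg_right (le_max_left _ _) (by positivity)

end AdiabaticFrame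

end DiracSwitching

end

noncomputable section

namespace DiracSwitching

/-! ### Fourier multipliers with bounded continuous symbols -/

/-- Bounded continuous matrix-valued functions. -/
structure IsSymbol (a : Space → SpinorOp) : Prop where
  cont : Continuous a
  bdd : ∃ C, ∀ p, ‖a p‖ ≤ C

namespace IsSymbol

variable {a a' : Space → SpinorOp}

theorem memLp (ha : IsSymbol a) : MemLp a ⊤ (volume : Measure Space) :=
  memLp_top_of_bound ha.cont.aestronglyMeasurable ha.bdd.choose (ae_of_all _ ha.bdd.choose_spec)

theorem scale (ha : IsSymbol a) : IsSymbol fun ξ => a ((2 * Real.pi) • ξ) :=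
  ⟨ha.cont.comp (continuous_const_smul _), ha.bdd.imp fun _ h _ => h _⟩

theorem one : IsSymbol 1 := ⟨continuous_const, 1, fun _ => by simp⟩

theorem add (ha : IsSymbol a) (ha' : IsSymbol a') : IsSymbol (a + a') := by
  obtain ⟨C, hC⟩ := ha.bdd
  obtain ⟨C', hC'⟩ := ha'.bdd
  exact ⟨ha.cont.add ha'.cont, C + C', fun p => (norm_add_le _ _).trans (add_le_add (hC p) (hC' p))⟩

theorem mul (ha : IsSymbol a) (ha' : IsSymbol a') : IsSymbol (a * a') := by
  obtain ⟨C, hC⟩ := ha.bdd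
  obtain ⟨C', hC'⟩ := ha'.bdd
  exact ⟨ha.cont.mul ha'.cont, C * C', fun p => (norm_mul_le _ _).trans
    (mul_le_mul (hC p) (hC' p) (norm_nonneg _) ((norm_nonneg _).trans (hC p)))⟩

theorem smul (ha : IsSymbol a) (z : ℂ) : IsSymbol (z • a) := by
  obtain ⟨C, hC⟩ := ha.bdd
  exact ⟨ha.cont.const_smul z, ‖z‖ * C, fun p => by
    rw [Pi.smul_apply, norm_smul]; exact mul_le_mul_of_nonneg_left (hC p) (norm_nonneg _)⟩

end IsSymbol

theorem mulOp_mul {a b : Space → SpinorOp} (ha : MemLp a ⊤ (volume : Measure Space))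
    (hb : MemLp b ⊤ (volume : Measure Space))
    (hab : MemLp (a * b) ⊤ (volume : Measure Space)) : mulOp (a * b) = mulOp a * mulOp b := by
  ext1 f
  refine Lp.ext ?_
  rw [mul_apply_eq_comp]
  filter_upwards [mulOp_coeFn hab f, mulOp_coeFn ha (mulOp b f), mulOp_coeFn hb f] with x h1 h2 h3
  rw [h1, h2, h3]
  rfl

theorem mulOp_add {a b : Space → SpinorOp} (ha : MemLp a ⊤ (volume : Measure Space))
    (hb : MemLp b ⊤ (volume : Measure Space))
    (hab : MemLp (a + b) ⊤ (volume : Measure Space)) : mulOp (a + b) = mulOp a + mulOp b := by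
  ext1 f
  refine Lp.ext ?_
  rw [_root_.add_apply]
  filter_upwards [mulOp_coeFn hab f, mulOp_coeFn ha f, mulOp_coeFn hb f,
    Lp.coeFn_add (mulOp a f) (mulOp b f)] with x h1 h2 h3 h4
  rw [h1, h4, Pi.add_apply, Pi.add_apply, h2, h3]
  rfl

theorem mulOp_smul {a : Space → SpinorOp} (ha : MemLp a ⊤ (volume : Measure Space)) (z : ℂ)
    (hz : MemLp (z • a) ⊤ (volume : Measure Space)) :
    mulOp (z • a) = z • mulOp a := by
  ext1 f
  refine Lp.ext ?_
  rw [_root_.smul_apply]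
  filter_upwards [mulOp_coeFn hz f, mulOp_coeFn ha f,
    Lp.coeFn_smul z (mulOp a f)] with x h1 h2 h3
  rw [h1, h3, Pi.smul_apply, Pi.smul_apply, h2]
  rfl

theorem mulOp_one : mulOp 1 = 1 := by
  ext1 f
  refine Lp.ext ?_
  filter_upwards [mulOp_coeFn IsSymbol.one.memLp f] with x h1
  rw [h1]
  rfl

theorem fourierMultiplier_apply (a : Space → SpinorOp) (f : OneParticle) :
    fourierMultiplier a f = (Lp.fourierTransformₗᵢ Space Spinor).symm
      (mulOp (fun ξ => a ((2 * Real.pi) • ξ)) (Lp.fourierTransformₗᵢ Space Spinor f)) := rfl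

theorem fourierMultiplier_mul {a b : Space → SpinorOp} (ha : IsSymbol a) (hb : IsSymbol b) :
    fourierMultiplier (a * b) = fourierMultiplier a * fourierMultiplier b := by
  ext1 f
  have h := mulOp_mul ha.scale.memLp hb.scale.memLp (ha.mul hb).scale.memLp
  rw [mul_apply_eq_comp]
  simp only [fourierMultiplier_apply, LinearIsometryEquiv.apply_symm_apply]
  exact congrArg _ (congrArg (fun T : Op OneParticle => T _) h)

theorem fourierMultiplier_add {a b : Space → SpinorOp} (ha : IsSymbol a) (hb : IsSymbol b) :
    fourierMultiplier (a + b) = fourierMultiplier a + fourierMultiplier b := by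
  ext1 f
  have h := mulOp_add ha.scale.memLp hb.scale.memLp (ha.add hb).scale.memLp
  rw [_root_.add_apply]
  simp only [fourierMultiplier_apply]
  rw [← map_add]
  exact congrArg _ (congrArg (fun T : Op OneParticle => T _) h)

theorem fourierMultiplier_smul {a : Space → SpinorOp} (ha : IsSymbol a) (z : ℂ) :
    fourierMultiplier (z • a) = z • fourierMultiplier a := by
  ext1 f
  have h := mulOp_smul ha.scale.memLp z (ha.smul z).scale.memLp
  rw [_root_.smul_apply]
  simp only [fourierMultiplier_apply]
  rw [← map_smul]
  exact congrArg _ (congrArg (fun T : Op OneParticle => T _) h)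

theorem fourierMultiplier_one : fourierMultiplier 1 = 1 := by
  ext1 f
  rw [fourierMultiplier_apply]
  have h : mulOp (fun ξ => (1 : Space → SpinorOp) ((2 * Real.pi) • ξ)) = 1 := mulOp_one
  rw [h]
  exact LinearIsometryEquiv.symm_apply_apply _ _

theorem fourierMultiplier_norm_le {a : Space → SpinorOp} {M : ℝ} (hM : 0 ≤ M)
    (h : ∀ p, ‖a p‖ ≤ M) : ‖fourierMultiplier a‖ ≤ M := by
  refine ContinuousLinearMap.opNorm_le_bound _ hM fun f => ?_
  rw [fourierMultiplier_apply, LinearIsometryEquiv.norm_map,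
    ← LinearIsometryEquiv.norm_map (Lp.fourierTransformₗᵢ Space Spinor) f]
  exact ContinuousLinearMap.le_of_opNorm_le _ (mulOp_norm_le hM fun ξ => h _) _

/-- If one of the functions is not essentially bounded, its operator is `0` by definition and
commutes trivially; no regularity has to be assumed. -/
theorem mulOp_commute {a b : Space → SpinorOp} (h : ∀ p, Commute (a p) (b p)) :
    Commute (mulOp a) (mulOp b) := by
  by_cases ha : MemLp a ⊤ (volume : Measure Space)
  · by_cases hb : MemLp b ⊤ (volume : Measure Space)
    · refine ContinuousLinearMap.ext fun f => Lp.ext ?_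
      rw [mul_apply_eq_comp, mul_apply_eq_comp]
      filter_upwards [mulOp_coeFn ha (mulOp b f), mulOp_coeFn hb f, mulOp_coeFn hb (mulOp a f),
        mulOp_coeFn ha f] with x h1 h2 h3 h4
      rw [h1, h2, h3, h4]
      exact congrArg (fun T : SpinorOp => T (f x)) (h x)
    · rw [mulOp, mulOp, dif_neg hb]; exact Commute.zero_right _
  · rw [mulOp, dif_neg ha]; exact Commute.zero_left _

theorem fourierMultiplier_commute {a b : Space → SpinorOp} (h : ∀ p, Commute (a p) (b p)) :
    Commute (fourierMultiplier a) (fourierMultiplier b) := by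
  refine ContinuousLinearMap.ext fun f => ?_
  rw [mul_apply_eq_comp, mul_apply_eq_comp]
  simp only [fourierMultiplier_apply, LinearIsometryEquiv.apply_symm_apply]
  exact congrArg _ (congrArg (fun T : Op OneParticle => T _)
    (mulOp_commute fun ξ => h ((2 * Real.pi) • ξ)))

/-- Operator norms of multipliers are bounded by suprema of symbols, so a quadratic remainder that
is uniform in momentum gives differentiability in norm. -/
theorem fourierMultiplier_hasDerivAt {a : ℝ → Space → SpinorOp} {a' : Space → SpinorOp} {t C : ℝ}
    (ha : ∀ᶠ s in 𝓝 t, IsSymbol (a s)) (ha' : IsSymbol a')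
    (h : ∀ᶠ s in 𝓝 t, ∀ p, ‖a s p - a t p - ((s - t : ℝ) : ℂ) • a' p‖ ≤ C * (s - t) ^ 2) :
    HasDerivAt (fun s => fourierMultiplier (a s)) (fourierMultiplier a') t := by
  rw [hasDerivAt_iff_isLittleO]
  refine Asymptotics.IsBigO.trans_isLittleO (g := fun s => (s - t) ^ 2) ?_ ?_
  · refine Asymptotics.IsBigO.of_bound |C| ?_
    filter_upwards [ha, h] with s has hs
    have e : fourierMultiplier (a s) - fourierMultiplier (a t) - (s - t) • fourierMultiplier a' =
        fourierMultiplier (a s + ((-1 : ℂ) • a t + (-((s - t : ℝ) : ℂ)) • a')) := by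
      rw [fourierMultiplier_add has ((ha.self_of_nhds.smul _).add (ha'.smul _)),
        fourierMultiplier_add (ha.self_of_nhds.smul _) (ha'.smul _),
        fourierMultiplier_smul ha.self_of_nhds, fourierMultiplier_smul ha']
      have : (s - t) • fourierMultiplier a' = ((s - t : ℝ) : ℂ) • fourierMultiplier a' := rfl
      rw [this]
      module
    rw [e, Real.norm_of_nonneg (sq_nonneg (s - t))]
    refine fourierMultiplier_norm_le (by positivity) fun p => ?_
    refine le_trans (le_of_eq ?_) ((hs p).trans
      (mul_le_mul_of_nonneg_right (le_abs_self C) (sq_nonneg _)))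
    congr 1
    simp only [Pi.add_apply, Pi.smul_apply]
    module
  · have h1 : Tendsto (fun s => s - t) (𝓝 t) (𝓝 0) := by
      simpa using (tendsto_id (x := 𝓝 t)).sub_const t
    exact (Asymptotics.isLittleO_pow_id one_lt_two).comp_tendsto h1

/-! ### Functions of the energy -/

theorem energy_continuous (m : ℝ) : Continuous (energy m) := by unfold energy; fun_prop

theorem le_energy (m : ℝ) (p : Space) : m ≤ energy m p :=
  Real.le_sqrt_of_sq_le (by linarith [sq_nonneg ‖p‖])

theorem energy_pos {m : ℝ} (hm : 0 < m) (p : Space) : 0 < energy m p := hm.trans_le (le_energy m p)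

/-- The symbol of the function `φ` of `|D|`. -/
def energySymbol (m : ℝ) (φ : ℝ → ℝ) (p : Space) : SpinorOp := (φ (energy m p) : ℂ) • 1

theorem norm_energySymbol (m : ℝ) (φ : ℝ → ℝ) (p : Space) :
    ‖energySymbol m φ p‖ = |φ (energy m p)| := by
  rw [energySymbol, norm_smul, norm_one, mul_one, Complex.norm_real, Real.norm_eq_abs]

theorem energySymbol_commute (m : ℝ) (φ : ℝ → ℝ) (p : Space) (X : SpinorOp) :
    Commute (energySymbol m φ p) X := (Commute.one_left X).smul_left _

theorem energySymbol_mul (m : ℝ) (φ ψ : ℝ → ℝ) :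
    energySymbol m φ * energySymbol m ψ = energySymbol m fun w => φ w * ψ w := by
  funext p
  simp [energySymbol, smul_smul, mul_comm]

theorem isSymbol_energySymbol {m : ℝ} (hm : 0 < m) {φ : ℝ → ℝ} (hφ : ContinuousOn φ (Set.Ioi 0))
    {C : ℝ} (hC : ∀ w, m ≤ w → |φ w| ≤ C) : IsSymbol (energySymbol m φ) := by
  refine ⟨?_, C, fun p => (norm_energySymbol m φ p).trans_le (hC _ (le_energy m p))⟩
  have h : Continuous fun p => φ (energy m p) :=
    hφ.comp_continuous (energy_continuous m) (energy_pos hm)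
  exact (Complex.continuous_ofReal.comp h).smul continuous_const

/-- The function `φ` of `|D|`. -/
def energyOp (m : ℝ) (φ : ℝ → ℝ) : Op OneParticle := fourierMultiplier (energySymbol m φ)

theorem energyOp_norm_le {m : ℝ} {φ : ℝ → ℝ} {C : ℝ} (hC0 : 0 ≤ C)
    (hC : ∀ w, m ≤ w → |φ w| ≤ C) : ‖energyOp m φ‖ ≤ C :=
  fourierMultiplier_norm_le hC0 fun p =>
    (norm_energySymbol m φ p).trans_le (hC _ (le_energy m p))

theorem sq_mul_exp_neg_le {a w : ℝ} (ha : 0 < a) (hw : 0 ≤ w) :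
    w ^ 2 * Real.exp (-(a * w)) ≤ 2 / a ^ 2 := by
  have h := Real.quadratic_le_exp_of_nonneg (mul_nonneg ha.le hw)
  rw [Real.exp_neg, ← div_eq_mul_inv, div_le_div_iff₀ (Real.exp_pos _) (by positivity)]
  nlinarith [mul_nonneg ha.le hw]

theorem mul_exp_neg_le {a w : ℝ} (ha : 0 < a) :
    w * Real.exp (-(a * w)) ≤ 1 / a := by
  have h := Real.add_one_le_exp (a * w)
  rw [Real.exp_neg, ← div_eq_mul_inv, div_le_div_iff₀ (Real.exp_pos _) ha]
  linarith

/-- This is `x^{7/8} ≤ eˣ` at `x = r w`. It shows that recovering `7/8` powers of `|D|` from the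
semigroup costs `r^{-7/8}`. -/
theorem rpow_mul_exp_neg_le {r w : ℝ} (hr : 0 < r) (hw : 0 < w) :
    w ^ (7 / 8 : ℝ) * Real.exp (-r * w) ≤ r ^ (-(7 / 8) : ℝ) := by
  have h1 : (r * w) ^ (7 / 8 : ℝ) ≤ Real.exp (r * w) := by
    have h0 : 0 < r * w := mul_pos hr hw
    rcases le_total (r * w) 1 with h | h
    · exact (Real.rpow_le_one h0.le h (by norm_num)).trans (Real.one_le_exp h0.le)
    · calc (r * w) ^ (7 / 8 : ℝ) ≤ (r * w) ^ (1 : ℝ) :=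
            Real.rpow_le_rpow_of_exponent_le h (by norm_num)
        _ = r * w := Real.rpow_one _
        _ ≤ Real.exp (r * w) := by linarith [Real.add_one_le_exp (r * w)]
  rw [Real.mul_rpow hr.le hw.le] at h1
  rw [neg_mul, Real.exp_neg, Real.rpow_neg hr.le, ← div_eq_mul_inv, div_le_iff₀ (Real.exp_pos _),
    inv_mul_eq_div, le_div_iff₀ (Real.rpow_pos_of_pos hr _), mul_comm]
  exact h1

/-! ### The free Dirac operator -/

theorem norm_symbol (G : DiracMatrices) {m : ℝ} (hm : 0 < m) (p : Space) :
    ‖G.symbol m p‖ = energy m p := by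
  have hw := energy_pos hm p
  have h := CStarRing.norm_star_mul_self (x := G.symbol m p)
  rw [(symbol_selfAdjoint G m p).star_eq, symbol_sq, norm_smul, norm_one, mul_one, norm_pow,
    Complex.norm_real, Real.norm_of_nonneg hw.le, sq] at h
  exact ((mul_self_inj hw.le (norm_nonneg _)).1 h).symm

/-- The symbol of the sign of `D`. -/
def signSymbol (G : DiracMatrices) (m : ℝ) (p : Space) : SpinorOp :=
  ((energy m p : ℂ))⁻¹ • G.symbol m p

theorem isSymbol_signSymbol (G : DiracMatrices) {m : ℝ} (hm : 0 < m) :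
    IsSymbol (signSymbol G m) := by
  refine ⟨?_, 1, fun p => ?_⟩
  · refine Continuous.smul (Continuous.inv₀ (G₀ := ℂ) ?_ fun p => ?_) (symbol_continuous G m)
    · exact Complex.continuous_ofReal.comp (energy_continuous m)
    · exact_mod_cast (energy_pos hm p).ne'
  · rw [signSymbol, norm_smul, norm_symbol G hm, norm_inv, Complex.norm_real,
      Real.norm_of_nonneg (energy_pos hm p).le, inv_mul_cancel₀ (energy_pos hm p).ne']

/-- The symbol of `e^{itD}`. -/
def evolSymbol (G : DiracMatrices) (m t : ℝ) (p : Space) : SpinorOp :=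
  NormedSpace.exp ((Complex.I * (t : ℂ)) • G.symbol m p)

theorem isSymbol_evolSymbol (G : DiracMatrices) (m t : ℝ) : IsSymbol (evolSymbol G m t) :=
  ⟨(evolSymbol_continuous G m).comp (by fun_prop : Continuous fun p : Space => (t, p)), 1,
    evolSymbol_norm_le G m t⟩

theorem evolSymbol_commute (G : DiracMatrices) (m t : ℝ) (p : Space) :
    Commute (evolSymbol G m t p) (G.symbol m p) := by
  let _ : NormedAlgebra ℚ SpinorOp := NormedAlgebra.restrictScalars ℚ ℂ SpinorOp
  exact ((Commute.refl (G.symbol m p)).smul_left _).exp_left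

theorem evolSymbol_add (G : DiracMatrices) (m s t : ℝ) :
    evolSymbol G m (s + t) = evolSymbol G m s * evolSymbol G m t := by
  let _ : NormedAlgebra ℚ SpinorOp := NormedAlgebra.restrictScalars ℚ ℂ SpinorOp
  funext p
  rw [Pi.mul_apply, evolSymbol, evolSymbol, evolSymbol, ← NormedSpace.exp_add_of_commute
    (((Commute.refl (G.symbol m p)).smul_left _).smul_right _), Complex.ofReal_add,
    mul_add]
  exact congrArg NormedSpace.exp (add_smul (Complex.I * (s : ℂ)) (Complex.I * (t : ℂ)) (G.symbol m p))

theorem evolSymbol_zero (G : DiracMatrices) (m : ℝ) : evolSymbol G m 0 = 1 := by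
  funext p
  rw [evolSymbol, Complex.ofReal_zero, mul_zero]
  exact (congrArg NormedSpace.exp (zero_smul ℂ (G.symbol m p))).trans NormedSpace.exp_zero

theorem evolSymbol_hasDerivAt (G : DiracMatrices) (m t : ℝ) (p : Space) :
    HasDerivAt (fun t => evolSymbol G m t p)
      (Complex.I • (evolSymbol G m t p * G.symbol m p)) t := by
  have h := (hasDerivAt_exp_smul_const (𝕂 := ℝ) (Complex.I • G.symbol m p) t)
  have e : ∀ u : ℝ, u • (Complex.I • G.symbol m p) = (Complex.I * (u : ℂ)) • G.symbol m p :=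
    fun u => by rw [mul_comm, mul_smul]; rfl
  simp only [e] at h
  rw [mul_smul_comm] at h
  exact h

/-- The mean value inequality is used twice: first for a Lipschitz bound with constant `ω(p)`, then
for the remainder, whose derivative is at most `ω(p)² |s - t|`. The growth in `p` is absorbed later
by `e^{-rω}`. -/
theorem evolSymbol_taylor (G : DiracMatrices) {m : ℝ} (hm : 0 < m) (s t : ℝ) (p : Space) :
    ‖evolSymbol G m s p - evolSymbol G m t p -
      ((s - t : ℝ) : ℂ) • Complex.I • (evolSymbol G m t p * G.symbol m p)‖ ≤
      energy m p ^ 2 * (s - t) ^ 2 := by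
  have hw := energy_pos hm p
  have h1 : ∀ u v : ℝ, ‖evolSymbol G m u p - evolSymbol G m v p‖ ≤ energy m p * |u - v| := by
    intro u v
    refine Convex.norm_image_sub_le_of_norm_hasDerivWithin_le (s := Set.univ)
      (f := fun x : ℝ => evolSymbol G m x p)
      (f' := fun x : ℝ => Complex.I • (evolSymbol G m x p * G.symbol m p))
      (fun x _ => (evolSymbol_hasDerivAt G m x p).hasDerivWithinAt) (fun x _ => ?_) convex_univ
      (Set.mem_univ v) (Set.mem_univ u)
    rw [norm_smul, Complex.norm_I, one_mul]
    refine (norm_mul_le _ _).trans ?_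
    rw [norm_symbol G hm]
    exact mul_le_of_le_one_left hw.le (evolSymbol_norm_le G m x p)
  have h2 := Convex.norm_image_sub_le_of_norm_hasDerivWithin_le (s := Set.uIcc t s)
      (f := fun x : ℝ => evolSymbol G m x p -
        x • Complex.I • (evolSymbol G m t p * G.symbol m p))
      (f' := fun x : ℝ => Complex.I • (evolSymbol G m x p * G.symbol m p) -
        (1 : ℝ) • Complex.I • (evolSymbol G m t p * G.symbol m p))
      (C := energy m p * |s - t| * energy m p)
      (fun x _ => ((evolSymbol_hasDerivAt G m x p).sub
        ((hasDerivAt_id x).smul_const _)).hasDerivWithinAt) (fun x hx => ?_) (convex_uIcc t s)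
      Set.left_mem_uIcc Set.right_mem_uIcc
  · refine le_trans (le_of_eq ?_) (h2.trans (le_of_eq ?_))
    · congr 1
      have : ∀ Z : SpinorOp, ((s - t : ℝ) : ℂ) • Z = s • Z - t • Z := fun Z =>
        sub_smul s t Z
      rw [this]
      abel
    · rw [Real.norm_eq_abs, ← sq_abs (s - t)]; ring
  · have e : Complex.I • (evolSymbol G m x p * G.symbol m p) -
        (1 : ℝ) • Complex.I • (evolSymbol G m t p * G.symbol m p) =
        Complex.I • ((evolSymbol G m x p - evolSymbol G m t p) * G.symbol m p) := by
      rw [one_smul, sub_mul]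
      exact (smul_sub _ _ _).symm
    rw [e, norm_smul, Complex.norm_I, one_mul]
    refine (norm_mul_le _ _).trans ?_
    rw [norm_symbol G hm]
    refine mul_le_mul_of_nonneg_right ((h1 x t).trans
      (mul_le_mul_of_nonneg_left ?_ hw.le)) hw.le
    exact Set.abs_sub_left_of_mem_uIcc hx

end DiracSwitching

end

/-! ### The semigroup of `|D|` and the regularized free evolution -/

noncomputable section

namespace DiracSwitching

section

variable {m : ℝ} (hm : 0 < m)
include hm

theorem isSymbol_expSymbol {r : ℝ} (hr : 0 < r) :
    IsSymbol (energySymbol m fun w => Real.exp (-r * w)) :=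
  isSymbol_energySymbol hm (by fun_prop) (C := 1) fun w hw => by
    rw [abs_of_pos (Real.exp_pos _), Real.exp_le_one_iff, neg_mul, neg_nonpos]
    exact mul_nonneg hr.le (hm.le.trans hw)

theorem isSymbol_mul_expSymbol {r : ℝ} (hr : 0 < r) :
    IsSymbol (energySymbol m fun w => w * Real.exp (-r * w)) :=
  isSymbol_energySymbol hm (by fun_prop) (C := 1 / r) fun w hw => by
    rw [abs_of_nonneg (mul_nonneg (hm.le.trans hw) (Real.exp_pos _).le), neg_mul]
    exact mul_exp_neg_le hr

theorem isSymbol_rpow_mul_expSymbol {r : ℝ} (hr : 0 < r) :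
    IsSymbol (energySymbol m fun w => w ^ (7 / 8 : ℝ) * Real.exp (-r * w)) :=
  isSymbol_energySymbol hm
    ((continuousOn_id.rpow_const fun w hw => Or.inl (ne_of_gt hw)).mul (by fun_prop))
    (C := r ^ (-(7 / 8) : ℝ)) fun w hw => by
      have hw0 : 0 < w := hm.trans_le hw
      rw [abs_of_nonneg (by positivity)]
      exact rpow_mul_exp_neg_le hr hw0

theorem isSymbol_rpow_neg {e : ℝ} (he : 0 ≤ e) : IsSymbol (energySymbol m fun w => w ^ (-e)) :=
  isSymbol_energySymbol hm
    (continuousOn_id.rpow_const fun w hw => Or.inl (ne_of_gt hw))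
    (C := m ^ (-e)) fun w hw => by
      rw [abs_of_nonneg (Real.rpow_nonneg (hm.le.trans hw) _)]
      exact Real.rpow_le_rpow_of_nonpos hm hw (by linarith)

theorem energyOp_exp_hasDerivAt {r : ℝ} (hr : 0 < r) :
    HasDerivAt (fun r => energyOp m fun w => Real.exp (-r * w))
      (-energyOp m fun w => w * Real.exp (-r * w)) r := by
  have h := fourierMultiplier_hasDerivAt (t := r) (C := 2 / (r / 2) ^ 2)
    (a := fun r => energySymbol m fun w => Real.exp (-r * w))
    (a' := (-1 : ℂ) • energySymbol m fun w => w * Real.exp (-r * w))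
    ((eventually_gt_nhds hr).mono fun s hs => isSymbol_expSymbol hm hs)
    ((isSymbol_mul_expSymbol hm hr).smul _) ?_
  · rwa [fourierMultiplier_smul (isSymbol_mul_expSymbol hm hr), neg_smul, one_smul] at h
  -- Restricting to `|s - r| < r/2` keeps the exponential in the Taylor remainder below `e^{rω/2}`.
  -- Half of the decay of `e^{-rω}` is left to absorb `ω²`, whence the constant `2/(r/2)²`.
  · filter_upwards [eventually_abs_sub_lt r (half_pos hr)] with s hs p
    have hw := energy_pos hm p
    have e : energySymbol m (fun w => Real.exp (-s * w)) p -
        energySymbol m (fun w => Real.exp (-r * w)) p - ((s - r : ℝ) : ℂ) •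
          ((-1 : ℂ) • energySymbol m fun w => w * Real.exp (-r * w)) p =
        energySymbol m (fun w => Real.exp (-s * w) - Real.exp (-r * w) +
          (s - r) * (w * Real.exp (-r * w))) p := by
      simp only [energySymbol, Pi.smul_apply, Complex.ofReal_sub, Complex.ofReal_add,
        Complex.ofReal_mul]
      module
    rw [e, norm_energySymbol]
    set w := energy m p
    set x := (r - s) * w with hx
    have e1 : Real.exp (-s * w) - Real.exp (-r * w) + (s - r) * (w * Real.exp (-r * w)) =
        Real.exp (-r * w) * (Real.exp x - 1 - x) := by
      rw [mul_sub, mul_sub, ← Real.exp_add, hx]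
      ring_nf
    have e2 : |Real.exp x - 1 - x| ≤ x ^ 2 * Real.exp |x| := by
      have := Complex.norm_exp_sub_sum_le_norm_mul_exp (x : ℂ) 2
      simp only [Finset.sum_range_succ, Finset.sum_range_zero, pow_zero, pow_one, Nat.factorial,
        Complex.norm_real, Real.norm_eq_abs, sq_abs, zero_add, Nat.cast_one, div_one, mul_one] at this
      rw [← Complex.ofReal_exp, ← sub_sub, ← Complex.ofReal_one, ← Complex.ofReal_sub,
        ← Complex.ofReal_sub, Complex.norm_real, Real.norm_eq_abs] at this
      exact this
    have e3 : |x| ≤ r / 2 * w := by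
      rw [hx, abs_mul, abs_of_pos hw, abs_sub_comm]
      exact mul_le_mul_of_nonneg_right hs.le hw.le
    rw [e1, abs_mul, abs_of_pos (Real.exp_pos _)]
    calc _ ≤ Real.exp (-r * w) * (x ^ 2 * Real.exp (r / 2 * w)) := by gcongr; exact e2.trans (by gcongr)
      _ = (s - r) ^ 2 * (w ^ 2 * (Real.exp (-r * w) * Real.exp (r / 2 * w))) := by rw [hx]; ring
      _ = (s - r) ^ 2 * (w ^ 2 * Real.exp (-(r / 2 * w))) := by
        rw [← Real.exp_add]; congr 3; ring
      _ ≤ (s - r) ^ 2 * (2 / (r / 2) ^ 2) :=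
        mul_le_mul_of_nonneg_left (sq_mul_exp_neg_le (half_pos hr) hw.le) (sq_nonneg _)
      _ = _ := mul_comm _ _

theorem freeEvolution_mul_exp_hasDerivAt (G : DiracMatrices) {r : ℝ} (hr : 0 < r) (t : ℝ) :
    HasDerivAt (fun t => freeEvolution G m t * energyOp m fun w => Real.exp (-r * w))
      (Complex.I • (freeEvolution G m t * (fourierMultiplier (signSymbol G m) *
        energyOp m fun w => w * Real.exp (-r * w)))) t := by
  have hE := isSymbol_evolSymbol G m
  have hS := isSymbol_expSymbol hm hr
  have hΩ := isSymbol_mul_expSymbol hm hr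
  have hJ := isSymbol_signSymbol G hm
  have h := fourierMultiplier_hasDerivAt (t := t) (C := 2 / r ^ 2)
    (a := fun t => evolSymbol G m t * energySymbol m fun w => Real.exp (-r * w))
    (a' := Complex.I • (evolSymbol G m t * (signSymbol G m *
      energySymbol m fun w => w * Real.exp (-r * w))))
    (.of_forall fun s => (hE s).mul hS)
    (((hE t).mul (hJ.mul hΩ)).smul _) ?_
  · rw [fourierMultiplier_smul ((hE t).mul (hJ.mul hΩ)), fourierMultiplier_mul (hE t) (hJ.mul hΩ),
      fourierMultiplier_mul hJ hΩ] at h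
    simp only [fun s => fourierMultiplier_mul (hE s) hS] at h
    exact h
  · refine .of_forall fun s p => ?_
    have hw := energy_pos hm p
    have hw' : (energy m p : ℂ) ≠ 0 := Complex.ofReal_ne_zero.2 hw.ne'
    have e : signSymbol G m p * energySymbol m (fun w => w * Real.exp (-r * w)) p =
        (Real.exp (-r * energy m p) : ℂ) • G.symbol m p := by
      rw [signSymbol, energySymbol, smul_mul_smul_comm, mul_one, Complex.ofReal_mul,
        inv_mul_cancel_left₀ hw']
    have e' : (evolSymbol G m s * energySymbol m fun w => Real.exp (-r * w)) p -
        (evolSymbol G m t * energySymbol m fun w => Real.exp (-r * w)) p -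
        ((s - t : ℝ) : ℂ) • (Complex.I • (evolSymbol G m t * (signSymbol G m *
          energySymbol m fun w => w * Real.exp (-r * w)))) p =
        (Real.exp (-r * energy m p) : ℂ) • (evolSymbol G m s p - evolSymbol G m t p -
          ((s - t : ℝ) : ℂ) • Complex.I • (evolSymbol G m t p * G.symbol m p)) := by
      simp only [Pi.smul_apply, Pi.mul_apply]
      rw [e]
      simp only [energySymbol, mul_smul_comm, mul_one]
      module
    rw [e', norm_smul, Complex.norm_real, Real.norm_of_nonneg (Real.exp_pos _).le]
    calc _ ≤ Real.exp (-r * energy m p) * (energy m p ^ 2 * (s - t) ^ 2) :=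
          mul_le_mul_of_nonneg_left (evolSymbol_taylor G hm s t p) (Real.exp_pos _).le
      _ = (energy m p ^ 2 * Real.exp (-(r * energy m p))) * (s - t) ^ 2 := by
          rw [neg_mul]; ring
      _ ≤ _ := mul_le_mul_of_nonneg_right (sq_mul_exp_neg_le hr hw.le) (sq_nonneg _)

theorem energyOp_exp_tendsto (f : OneParticle) :
    Tendsto (fun r => (energyOp m fun w => Real.exp (-r * w)) f) (𝓝[>] 0) (𝓝 f) := by
  have h := mulOp_strongly_continuous (M := 1)
    -- Replacing `r` by `|r|` gives a family that is contractive for all real `r`, so the strong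
    -- continuity criterion on `ℝ` applies at `0`.
    (a := fun r ξ => energySymbol m (fun w => Real.exp (-|r| * w)) ((2 * Real.pi) • ξ))
    (fun r ξ => by
      rw [norm_energySymbol, abs_of_pos (Real.exp_pos _), Real.exp_le_one_iff, neg_mul, neg_nonpos]
      exact mul_nonneg (abs_nonneg _) (energy_pos hm _).le)
    (fun r => by
      have := energy_continuous m
      unfold energySymbol
      refine Continuous.smul (Complex.continuous_ofReal.comp ?_) continuous_const
      fun_prop)
    (fun ξ => by
      unfold energySymbol
      refine Continuous.smul (Complex.continuous_ofReal.comp ?_) continuous_const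
      fun_prop) (Lp.fourierTransformₗᵢ Space Spinor f)
  have h1 : Continuous fun r => (energyOp m fun w => Real.exp (-|r| * w)) f :=
    (Lp.fourierTransformₗᵢ Space Spinor).symm.continuous.comp h
  have h2 := (h1.tendsto 0).mono_left (nhdsWithin_le_nhds (s := Set.Ioi 0))
  have h3 : (energyOp m fun w => Real.exp (-|0| * w)) = 1 := by
    rw [energyOp, ← fourierMultiplier_one]
    congr 1
    funext p
    simp [energySymbol]
  rw [h3] at h2
  refine h2.congr' ?_
  filter_upwards [self_mem_nhdsWithin] with r hr
  rw [abs_of_pos hr]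

end

end DiracSwitching

end

/-! ### The Dirac Hamiltonian as a free model, with its weight -/

noncomputable section

namespace DiracSwitching

/-- The free Dirac Hamiltonian as a free model. -/
def diracModel (G : DiracMatrices) {m : ℝ} (hm : 0 < m) : FreeModel OneParticle where
  m := m
  E := freeEvolution G m
  J := fourierMultiplier (signSymbol G m)
  S r := energyOp m fun w => Real.exp (-r * w)
  Ω r := energyOp m fun w => w * Real.exp (-r * w)
  m_pos := hm
  E_zero := by
    rw [← fourierMultiplier_one, ← evolSymbol_zero G m]; rfl
  E_add s t := by
    have h := fourierMultiplier_mul (isSymbol_evolSymbol G m s) (isSymbol_evolSymbol G m t)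
    rw [← evolSymbol_add] at h
    exact h
  E_norm := freeEvolution_norm_le G m
  E_cont := freeEvolution_continuous G m
  J_sq := by
    have hJ := isSymbol_signSymbol G hm
    rw [← fourierMultiplier_mul hJ hJ, ← fourierMultiplier_one]
    congr 1
    funext p
    have hw : (energy m p : ℂ) ≠ 0 := Complex.ofReal_ne_zero.2 (energy_pos hm p).ne'
    rw [Pi.mul_apply, signSymbol, smul_mul_smul_comm, symbol_sq]
    have : ((energy m p : ℂ)⁻¹ * (energy m p : ℂ)⁻¹) * (energy m p : ℂ) ^ 2 = 1 := by
      field_simp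
    refine (smul_smul _ _ _).trans ?_
    rw [this]
    exact one_smul _ _
  J_norm := fourierMultiplier_norm_le zero_le_one fun p => by
    have hw := energy_pos hm p
    rw [signSymbol, norm_smul, norm_symbol G hm, norm_inv, Complex.norm_real,
      Real.norm_of_nonneg hw.le, inv_mul_cancel₀ hw.ne']
  E_J t := fourierMultiplier_commute fun p => (evolSymbol_commute G m t p).smul_right _
  S_J r := fourierMultiplier_commute fun p => energySymbol_commute _ _ _ _
  E_S t r := fourierMultiplier_commute fun p => (energySymbol_commute _ _ _ _).symm
  S_add r s hr hs := by
    have h := fourierMultiplier_mul (isSymbol_expSymbol hm hr) (isSymbol_expSymbol hm hs)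
    rw [energySymbol_mul] at h
    refine Eq.trans ?_ h
    rw [energyOp]
    congr 2
    funext w
    rw [← Real.exp_add]
    congr 1
    ring
  S_norm r hr := energyOp_norm_le (Real.exp_pos _).le fun w hw => by
    rw [abs_of_pos (Real.exp_pos _), Real.exp_le_exp]
    nlinarith
  S_tendsto := energyOp_exp_tendsto hm
  S_deriv r hr := energyOp_exp_hasDerivAt hm hr
  ES_deriv r hr := freeEvolution_mul_exp_hasDerivAt hm G hr

/-- The weight `|D|^{-7/8}`. -/
def diracWeight (G : DiracMatrices) {m : ℝ} (hm : 0 < m) : Weight (diracModel G hm) where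
  -- The exponent has to lie strictly between `3/4` and `1`: its double must exceed `3/2` for square
  -- integrability in three dimensions, and `r^{-7/8}` must be integrable at `0`.
  G := energyOp m fun w => w ^ (-(7 / 8) : ℝ)
  L r := energyOp m fun w => w ^ (7 / 8 : ℝ) * Real.exp (-r * w)
  w r := r ^ (-(7 / 8) : ℝ)
  G_J := fourierMultiplier_commute fun p => energySymbol_commute _ _ _ _
  G_S r := fourierMultiplier_commute fun p => energySymbol_commute _ _ _ _
  G_L r := fourierMultiplier_commute fun p => energySymbol_commute _ _ _ _
  L_G r hr := by
    have h := fourierMultiplier_mul (isSymbol_rpow_mul_expSymbol hm hr)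
      (isSymbol_rpow_neg hm (e := 7 / 8) (by norm_num))
    refine h.symm.trans ?_
    rw [energySymbol_mul]
    change _ = fourierMultiplier _
    congr 1
    funext p
    have hw := Real.rpow_pos_of_pos (energy_pos hm p) (7 / 8)
    have e : energy m p ^ (7 / 8 : ℝ) * Real.exp (-r * energy m p) *
        energy m p ^ (-(7 / 8) : ℝ) = Real.exp (-r * energy m p) := by
      rw [Real.rpow_neg (energy_pos hm p).le]
      field_simp
    rw [energySymbol, e, energySymbol]
  L_norm r hr := energyOp_norm_le (Real.rpow_nonneg hr.le _) fun w hw => by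
    have hw0 : 0 < w := hm.trans_le hw
    rw [abs_of_nonneg (by positivity)]
    exact rpow_mul_exp_neg_le hr hw0
  w_int := by
    have h := integrableOn_rpow_mul_exp_neg_mul_rpow (p := 1) (s := -(7 / 8)) (by norm_num)
      one_pos (b := m) hm
    simp only [Real.rpow_one] at h
    exact h

theorem diracModel_P (G : DiracMatrices) {m : ℝ} (hm : 0 < m) :
    (diracModel G hm).P = posProj G m := by
  have hJ := isSymbol_signSymbol G hm
  have h1 := fourierMultiplier_smul (IsSymbol.one.add hJ) (2⁻¹ : ℂ)
  rw [fourierMultiplier_add IsSymbol.one hJ, fourierMultiplier_one] at h1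
  exact h1.symm

theorem diracWeight_sq (G : DiracMatrices) {m : ℝ} (hm : 0 < m) :
    (diracWeight G hm).G * (diracWeight G hm).G = energyOp m fun w => w ^ (-(7 / 4) : ℝ) := by
  have h := isSymbol_rpow_neg hm (e := 7 / 8) (by norm_num)
  refine (fourierMultiplier_mul h h).symm.trans ?_
  rw [energySymbol_mul]
  change _ = fourierMultiplier _
  congr 1
  funext p
  have e : energy m p ^ (-(7 / 8) : ℝ) * energy m p ^ (-(7 / 8) : ℝ) =
      energy m p ^ (-(7 / 4) : ℝ) := by
    rw [← Real.rpow_add (energy_pos hm p)]; norm_num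
  rw [energySymbol, e, energySymbol]

end DiracSwitching

end

noncomputable section

namespace DiracSwitching

/-! ### Hilbert-Schmidt bounds for `φ(|D|) a(x)` -/

/-- The Fourier transform of an integrable `L²` function is given by the Fourier integral. -/
theorem fourierTransformₗᵢ_ae_eq {f : OneParticle} (hf : Integrable f volume) :
    Lp.fourierTransformₗᵢ Space Spinor f =ᵐ[volume] 𝓕 (f : Space → Spinor) := by
  refine ae_eq_of_integral_contDiff_smul_eq ?_ ?_ fun g hg hgc => ?_
  · exact (Lp.memLp (Lp.fourierTransformₗᵢ Space Spinor f)).locallyIntegrable (by norm_num)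
  · have : Continuous (𝓕 (f : Space → Spinor)) :=
      VectorFourier.fourierIntegral_continuous Real.continuous_fourierChar continuous_inner hf
    exact this.locallyIntegrable
  · have hgc' : HasCompactSupport fun x => (g x : ℂ) := hgc.comp_left (g := fun r : ℝ => (r : ℂ)) rfl
    -- Tested against Schwartz functions, both transforms move the Fourier transform onto the test
    -- function: one by the definition for tempered distributions, the other by Fubini.
    let ψ : SchwartzMap Space ℂ := hgc'.toSchwartzMap (Complex.ofRealCLM.contDiff.comp hg)
    have h1 := congrArg (fun u => u ψ) (Lp.fourier_toTemperedDistribution_eq f)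
    simp only [TemperedDistribution.fourier_apply, Lp.toTemperedDistribution_apply] at h1
    have h2 : ∫ x, g x • (𝓕 (f : Space → Spinor)) x = ∫ x, ψ x • (𝓕 (f : Space → Spinor)) x := rfl
    have h3 : ∫ x, g x • (Lp.fourierTransformₗᵢ Space Spinor f) x =
      ∫ x, ψ x • (𝓕 f : OneParticle) x := rfl
    rw [h2, h3, ← h1]
    exact (VectorFourier.integral_fourierIntegral_smul_eq_flip (μ := volume) (ν := volume)
      (L := innerₗ Space) Real.continuous_fourierChar continuous_inner ψ.integrable hf).trans
      (by rw [flip_innerₗ]; rfl)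

theorem enorm_sq_eq_lintegral (f : OneParticle) : ‖f‖ₑ ^ 2 = ∫⁻ x, ‖f x‖ₑ ^ 2 := by
  rw [Lp.enorm_def, eLpNorm_eq_lintegral_rpow_enorm_toReal (by norm_num) (by norm_num),
    ← ENNReal.rpow_natCast, ← ENNReal.rpow_mul]
  norm_num

/-- The integrand is bounded by a constant times `(1 + |ξ|²)^{-7/4}`, and `7/2 > 3`. -/
theorem lintegral_energy_lt_top {m : ℝ} (hm : 0 < m) :
    ∫⁻ ξ : Space, ENNReal.ofReal (energy m ((2 * Real.pi) • ξ) ^ (-(7 / 4) : ℝ)) ^ 2 < ⊤ := by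
  set c := min (m ^ 2) 1 with hc
  have hc0 : 0 < c := lt_min (by positivity) one_pos
  have hint := (integrable_rpow_neg_one_add_norm_sq (E := Space) (μ := volume) (r := 7 / 2)
    (by rw [finrank_euclideanSpace_fin]; norm_num)).const_mul (c ^ (-(7 / 4) : ℝ))
  refine lt_of_le_of_lt (lintegral_mono fun ξ => ?_) hint.lintegral_lt_top
  rw [← ENNReal.ofReal_pow (Real.rpow_nonneg (energy_pos hm _).le _)]
  refine ENNReal.ofReal_le_ofReal ?_
  have hw := energy_pos hm ((2 * Real.pi) • ξ)
  have e1 : (energy m ((2 * Real.pi) • ξ) ^ (-(7 / 4) : ℝ)) ^ 2 =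
      (energy m ((2 * Real.pi) • ξ) ^ 2) ^ (-(7 / 4) : ℝ) := by
    rw [← Real.rpow_natCast, ← Real.rpow_natCast, ← Real.rpow_mul hw.le, ← Real.rpow_mul hw.le]
    congr 1
    exact mul_comm _ _
  have e2 : c * (1 + ‖ξ‖ ^ 2) ≤ energy m ((2 * Real.pi) • ξ) ^ 2 := by
    rw [energy, Real.sq_sqrt (by positivity), norm_smul, mul_pow, Real.norm_of_nonneg (by positivity)]
    have h1 : c ≤ m ^ 2 := min_le_left _ _
    have h2 : c ≤ 1 := min_le_right _ _
    have h3 : 1 ≤ (2 * Real.pi) ^ 2 := by nlinarith [Real.pi_gt_three]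
    nlinarith [sq_nonneg ‖ξ‖, mul_le_mul_of_nonneg_right (h2.trans h3) (sq_nonneg ‖ξ‖)]
  rw [e1, show (-(7 / 2) / 2 : ℝ) = -(7 / 4) by norm_num,
    ← Real.mul_rpow hc0.le (by positivity)]
  exact Real.rpow_le_rpow_of_nonpos (by positivity) e2 (by norm_num)


theorem mulOp_coeFn_of_continuous {a : Space → SpinorOp} (ha : Continuous a)
    (hac : HasCompactSupport a) (f : OneParticle) : mulOp a f =ᵐ[volume] fun x => a x (f x) := by
  obtain ⟨C, hC⟩ := hac.exists_bound_of_continuous ha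
  exact mulOp_coeFn (IsSymbol.memLp ⟨ha, C, hC⟩) f

theorem integrable_mulOp {a : Space → SpinorOp} (ha : Continuous a) (hac : HasCompactSupport a)
    (f : OneParticle) : Integrable (mulOp a f : Space → Spinor) volume := by
  have h1 : MemLp (fun x => a x (f x)) 1 volume := by
    refine (Lp.memLp f).of_bilin (p := 2) (q := 2) (r := 1) (fun v (X : SpinorOp) => X v) 1
      (ha.memLp_of_hasCompactSupport hac) ?_ (ae_of_all _ fun x => ?_)
    · exact (ContinuousLinearMap.id ℂ SpinorOp).aestronglyMeasurable_comp₂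
        ha.aestronglyMeasurable (Lp.aestronglyMeasurable f)
    · rw [one_mul, mul_comm]
      exact (a x).le_opNNNorm _
  exact (memLp_one_iff_integrable.1 h1).congr (mulOp_coeFn_of_continuous ha hac f).symm

/-- The function `x ↦ e^{2πi x·ξ} a(x)^* ε_k`. -/
def fourierColumn (a : Space → SpinorOp) (ξ : Space) (k : Fin 4) (x : Space) : Spinor :=
  (Real.fourierChar (inner ℝ x ξ) : ℂ) • ContinuousLinearMap.adjoint (a x) (EuclideanSpace.single k 1)

theorem fourierColumn_memLp {a : Space → SpinorOp} (ha : Continuous a) (hac : HasCompactSupport a)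
    (ξ : Space) (k : Fin 4) : MemLp (fourierColumn a ξ k) 2 volume := by
  refine Continuous.memLp_of_hasCompactSupport ?_ ?_
  · refine Continuous.smul (continuous_subtype_val.comp (Real.continuous_fourierChar.comp
      (f := fun x : Space => inner ℝ x ξ) (by fun_prop))) ?_
    exact (ContinuousLinearMap.adjoint.continuous.comp ha).clm_apply continuous_const
  · refine hac.mono fun x hx => ?_
    contrapose! hx
    simp only [Function.mem_support, not_not] at hx ⊢
    rw [fourierColumn, hx]
    simp

/-- For fixed `ξ` and `k` this is a bounded functional of `f`. Its representing vector is in `L²`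
because `a` is continuous with compact support, which makes Bessel's inequality available. -/
theorem fourier_mulOp_apply {a : Space → SpinorOp} (ha : Continuous a) (hac : HasCompactSupport a)
    (f : OneParticle) (ξ : Space) (k : Fin 4) :
    𝓕 (mulOp a f : Space → Spinor) ξ k =
      inner ℂ ((fourierColumn_memLp ha hac ξ k).toLp _) f := by
  have hi := integrable_mulOp ha hac f
  rw [Real.fourier_eq, L2.inner_def]
  have h1 : Integrable (fun x => Real.fourierChar (-inner ℝ x ξ) • (mulOp a f) x) volume :=
    (Real.fourierIntegral_convergent_iff ξ).2 hi
  have h2 := ((EuclideanSpace.proj (𝕜 := ℂ) k : Spinor →L[ℂ] ℂ).integral_comp_comm h1).symm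
  refine h2.trans (integral_congr_ae ?_)
  filter_upwards [mulOp_coeFn_of_continuous ha hac f,
    (fourierColumn_memLp ha hac ξ k).coeFn_toLp] with x e1 e2
  rw [e1, e2, fourierColumn, inner_smul_left, ContinuousLinearMap.adjoint_inner_left,
    EuclideanSpace.inner_single_left, map_one, one_mul, ← Circle.coe_inv_eq_conj,
    ← AddChar.map_neg_eq_inv]
  rfl

theorem norm_fourierColumn_sq_le {a : Space → SpinorOp} (ha : Continuous a)
    (hac : HasCompactSupport a) {S : Set Space} (hS : IsCompact S) (haS : tsupport a ⊆ S) {B : ℝ}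
    (hB : ∀ x, ‖a x‖ ≤ B) (ξ : Space) (k : Fin 4) :
    ‖(fourierColumn_memLp ha hac ξ k).toLp _‖ ^ 2 ≤ B ^ 2 * (volume S).toReal := by
  have hB0 : 0 ≤ B := (norm_nonneg _).trans (hB 0)
  have h1 : ‖(fourierColumn_memLp ha hac ξ k).toLp _‖ₑ ^ 2 ≤
      ENNReal.ofReal (B ^ 2) * volume S := by
    rw [enorm_sq_eq_lintegral, ← setLIntegral_const, ← lintegral_indicator hS.measurableSet]
    refine lintegral_mono_ae ?_
    filter_upwards [(fourierColumn_memLp ha hac ξ k).coeFn_toLp] with x e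
    rw [e, fourierColumn]
    by_cases hx : x ∈ S
    · rw [Set.indicator_of_mem hx, ← ofReal_norm, ← ENNReal.ofReal_pow (norm_nonneg _)]
      refine ENNReal.ofReal_le_ofReal (pow_le_pow_left₀ (norm_nonneg _) ?_ 2)
      rw [norm_smul, Circle.norm_coe, one_mul]
      refine (ContinuousLinearMap.le_opNorm _ _).trans ?_
      rw [LinearIsometryEquiv.norm_map]
      simpa using hB x
    · have : a x = 0 := image_eq_zero_of_notMem_tsupport fun h => hx (haS h)
      rw [this]
      simp
  rw [← ofReal_norm, ← ENNReal.ofReal_pow (norm_nonneg _),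
    ← ENNReal.ofReal_toReal hS.measure_ne_top, ← ENNReal.ofReal_mul (sq_nonneg _)] at h1
  exact (ENNReal.ofReal_le_ofReal_iff (by positivity)).1 h1

/-- Bessel's inequality is applied to each of the four spinor components, hence the factor `4`; the
bound does not depend on `ξ`. -/
theorem sum_norm_fourier_mulOp_sq_le {ι : Type*} (b : HilbertBasis ι ℂ OneParticle)
    {a : Space → SpinorOp} (ha : Continuous a)
    (hac : HasCompactSupport a) {S : Set Space} (hS : IsCompact S) (haS : tsupport a ⊆ S) {B : ℝ}
    (hB : ∀ x, ‖a x‖ ≤ B) (ξ : Space) (s : Finset ι) :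
    ∑ i ∈ s, ‖𝓕 (mulOp a (b i) : Space → Spinor) ξ‖ ^ 2 ≤ 4 * (B ^ 2 * (volume S).toReal) := by
  simp only [EuclideanSpace.norm_sq_eq, fourier_mulOp_apply ha hac]
  rw [Finset.sum_comm]
  refine (Finset.sum_le_card_nsmul _ _ (B ^ 2 * (volume S).toReal) fun k _ => ?_).trans
    (by simp)
  refine le_trans (le_of_eq ?_) ((b.orthonormal.sum_inner_products_le _ (s := s)).trans
    (norm_fourierColumn_sq_le ha hac hS haS hB ξ k))
  exact Finset.sum_congr rfl fun i _ => by rw [norm_inner_symm]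

theorem enorm_energyOp_mulOp_sq {m : ℝ} (hm : 0 < m) {a : Space → SpinorOp} (ha : Continuous a)
    (hac : HasCompactSupport a) (f : OneParticle) :
    ‖(energyOp m (fun w => w ^ (-(7 / 4) : ℝ)) * mulOp a) f‖ₑ ^ 2 =
      ∫⁻ ξ : Space, ENNReal.ofReal (energy m ((2 * Real.pi) • ξ) ^ (-(7 / 4) : ℝ)) ^ 2 *
        ENNReal.ofReal (‖𝓕 (mulOp a f : Space → Spinor) ξ‖ ^ 2) := by
  rw [mul_apply_eq_comp, energyOp, fourierMultiplier_apply, LinearIsometryEquiv.enorm_map,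
    enorm_sq_eq_lintegral]
  refine lintegral_congr_ae ?_
  filter_upwards [mulOp_coeFn (isSymbol_rpow_neg hm (e := 7 / 4) (by norm_num)).scale.memLp
    (Lp.fourierTransformₗᵢ Space Spinor (mulOp a f)),
    fourierTransformₗᵢ_ae_eq (integrable_mulOp ha hac f)] with ξ h1 h2
  rw [h1, h2, energySymbol, _root_.smul_apply, enorm_smul, mul_pow, ENNReal.ofReal_pow (norm_nonneg _),
    ofReal_norm, ← ofReal_norm (Complex.ofReal _), Complex.norm_real,
    Real.norm_of_nonneg (Real.rpow_nonneg (energy_pos hm _).le _)]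
  rfl

/-- The constant in the Hilbert-Schmidt bound for `|D|^{-7/4} a(x)`. -/
def cutoffConst (m : ℝ) (S : Set Space) : ℝ :=
  Real.sqrt (4 * (volume S).toReal * (∫⁻ ξ : Space,
    ENNReal.ofReal (energy m ((2 * Real.pi) • ξ) ^ (-(7 / 4) : ℝ)) ^ 2).toReal)

/-- By Plancherel, the sum over the basis becomes a momentum integral of `ω^{-7/2}` against a sum
that is bounded uniformly in `ξ`. -/
theorem hsLe_energyOp_mulOp {ι : Type*} (b : HilbertBasis ι ℂ OneParticle) {m : ℝ} (hm : 0 < m)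
    {a : Space → SpinorOp} (ha : Continuous a)
    (hac : HasCompactSupport a) {S : Set Space} (hS : IsCompact S) (haS : tsupport a ⊆ S) {B : ℝ}
    (hB : ∀ x, ‖a x‖ ≤ B) :
    HSLe b (energyOp m (fun w => w ^ (-(7 / 4) : ℝ)) * mulOp a) (B * cutoffConst m S) := by
  have hB0 : 0 ≤ B := (norm_nonneg _).trans (hB 0)
  have hK : 0 ≤ B * cutoffConst m S := mul_nonneg hB0 (Real.sqrt_nonneg _)
  rw [hsLe_iff_tsum hK, ENNReal.tsum_eq_iSup_sum]
  refine iSup_le fun s => ?_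
  simp only [enorm_energyOp_mulOp_sq hm ha hac]
  have hm1 : Measurable fun ξ : Space =>
      ENNReal.ofReal (energy m ((2 * Real.pi) • ξ) ^ (-(7 / 4) : ℝ)) ^ 2 := by
    have : Measurable fun ξ : Space => energy m ((2 * Real.pi) • ξ) :=
      ((energy_continuous m).comp (continuous_const_smul _)).measurable
    fun_prop
  rw [← lintegral_finsetSum']
  · calc _ ≤ ∫⁻ ξ : Space, ENNReal.ofReal (energy m ((2 * Real.pi) • ξ) ^ (-(7 / 4) : ℝ)) ^ 2 *
          ENNReal.ofReal (4 * (B ^ 2 * (volume S).toReal)) := by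
          refine lintegral_mono fun ξ => ?_
          rw [← Finset.mul_sum, ← ENNReal.ofReal_sum_of_nonneg fun _ _ => sq_nonneg _]
          exact mul_le_mul_right (ENNReal.ofReal_le_ofReal
            (sum_norm_fourier_mulOp_sq_le b ha hac hS haS hB ξ s)) _
      _ = _ := by
          rw [lintegral_mul_const _ hm1,
            ← ENNReal.ofReal_toReal (lintegral_energy_lt_top hm).ne,
            ← ENNReal.ofReal_mul ENNReal.toReal_nonneg, ← ENNReal.ofReal_pow hK, cutoffConst, mul_pow,
            Real.sq_sqrt (by positivity)]
          congr 1
          ring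
  · intro i _
    have hc : Continuous (𝓕 (mulOp a (b i) : Space → Spinor)) :=
      VectorFourier.fourierIntegral_continuous Real.continuous_fourierChar continuous_inner
        (integrable_mulOp ha hac (b i))
    exact (hm1.mul (by fun_prop)).aemeasurable

/-- Fourier inversion bounds the supremum by the `L¹` norm of the transform. -/
theorem norm_le_of_eLpNorm_fourier {a : Space → SpinorOp} (ha : Continuous a)
    (hac : HasCompactSupport a) {B : ℝ} (hB : 0 ≤ B)
    (h : eLpNorm (𝓕 a) 1 volume ≤ ENNReal.ofReal B) (x : Space) : ‖a x‖ ≤ B := by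
  have hi : Integrable a volume := ha.integrable_of_hasCompactSupport hac
  have hc : Continuous (𝓕 a) :=
    VectorFourier.fourierIntegral_continuous Real.continuous_fourierChar continuous_inner hi
  have hi' : Integrable (𝓕 a) volume :=
    memLp_one_iff_integrable.1 ⟨hc.aestronglyMeasurable, h.trans_lt ENNReal.ofReal_lt_top⟩
  rw [← ha.fourierInv_fourier_eq hi hi', Real.fourierInv_eq]
  refine (norm_integral_le_integral_norm _).trans ?_
  simp only [Circle.norm_smul]
  rw [integral_norm_eq_lintegral_enorm hc.aestronglyMeasurable, ← eLpNorm_one_eq_lintegral_enorm]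
  exact ENNReal.toReal_le_of_le_ofReal hB h

end DiracSwitching

end

noncomputable section

namespace DiracSwitching

/-! ### The Dyson series -/

/-- Bounded, strongly continuous, self-adjoint operators which vanish at early times. -/
structure IsPerturbation (B : ℝ → Op OneParticle) (M ε : ℝ) : Prop where
  pos : 0 < M
  norm_le : ∀ t, ‖B t‖ ≤ M
  cont : ∀ f, Continuous fun t => B t f
  early : ∀ t, t < -ε → B t = 0
  selfAdjoint : ∀ t, ContinuousLinearMap.adjoint (B t) = B t

/-- The sum of the Dyson series. -/
def dysonSum (B : ℝ → Op OneParticle) (t : ℝ) : Op OneParticle := ∑' n, dysonTerm B n t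

namespace IsPerturbation

variable {B : ℝ → Op OneParticle} {M ε : ℝ}

theorem mono (hB : IsPerturbation B M ε) {ε' : ℝ} (h : ε ≤ ε') : IsPerturbation B M ε' :=
  ⟨hB.pos, hB.norm_le, hB.cont, fun t ht => hB.early t (by linarith), hB.selfAdjoint⟩

theorem strongCont (hB : IsPerturbation B M ε) : StrongCont B :=
  ⟨fun _ => .of_le hB.norm_le, hB.cont⟩

theorem summable (hB : IsPerturbation B M ε) (t : ℝ) : Summable fun n => dysonTerm B n t := by
  -- The geometric bounds hold only from time `-ε` on; enlarging `ε` makes them available at any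
  -- `t`.
  have h := hB.mono (le_max_left ε (-t))
  exact (dyson_summable h.pos h.norm_le h.cont h.early t).1 t
    ⟨by linarith [le_max_right ε (-t)], le_rfl⟩

theorem continuous_dysonSum (hB : IsPerturbation B M ε) : Continuous (dysonSum B) := by
  refine continuous_iff_continuousAt.2 fun t => ?_
  have h := hB.mono (le_max_left ε (-t + 1))
  refine (dyson_summable h.pos h.norm_le h.cont h.early (t + 1)).2.continuousAt
    (Icc_mem_nhds ?_ (by linarith))
  linarith [le_max_right ε (-t + 1)]

theorem dysonTerm_hasDerivAt (hB : IsPerturbation B M ε) (n : ℕ) (f : OneParticle) (t : ℝ) :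
    HasDerivAt (fun s => dysonTerm B (n + 1) s f) (Complex.I • dysonTerm B n t (B t f)) t := by
  have hc : Continuous fun s => dysonTerm B n s (B s f) :=
    (dysonTerm_bound hB.pos hB.norm_le hB.cont hB.early n).1.clm_apply (hB.cont f)
  have hs := dysonTerm_succ_apply hB.pos hB.norm_le hB.cont hB.early n
  have h1 : (fun s => dysonTerm B (n + 1) s f) = fun s =>
      dysonTerm B (n + 1) t f + Complex.I • ∫ r in t..s, dysonTerm B n r (B r f) := by
    funext s
    rw [(hs s f).2, (hs t f).2, ← smul_add,
      ← intervalIntegral.integral_Iic_sub_Iic (hs t f).1 (hs s f).1, add_sub_cancel]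
  rw [h1]
  exact ((hc.integral_hasStrictDerivAt t t).hasDerivAt.const_smul Complex.I).const_add _

theorem dysonSum_apply (hB : IsPerturbation B M ε) (t : ℝ) (f : OneParticle) :
    HasSum (fun n => dysonTerm B n t f) (dysonSum B t f) :=
  (hB.summable t).hasSum.mapL (ContinuousLinearMap.apply ℂ OneParticle f)

/-- The series is differentiated term by term on an open interval around `t`, where the geometric
bounds dominate the derivatives. As `B` is only strongly continuous, the derivative is a strong one.
-/
theorem dysonSum_strongDerivAt (hB : IsPerturbation B M ε) (t : ℝ) :
    StrongDerivAt (dysonSum B) (Complex.I • (dysonSum B t * B t)) t := by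
  refine ⟨.of_tendsto (hB.continuous_dysonSum.tendsto t), fun f => ?_⟩
  have h := hB.mono (le_max_left ε (-t + 1))
  set ε' := max ε (-t + 1)
  have hε : -t + 1 ≤ ε' := le_max_right _ _
  -- The zeroth term is constant, and the derivative of term `n + 1` involves term `n`; the shift in
  -- the index turns the sum of derivatives back into the Dyson sum.
  set g' : ℕ → ℝ → OneParticle := fun n s =>
    n.casesOn 0 fun k => Complex.I • dysonTerm B k s (B s f)
  have hu : Summable fun n : ℕ => (n.casesOn 0 fun k =>
      (1 / 2 : ℝ) ^ k * (Real.exp (2 * M * (t + 1 + ε')) * (M * ‖f‖)) : ℝ) := by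
    rw [← summable_nat_add_iff 1]
    exact (summable_geometric_of_lt_one (by norm_num) (by norm_num)).mul_right _
  have h1 := hasDerivAt_tsum_of_isPreconnected (g := fun n s => dysonTerm B n s f) (g' := g')
    (y₀ := t) (y := t) hu isOpen_Ioo (isPreconnected_Ioo (a := -ε') (b := t + 1))
    (fun n s _ => ?_) (fun n s hs => ?_) ⟨by linarith, by linarith⟩ (hB.dysonSum_apply t f).summable
    ⟨by linarith, by linarith⟩
  · have e1 : (fun s => ∑' n, dysonTerm B n s f) = fun s => dysonSum B s f :=
      funext fun s => (hB.dysonSum_apply s f).tsum_eq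
    have e2 : ∑' n, g' n t = (Complex.I • (dysonSum B t * B t)) f := by
      have h2 := (hB.dysonSum_apply t (B t f)).const_smul Complex.I
      have h3 : HasSum (fun n => g' n t) (g' 0 t + Complex.I • dysonSum B t (B t f)) :=
        HasSum.zero_add h2
      rw [h3.tsum_eq]
      exact zero_add _
    rwa [e1, e2] at h1
  · cases n with
    | zero => exact hasDerivAt_const _ _
    | succ n => exact hB.dysonTerm_hasDerivAt n f s
  · cases n with
    | zero => simp [g']
    | succ n =>
      change ‖Complex.I • dysonTerm B n s (B s f)‖ ≤ _ ^ n * _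
      rw [norm_smul, Complex.norm_I, one_mul, ← mul_assoc]
      have h4 := (dysonTerm_bound h.pos h.norm_le h.cont h.early n).2 s hs.1.le
      refine (ContinuousLinearMap.le_of_opNorm_le _ h4 _).trans ?_
      have h5 : Real.exp (2 * M * (s + ε')) ≤ Real.exp (2 * M * (t + 1 + ε')) := by
        have := hB.pos
        gcongr
        exact hs.2.le
      have h6 := ContinuousLinearMap.le_of_opNorm_le _ (hB.norm_le s) f
      gcongr

theorem dysonSum_early (hB : IsPerturbation B M ε) : dysonSum B (-ε) = 1 := by
  ext1 f
  have h1 : ∀ n, dysonTerm B (n + 1) (-ε) f = 0 := by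
    intro n
    rw [(dysonTerm_succ_apply hB.pos hB.norm_le hB.cont hB.early n (-ε) f).2,
      integral_Iic_eq_integral_Iio, setIntegral_eq_zero_of_forall_eq_zero, smul_zero]
    intro s hs
    rw [hB.early s hs, _root_.zero_apply, map_zero]
  refine (hB.dysonSum_apply (-ε) f).unique ?_
  exact hasSum_single 0 fun n hn => by
    obtain ⟨k, rfl⟩ := Nat.exists_eq_succ_of_ne_zero hn
    exact h1 k

/-- The adjoint of the Dyson series solves the adjoint equation. -/
theorem adjoint_dysonSum_strongDerivAt (hB : IsPerturbation B M ε) (t : ℝ) :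
    StrongDerivAt (fun s => ContinuousLinearMap.adjoint (dysonSum B s))
      (-(Complex.I • (B t * ContinuousLinearMap.adjoint (dysonSum B t)))) t := by
  have hV : Continuous fun s => ContinuousLinearMap.adjoint (dysonSum B s) :=
    ContinuousLinearMap.adjoint.continuous.comp hB.continuous_dysonSum
  have hF : StrongCont fun s =>
      -(Complex.I • (B s * ContinuousLinearMap.adjoint (dysonSum B s))) :=
    ((hB.strongCont.mul (.of_continuous hV)).const_smul _).neg
  refine ⟨.of_tendsto (hV.tendsto t), fun f => ?_⟩
  have hW : StrongCont fun s => Complex.I • (dysonSum B s * B s) :=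
    ((StrongCont.of_continuous hB.continuous_dysonSum).mul hB.strongCont).const_smul _
  -- Adjoints do not preserve strong differentiability in general. The integrated equation is
  -- obtained by testing against `g`, where the adjoint can be moved across, and then differentiated
  -- by strong continuity of its integrand.
  have key : ∀ s, ContinuousLinearMap.adjoint (dysonSum B s) f =
      ContinuousLinearMap.adjoint (dysonSum B t) f + ∫ r in t..s,
        (-(Complex.I • (B r * ContinuousLinearMap.adjoint (dysonSum B r)))) f := by
    intro s
    refine ext_inner_left ℂ fun g => ?_
    have h1 := hW.integral_eq_sub (fun r => hB.dysonSum_strongDerivAt r) t s g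
    have h2 : inner ℂ (dysonSum B s g) f = inner ℂ (dysonSum B t g) f +
        inner ℂ (∫ r in t..s, (Complex.I • (dysonSum B r * B r)) g) f := by
      have h1' : dysonSum B s g = dysonSum B t g +
        ∫ r in t..s, (Complex.I • (dysonSum B r * B r)) g := eq_add_of_sub_eq' h1.symm
      rw [h1', inner_add_left]
    rw [ContinuousLinearMap.adjoint_inner_right, inner_add_right,
      ContinuousLinearMap.adjoint_inner_right, h2]
    congr 1
    have h3 := ((innerSL ℂ g).intervalIntegral_comp_comm ((hF.cont f).intervalIntegrable (μ := volume) t s))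
    have h4 := ((innerSL ℂ f).intervalIntegral_comp_comm ((hW.cont g).intervalIntegrable (μ := volume) t s))
    rw [innerSL_apply_apply] at h3 h4
    rw [← inner_conj_symm, ← h4, ← h3, ← intervalIntegral.intervalIntegral_conj]
    refine intervalIntegral.integral_congr fun r _ => ?_
    simp only [innerSL_apply_apply, inner_conj_symm, _root_.smul_apply, _root_.neg_apply,
      mul_apply_eq_comp]
    rw [inner_smul_left, inner_neg_right, inner_smul_right, ← hB.selfAdjoint r,
      ContinuousLinearMap.adjoint_inner_right, ContinuousLinearMap.adjoint_inner_right,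
      hB.selfAdjoint r]
    simp
  rw [funext key]
  exact ((hF.cont f).integral_hasStrictDerivAt t t).hasDerivAt.const_add _

/-- The two terms of the derivative cancel, so the product keeps its value at time `-ε`. -/
theorem dysonSum_mul_adjoint (hB : IsPerturbation B M ε) (t : ℝ) :
    dysonSum B t * ContinuousLinearMap.adjoint (dysonSum B t) = 1 := by
  have h1 : ∀ s, StrongDerivAt (fun s => dysonSum B s *
      ContinuousLinearMap.adjoint (dysonSum B s)) 0 s := fun s =>
    ((hB.dysonSum_strongDerivAt s).mul (hB.adjoint_dysonSum_strongDerivAt s)).congr_deriv (by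
      rw [mul_neg, smul_mul_assoc, mul_smul_comm, mul_assoc, add_neg_cancel])
  ext1 f
  have h2 := (StrongCont.const (0 : Op OneParticle)).integral_eq_sub h1 (-ε) t f
  simp only [_root_.zero_apply, intervalIntegral.integral_zero] at h2
  rw [sub_eq_zero.1 h2.symm, hB.dysonSum_early]
  have : ContinuousLinearMap.adjoint (1 : Op OneParticle) = 1 := star_one _
  rw [this, mul_one]

/-- Given `V V* = 1`, the relation `V* V = 1` is equivalent to invertibility of `V`. The set of such
times is closed as the solution set of an equation, open because units are open, and contains `-ε`;
connectedness of `ℝ` concludes. -/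
theorem adjoint_mul_dysonSum (hB : IsPerturbation B M ε) (t : ℝ) :
    ContinuousLinearMap.adjoint (dysonSum B t) * dysonSum B t = 1 := by
  set s := {t | ContinuousLinearMap.adjoint (dysonSum B t) * dysonSum B t = 1}
  have hV : Continuous fun s => ContinuousLinearMap.adjoint (dysonSum B s) :=
    ContinuousLinearMap.adjoint.continuous.comp hB.continuous_dysonSum
  have h1 : s = (dysonSum B) ⁻¹' {X | IsUnit X} := by
    ext r
    refine ⟨fun h => ⟨⟨_, _, hB.dysonSum_mul_adjoint r, h⟩, rfl⟩, fun h => ?_⟩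
    obtain ⟨u, hu⟩ := h
    have h2 := hB.dysonSum_mul_adjoint r
    rw [← hu] at h2
    have h3 := u.inv_eq_of_mul_eq_one_right h2
    change ContinuousLinearMap.adjoint (dysonSum B r) * dysonSum B r = 1
    rw [← hu, ← h3, u.inv_mul]
  have h2 : IsClopen s := by
    refine ⟨isClosed_eq (hV.mul hB.continuous_dysonSum) continuous_const, ?_⟩
    rw [h1]
    exact Units.isOpen.preimage hB.continuous_dysonSum
  have h3 : (-ε) ∈ s := by
    change ContinuousLinearMap.adjoint (dysonSum B (-ε)) * dysonSum B (-ε) = 1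
    rw [hB.dysonSum_early, mul_one]
    exact star_one _
  have h4 : t ∈ s := by
    rw [h2.eq_univ ⟨_, h3⟩]
    trivial
  exact h4

theorem norm_dysonSum_le (hB : IsPerturbation B M ε) (t : ℝ) : ‖dysonSum B t‖ ≤ 1 := by
  have h := CStarRing.norm_self_mul_star (x := dysonSum B t)
  have h2 : dysonSum B t * star (dysonSum B t) = 1 := hB.dysonSum_mul_adjoint t
  rw [h2] at h
  have h3 : ‖(1 : Op OneParticle)‖ ≤ 1 := ContinuousLinearMap.norm_id_le
  nlinarith [norm_nonneg (dysonSum B t)]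

end IsPerturbation

/-! ### The propagator of a switched potential -/

theorem slash_selfAdjoint (G : DiracMatrices) (a : Fin 4 → ℝ) :
    ContinuousLinearMap.adjoint (G.slash a) = G.slash a := by
  change IsSelfAdjoint (G.slash a)
  rw [DiracMatrices.slash]
  refine IsSelfAdjoint.map ?_ _
  rw [isSelfAdjoint_iff, Matrix.star_eq_conjTranspose]
  simp [Matrix.conjTranspose_add, Matrix.conjTranspose_sum, Matrix.conjTranspose_smul,
    (G.α_hermitian _).eq]

theorem slash_smul (G : DiracMatrices) (r : ℝ) (a : Fin 4 → ℝ) :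
    G.slash (fun μ => r * a μ) = (r : ℂ) • G.slash a := by
  simp only [DiracMatrices.slash, ← map_smul, smul_add, Finset.smul_sum, smul_smul,
    Complex.ofReal_mul]

theorem slash_zero (G : DiracMatrices) : G.slash 0 = 0 := by
  simp [DiracMatrices.slash]

theorem adjoint_mulOp {a : Space → SpinorOp} (ha : MemLp a ⊤ (volume : Measure Space))
    (h : ∀ x, ContinuousLinearMap.adjoint (a x) = a x) :
    ContinuousLinearMap.adjoint (mulOp a) = mulOp a := by
  refine ((ContinuousLinearMap.eq_adjoint_iff _ _).2 fun f g => ?_).symm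
  rw [L2.inner_def, L2.inner_def]
  refine integral_congr_ae ?_
  filter_upwards [mulOp_coeFn ha f, mulOp_coeFn ha g] with x h1 h2
  rw [h1, h2, ← ContinuousLinearMap.adjoint_inner_left, h]

/-- An invertible contraction whose inverse is also a contraction is isometric, so its adjoint is
its inverse. -/
theorem adjoint_freeEvolution (G : DiracMatrices) {m : ℝ} (hm : 0 < m) (t : ℝ) :
    ContinuousLinearMap.adjoint (freeEvolution G m t) = freeEvolution G m (-t) := by
  have h1 : freeEvolution G m (-t) * freeEvolution G m t = 1 := (diracModel G hm).E_neg_mul t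
  have h2 : freeEvolution G m t * freeEvolution G m (-t) = 1 := (diracModel G hm).E_mul_neg t
  have h3 : ContinuousLinearMap.adjoint (freeEvolution G m t) * freeEvolution G m t = 1 := by
    refine (ContinuousLinearMap.norm_map_iff_adjoint_comp_self _).1 fun f => ?_
    refine le_antisymm ?_ ?_
    · simpa using ContinuousLinearMap.le_of_opNorm_le _ (freeEvolution_norm_le G m t) f
    · have h4 := ContinuousLinearMap.le_of_opNorm_le _ (freeEvolution_norm_le G m (-t))
        (freeEvolution G m t f)
      rwa [← mul_apply_eq_comp, h1, one_mul] at h4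
  calc _ = ContinuousLinearMap.adjoint (freeEvolution G m t) *
        (freeEvolution G m t * freeEvolution G m (-t)) := by rw [h2, mul_one]
    _ = _ := by rw [← mul_assoc, h3, one_mul]

/-- The perturbation `h(s/T) e^{isD} A e^{-isD}`. -/
theorem interactionPicture_smul (G : DiracMatrices) {m : ℝ} (hm : 0 < m) {A : Space → Fin 4 → ℝ}
    (hA : Continuous A) (hAc : HasCompactSupport A) (B : TimePotential) (s r : ℝ)
    (hB : B s = fun x μ => r * A x μ) :
    interactionPicture G m B s =
      (r : ℂ) • (diracModel G hm).conj s (mulOp fun x => G.slash (A x)) := by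
  have ha : IsSymbol fun x => G.slash (A x) :=
    ⟨(slash_continuous G).comp hA, (hAc.comp_left (g := G.slash)
      (slash_zero G)).exists_bound_of_continuous ((slash_continuous G).comp hA)⟩
  have h1 : slashOp G B s = (r : ℂ) • mulOp fun x => G.slash (A x) := by
    rw [← mulOp_smul ha.memLp _ (ha.smul _).memLp, slashOp, hB]
    congr 1
    funext x
    exact slash_smul G r (A x)
  rw [interactionPicture, h1]
  change freeEvolution G m s * ((r : ℂ) • (mulOp fun x => G.slash (A x)) * freeEvolution G m (-s)) =
    (r : ℂ) • (freeEvolution G m s * (mulOp fun x => G.slash (A x)) * freeEvolution G m (-s))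
  rw [smul_mul_assoc, mul_smul_comm, mul_assoc]

theorem isPerturbation_switched (G : DiracMatrices) {m : ℝ} (hm : 0 < m) {A : Space → Fin 4 → ℝ}
    (hA : Continuous A) (hAc : HasCompactSupport A) {h : ℝ → ℝ} (hh : Continuous h)
    (h0 : ∀ t, t < -1 → h t = 0) (hle : ∀ t, |h t| ≤ 1) {T : ℝ} (hT : 0 < T) :
    ∃ M, IsPerturbation (interactionPicture G m (switched h T A)) M T := by
  obtain ⟨C, hC⟩ := (hAc.comp_left (g := G.slash)
    (slash_zero G)).exists_bound_of_continuous ((slash_continuous G).comp hA)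
  have ha : IsSymbol fun x => G.slash (A x) := ⟨(slash_continuous G).comp hA, C, hC⟩
  have e : ∀ t x, switched h T A t x = fun μ => h (t / T) * A x μ := fun _ _ => rfl
  have hI : ∀ s, interactionPicture G m (switched h T A) s = _ := fun s =>
    interactionPicture_smul G hm hA hAc (switched h T A) s (h (s / T)) rfl
  have hb : ∀ t x, ‖G.slash (switched h T A t x)‖ ≤ |C| + 1 := by
    intro t x
    rw [e, slash_smul, norm_smul, Complex.norm_real, Real.norm_eq_abs]
    have h1 : ‖G.slash (A x)‖ ≤ |C| + 1 := (hC x).trans ((le_abs_self C).trans (by linarith))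
    exact (mul_le_of_le_one_left (norm_nonneg _) (hle _)).trans h1
  have hsp := interactionPicture_spec G m hb (fun t => by
      rw [funext (e t)]; fun_prop) (fun x => by
      simp only [e]; fun_prop)
  refine ⟨|C| + 1, by positivity, hsp.1, hsp.2, fun t ht => ?_, fun t => ?_⟩
  · have : t / T < -1 := by rw [div_lt_iff₀ hT]; linarith
    rw [hI, h0 _ this, Complex.ofReal_zero]
    exact zero_smul _ _
  · rw [hI]
    change star ((h (t / T) : ℂ) • (freeEvolution G m t * (mulOp fun x => G.slash (A x)) *
      freeEvolution G m (-t))) = (h (t / T) : ℂ) • (freeEvolution G m t *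
        (mulOp fun x => G.slash (A x)) * freeEvolution G m (-t))
    have e1 : star (mulOp fun x => G.slash (A x)) = mulOp fun x => G.slash (A x) :=
      adjoint_mulOp ha.memLp fun x => slash_selfAdjoint G (A x)
    have e2 : ∀ t, star (freeEvolution G m t) = freeEvolution G m (-t) :=
      adjoint_freeEvolution G hm
    rw [star_smul, star_mul, star_mul, e1, e2, e2, neg_neg, mul_assoc, RCLike.star_def,
      Complex.conj_ofReal]

/-- The Dyson series of a switched potential as a propagator. -/
def diracPropagator (G : DiracMatrices) {m : ℝ} (hm : 0 < m) {A : Space → Fin 4 → ℝ}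
    (hA : Continuous A) (hAc : HasCompactSupport A) {h : ℝ → ℝ} (hh : Continuous h)
    (h0 : ∀ t, t < -1 → h t = 0) (hle : ∀ t, |h t| ≤ 1) {T : ℝ} (hT : 0 < T) :
    Propagator (diracModel G hm) (mulOp fun x => G.slash (A x)) h T :=
  have hB := (isPerturbation_switched G hm hA hAc hh h0 hle hT).choose_spec
  have hI := fun s => interactionPicture_smul G hm hA hAc (switched h T A) s (h (s / T)) rfl
  { V := dysonV G m (switched h T A)
    Vinv := fun s => ContinuousLinearMap.adjoint (dysonV G m (switched h T A) s)
    V_mul_Vinv := hB.dysonSum_mul_adjoint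
    Vinv_mul_V := hB.adjoint_mul_dysonSum
    V_norm := hB.norm_dysonSum_le
    Vinv_norm := fun s => (LinearIsometryEquiv.norm_map _ _).trans_le (hB.norm_dysonSum_le s)
    V_deriv := fun s => (hB.dysonSum_strongDerivAt s).congr_deriv (by rw [hI]; rfl)
    Vinv_deriv := fun s => (hB.adjoint_dysonSum_strongDerivAt s).congr_deriv (by rw [hI]; rfl)
    V_init := hB.dysonSum_early }

theorem timeDeriv_switched (h : ℝ → ℝ) (T : ℝ) (A : Space → Fin 4 → ℝ) :
    timeDeriv (switched h T A) = fun t x μ => (T⁻¹ * deriv h (t / T)) * A x μ := by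
  funext t x μ
  have e : (fun s => switched h T A s x μ) = fun s => h (T⁻¹ * s) * A x μ := by
    funext s; simp only [switched]; rw [div_eq_inv_mul]
  rw [timeDeriv, e, deriv_mul_const_field, deriv_comp_mul_left, smul_eq_mul, div_eq_inv_mul]

theorem smoothedInteraction_switched_eq (G : DiracMatrices) {m : ℝ} (hm : 0 < m)
    {A : Space → Fin 4 → ℝ} (hA : Continuous A) (hAc : HasCompactSupport A) {h : ℝ → ℝ}
    (hh : ContDiff ℝ ∞ h) (h0 : ∀ t, t < -1 → h t = 0) (h1 : ∀ t, 0 < t → h t = 1)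
    (hle : ∀ t, |h t| ≤ 1) {T : ℝ} (hT : 0 < T) (f : OneParticle) :
    smoothedInteraction G m T (switched h T A) f = ∫ s in (-T)..0,
      ((diracPropagator G hm hA hAc hh.continuous h0 hle hT).V s *
        ((T⁻¹ * deriv h (s / T) : ℝ) : ℂ) • (diracModel G hm).conj s (mulOp fun x => G.slash (A x)) *
        (diracPropagator G hm hA hAc hh.continuous h0 hle hT).Vinv s) f := by
  rw [(smoothedInteraction_switched_apply G m hh h0 h1 hA hAc hT f).2,
    intervalIntegral.integral_of_le (by linarith), ← integral_Icc_eq_integral_Ioc]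
  refine integral_congr_ae (ae_of_all _ fun s => ?_)
  beta_reduce
  rw [interactionPicture_smul G hm hA hAc _ s (T⁻¹ * deriv h (s / T))
    (congrFun (timeDeriv_switched h T A) s)]
  rfl

end DiracSwitching

end

noncomputable section

namespace DiracSwitching

/-! ### Smooth switching functions -/

theorem switching_mem_Icc {h : ℝ → ℝ} (hh : ContDiff ℝ ∞ h) (h0 : ∀ t, t < -1 → h t = 0)
    (h1 : ∀ t, 0 < t → h t = 1) (hd : ∀ t, 0 ≤ deriv h t) (t : ℝ) : 0 ≤ h t ∧ h t ≤ 1 := by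
  have hm : Monotone h := monotone_of_deriv_nonneg (hh.differentiable (by simp)) hd
  constructor
  · rw [← h0 (min t (-1) - 1) (by linarith [min_le_right t (-1)])]
    exact hm (by linarith [min_le_left t (-1)])
  · rw [← h1 (max t 0 + 1) (by linarith [le_max_right t 0])]
    exact hm (by linarith [le_max_left t 0])

/-- The switching function is prescribed only outside the closed interval `[-1, 0]`; continuity
supplies the endpoint values that remove the boundary terms. -/
theorem eq_of_eqOn_Iio {g : ℝ → ℝ} (hg : Continuous g) {a c : ℝ} (h : ∀ t, t < a → g t = c) :
    g a = c := by
  have h1 : Set.EqOn g (fun _ => c) (closure (Set.Iio a)) :=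
    Set.EqOn.closure (fun t ht => h t ht) hg continuous_const
  rw [closure_Iio] at h1
  exact h1 Set.self_mem_Iic

theorem eq_of_eqOn_Ioi {g : ℝ → ℝ} (hg : Continuous g) {a c : ℝ} (h : ∀ t, a < t → g t = c) :
    g a = c := by
  have h1 : Set.EqOn g (fun _ => c) (closure (Set.Ioi a)) :=
    Set.EqOn.closure (fun t ht => h t ht) hg continuous_const
  rw [closure_Ioi] at h1
  exact h1 Set.self_mem_Ici

/-- The Hilbert-Schmidt bound of order `T⁻²` for the smoothed interaction of a slowly switched
potential. -/
theorem exists_hsNorm_smoothedInteraction_le (G : DiracMatrices) {m : ℝ} (hm : 0 < m)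
    {S : Set Space} (hS : IsCompact S) :
    ∃ δ : ℝ, 0 < δ ∧
      ∀ A : Space → Fin 4 → ℝ, Continuous A → tsupport A ⊆ S →
        eLpNorm (𝓕 fun x => G.slash (A x)) 1 volume < ENNReal.ofReal δ →
      ∀ h : ℝ → ℝ, ContDiff ℝ ∞ h → (∀ t, t < -1 → h t = 0) → (∀ t, 0 < t → h t = 1) →
        (∀ t, 0 ≤ deriv h t) →
      ∃ C : ℝ, 0 < C ∧ ∀ T : ℝ, 0 < T →
        hsNorm (posProj G m ∘L smoothedInteraction G m T (switched h T A) ∘L negProj G m) ≤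
          ENNReal.ofReal (C / T ^ 2) := by
  obtain ⟨w, b, -⟩ := exists_hilbertBasis ℂ OneParticle
  obtain ⟨δ, hδ, H⟩ := exists_adiabaticFrame (b := b) (𝓦 := diracWeight G hm)
  have hK : 0 ≤ cutoffConst m S := Real.sqrt_nonneg _
  -- The norm in the weighted class is the maximum of the operator norm, at most `B`, and the
  -- weighted Hilbert–Schmidt norm, at most `B` times `cutoffConst m S`. Dividing by `1 +
  -- cutoffConst m S` puts both below the threshold of the frame construction.
  refine ⟨δ / (1 + cutoffConst m S), by positivity, fun A hA hAS hAn h hh h0 h1 hd => ?_⟩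
  have hAc : HasCompactSupport A := hS.of_isClosed_subset (isClosed_tsupport A) hAS
  set a : Space → SpinorOp := fun x => G.slash (A x) with ha
  have hac : HasCompactSupport a := hAc.comp_left (g := G.slash) (slash_zero G)
  have hac' : Continuous a := (slash_continuous G).comp hA
  have haS : tsupport a ⊆ S :=
    (closure_mono (Function.support_comp_subset (slash_zero G) A)).trans hAS
  set B := (eLpNorm (𝓕 a) 1 volume).toReal
  have hBe : eLpNorm (𝓕 a) 1 volume = ENNReal.ofReal B :=
    (ENNReal.ofReal_toReal hAn.ne_top).symm
  have hB0 : 0 ≤ B := ENNReal.toReal_nonneg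
  have hBδ : B < δ / (1 + cutoffConst m S) := by
    rw [hBe] at hAn
    exact (ENNReal.ofReal_lt_ofReal_iff (by positivity)).1 hAn
  have hB : ∀ x, ‖a x‖ ≤ B := norm_le_of_eLpNorm_fourier hac' hac hB0 hBe.le
  have hHS : HSLe b ((diracWeight G hm).G * (diracWeight G hm).G * mulOp a)
      (B * cutoffConst m S) := by
    rw [diracWeight_sq]
    exact hsLe_energyOp_mulOp b hm hac' hac hS haS hB
  set x := WeightedHS.mk ⟨_, hHS⟩ with hx
  have hxo : WeightedHS.op b _ x = mulOp a := WeightedHS.op_mk _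
  have hxn : ‖x‖ < δ := by
    have h2 : ‖x‖ ≤ max ‖WeightedHS.op b _ x‖ (B * cutoffConst m S) :=
      WeightedHS.norm_le_of_hsLe (by rw [hxo]; exact hHS)
    rw [hxo] at h2
    rw [lt_div_iff₀ (by positivity)] at hBδ
    refine h2.trans_lt (max_lt ((mulOp_norm_le hB0 hB).trans_lt ?_) ?_)
    · nlinarith
    · nlinarith
  have hI := switching_mem_Icc hh h0 h1 hd
  obtain ⟨𝓖⟩ := H x hxn h hh (fun t => (hI t).1) (fun t => (hI t).2)
  rw [hxo] at 𝓖
  have hdc : Continuous (deriv h) := hh.continuous_deriv (by simp)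
  have hd0 : ∀ t, t < -1 → deriv h t = 0 := fun t ht => by
    have : h =ᶠ[𝓝 t] fun _ => 0 := by
      filter_upwards [Iio_mem_nhds ht] with s hs using h0 s hs
    rw [this.deriv_eq, deriv_const]
  have hd1 : ∀ t, 0 < t → deriv h t = 0 := fun t ht => by
    have : h =ᶠ[𝓝 t] fun _ => 1 := by
      filter_upwards [Ioi_mem_nhds ht] with s hs using h1 s hs
    rw [this.deriv_eq, deriv_const]
  obtain ⟨C, hC, hCT⟩ := 𝓖.exists_hsLe_offDiag hh (eq_of_eqOn_Iio hh.continuous h0)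
    (eq_of_eqOn_Iio hdc hd0) (eq_of_eqOn_Ioi hdc hd1)
  refine ⟨C, hC, fun T hT => ?_⟩
  have hle : ∀ t, |h t| ≤ 1 := fun t => by rw [abs_of_nonneg (hI t).1]; exact (hI t).2
  have h2 := hCT T hT (diracPropagator G hm hA hAc hh.continuous h0 hle hT)
    (smoothedInteraction G m T (switched h T A))
    (smoothedInteraction_switched_eq G hm hA hAc hh h0 h1 hle hT)
  rw [diracModel_P, mul_assoc] at h2
  exact hsNorm_le_of_hsLe h2

end DiracSwitching

end

theorem mainTheorem4 (G : DiracSwitching.DiracMatrices) (m : ℝ) (hm : 0 < m)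
    (S : Set DiracSwitching.Space) (hS : IsCompact S) :
    ∃ δ : ℝ, 0 < δ ∧
      ∀ A : DiracSwitching.Space → Fin 4 → ℝ, ContDiff ℝ ∞ A → tsupport A ⊆ S →
        DiracSwitching.fourierNorm (fun x => G.slash (A x)) < ENNReal.ofReal δ →
      ∀ h : ℝ → ℝ, ContDiff ℝ ∞ h → (∀ t, t < -1 → h t = 0) → (∀ t, 0 < t → h t = 1) →
        (∀ t, 0 ≤ deriv h t) →
      (∃ C : ℝ, 0 < C ∧ ∀ T : ℝ, 0 < T →
        DiracSwitching.hsNorm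
          (DiracSwitching.posProj G m ∘L
            DiracSwitching.smoothedInteraction G m T (DiracSwitching.switched h T A) ∘L
            DiracSwitching.negProj G m) ≤ ENNReal.ofReal (C / T ^ 2)) ∧
      Tendsto (fun T : ℝ => DiracSwitching.hsNorm
          (DiracSwitching.posProj G m ∘L
            DiracSwitching.smoothedInteraction G m T (DiracSwitching.switched h T A) ∘L
            DiracSwitching.negProj G m)) atTop (𝓝 0) := by
  obtain ⟨δ, hδ, H⟩ := DiracSwitching.exists_hsNorm_smoothedInteraction_le G hm hS
  refine ⟨δ, hδ, fun A hA hAS hAn h hh h0 h1 hd => ?_⟩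
  obtain ⟨C, hC, hCT⟩ := H A hA.continuous hAS ((le_max_left _ _).trans_lt hAn) h hh h0 h1 hd
  refine ⟨⟨C, hC, hCT⟩, ?_⟩
  have h1 : Tendsto (fun T : ℝ => ENNReal.ofReal (C / T ^ 2)) atTop (𝓝 0) := by
    rw [← ENNReal.ofReal_zero]
    exact (ENNReal.continuous_ofReal.tendsto 0).comp
      (tendsto_const_nhds.div_atTop (tendsto_pow_atTop two_ne_zero))
  refine tendsto_of_tendsto_of_tendsto_of_le_of_le' tendsto_const_nhds h1
    (Eventually.of_forall fun _ => zero_le) ?_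
  filter_upwards [eventually_gt_atTop 0] with T hT using hCT T hT
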